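/- All Lie algebras and modules are real and finite-dimensional; a scalar product is a non-degenerate symmetric bilinear form of any signature. **Setting.** A Lie algebra with involution $(\mathfrak l,\theta_{\mathfrak l})$ is a Lie algebra with an automorphism satisfying $\theta_{\mathfrak l}^2=\mathrm{Id}$; $\mathfrak l_\pm$ are its $\pm1$-eigenspaces. A metric Lie algebra with involution $(\mathfrak g,\theta,\langle\cdot,\cdot\rangle)$ is a Lie algebra with involution with an invariant scalar product for which $\theta$ is isometric; it is a *symmetric triple* if $[\mathfrak g_-,\mathfrak g_-]=\mathfrak g_+$ and $\mathfrak g_+$ acts faithfully on $\mathfrak g_-$. An isomorphism of symmetric triples is an isometric Lie algebra isomorphism commuting with the involutions. An orthogonal $(\mathfrak l,\theta_{\mathfrak l})$-module is a representation $\rho$ of $\mathfrak l$ on a space $\mathfrak a$ with a scalar product $\langle\cdot,\cdot\rangle_{\mathfrak a}$ for which all $\rho(L)$ are skew, and an isometry $\theta_{\mathfrak a}$ with $\theta_{\mathfrak a}^2=\mathrm{Id}$ and $\theta_{\mathfrak a}\rho(\theta_{\mathfrak l}L)=\rho(L)\theta_{\mathfrak a}$. **Quadratic cohomology.** Let $C^p(\mathfrak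 l,\mathfrak a)$ and $C^p(\mathfrak l)$ be the spaces of alternating $p$-linear maps with values in $\mathfrak a$ and in $\mathbb R$ (trivial module), $d$ the Lie algebra differentials, and $\langle\cdot\wedge\cdot\rangle$ the wedge product (signed sum over shuffles) followed by $\langle\cdot,\cdot\rangle_{\mathfrak a}$. The lower index $+$ denotes cochains invariant under the action of $(\theta_{\mathfrak l},\theta_{\mathfrak a})$, that is $\theta_{\mathfrak a}\circ\theta_{\mathfrak l}^*\alpha=\alpha$, resp. $\theta_{\mathfrak l}^*\gamma=\gamma$. Put $$\mathcal Z^2_Q(\mathfrak l,\mathfrak a)_+=\{(\alpha,\gamma)\in C^2(\mathfrak l,\mathfrak a)_+\oplus C^3(\mathfrak l)_+ : d\alpha=0,\ d\gamma=\tfrac12\langle\alpha\wedge\alpha\rangle\},$$ and let $\mathcal H^2_Q(\mathfrak l,\theta_{\mathfrak l},\mathfrak a)$ be its quotient by the equivalence relation $(\alpha,\gamma)\sim(\alpha+d\tau,\ \gamma+d\sigma+\langle(\alpha+\frac12d\tau)\wedge\tau\rangle)$, $\tau\in C^1(\mathfrak l,\mathfrak a)_+$, $\sigma\in C^2(\mathfrak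 l)_+$. The class of $(\alpha,\gamma)$ is $[\alpha,\gamma]$. **Isomorphisms of triples.** An isomorphism of triples $(S,U):(\mathfrak l_1,\theta_{\mathfrak l_1},\mathfrak a_1)\to(\mathfrak l_2,\theta_{\mathfrak l_2},\mathfrak a_2)$ is a Lie algebra isomorphism $S:\mathfrak l_1\to\mathfrak l_2$ and a bijective linear isometry $U:\mathfrak a_2\to\mathfrak a_1$, both commuting with the involutions, with $U\circ\rho_2(S(L))=\rho_1(L)\circ U$ for all $L\in\mathfrak l_1$. It induces $(S,U)^*[\alpha,\gamma]=[U\circ S^*\alpha,\ S^*\gamma]$ from $\mathcal H^2_Q(\mathfrak l_2,\theta_{\mathfrak l_2},\mathfrak a_2)$ to $\mathcal H^2_Q(\mathfrak l_1,\theta_{\mathfrak l_1},\mathfrak a_1)$. **Standard model.** For $(\alpha,\gamma)\in\mathcal Z^2_Q(\mathfrak l,\mathfrak a)_+$ let $\mathfrak d_{\alpha,\gamma}(\mathfrak l,\theta_{\mathfrak l},\mathfrak a)$ be the metric Lie algebra with involution on $\mathfrak l^*\oplus\mathfrak a\oplus\mathfrak l$ with $\langle Z_1+A_1+L_1,Z_2+A_2+L_2\rangle=\langle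 A_1,A_2\rangle_{\mathfrak a}+Z_1(L_2)+Z_2(L_1)$, $\theta=\theta_{\mathfrak l}^*\oplus\theta_{\mathfrak a}\oplus\theta_{\mathfrak l}$, $[\mathfrak l^*,\mathfrak l^*\oplus\mathfrak a]=0$, $[L_1,L_2]=\gamma(L_1,L_2,\cdot)+\alpha(L_1,L_2)+[L_1,L_2]_{\mathfrak l}$, $[L,A]=\rho(L)A-\langle A,\alpha(L,\cdot)\rangle_{\mathfrak a}$, $[L,Z]=\mathrm{ad}^*(L)Z=-Z([L,\cdot]_{\mathfrak l})$, $[A_1,A_2]=\langle\rho(\cdot)A_1,A_2\rangle_{\mathfrak a}$. **Admissibility.** A module is semi-simple if every submodule has a complementary submodule. Let $R_0(\mathfrak l)=\mathfrak l$, let $R_{k+1}(\mathfrak l)$ be the smallest ideal contained in $R_k(\mathfrak l)$ such that the $\mathfrak l$-module $R_k(\mathfrak l)/R_{k+1}(\mathfrak l)$ is semi-simple, and let $S(\mathfrak l)$ be the largest ideal that is a semi-simple $\mathfrak l$-module. If $\rho$ is semi-simple, then $\mathfrak a=\mathfrak a^{\mathfrak l}\oplus\rho(\mathfrak l)\mathfrak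 a$, and $\alpha_0$ is the $\mathfrak a^{\mathfrak l}$-component of $\alpha$, regarded as a linear map on $\Lambda^2\mathfrak l$. The set $\mathcal H^2_Q(\mathfrak l,\theta_{\mathfrak l},\mathfrak a)_\sharp$ of admissible classes consists of the classes $[\alpha,\gamma]$ such that $(T_1)$ holds, $\rho$ is semi-simple, and $(T_2)$ and all $(A_k)$, $(B_k)$, $k\ge0$, hold: * $(T_1)$ $[\mathfrak l_-,\mathfrak l_-]=\mathfrak l_+$. * $(T_2)$ $\mathfrak a^{\mathfrak l}\cap\mathfrak a_+=\alpha_0(\ker([\cdot,\cdot]:\Lambda^2\mathfrak l_-\to\mathfrak l))$, where $\mathfrak a_+=\ker(\theta_{\mathfrak a}-\mathrm{Id})$. * $(A_0)$ If $L_0\in\mathfrak z(\mathfrak l)\cap\ker\rho$ and there are $A_0\in\mathfrak a$, $Z_0\in\mathfrak l^*$ with $\alpha(L,L_0)=\rho(L)A_0$ and $\gamma(L,L_0,\cdot)=-\langle A_0,\alpha(L,\cdot)\rangle_{\mathfrak a}+\langle Z_0,[L,\cdot]_{\mathfrak l}\rangle$ for all $L\in\mathfrak l$, then $L_0=0$.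 * $(B_0)$ The subspace $\alpha_0(\ker([\cdot,\cdot]:\Lambda^2\mathfrak l\to\mathfrak l))\subset\mathfrak a^{\mathfrak l}$ is non-degenerate. * $(A_k)$, $k\ge1$: If $\mathfrak k\subset S(\mathfrak l)\cap R_k(\mathfrak l)$ is an ideal of $\mathfrak l$ and there are $\Phi_1\in\mathrm{Hom}(\mathfrak k,\mathfrak a)$, $\Phi_2\in\mathrm{Hom}(\mathfrak k,R_k(\mathfrak l)^*)$ with $\alpha(L,K)=\rho(L)\Phi_1(K)-\Phi_1([L,K]_{\mathfrak l})$ and $\gamma(L,K,\cdot)=-\langle\Phi_1(K),\alpha(L,\cdot)\rangle_{\mathfrak a}+\langle\Phi_2(K),[L,\cdot]_{\mathfrak l}\rangle+\langle\Phi_2([L,K]_{\mathfrak l}),\cdot\rangle$ in $R_k(\mathfrak l)^*$ for all $L\in\mathfrak l$, $K\in\mathfrak k$, then $\mathfrak k=0$. * $(B_k)$, $k\ge1$: If $\mathfrak b_k\subset\mathfrak a$ is the maximal $\mathfrak l$-submodule for which there is $\Phi\in\mathrm{Hom}(R_k(\mathfrak l),\mathfrak a)$ with $\langle\alpha(L,K),B\rangle_{\mathfrak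 a}=\langle\rho(L)\Phi(K)-\Phi([L,K]_{\mathfrak l}),B\rangle_{\mathfrak a}$ for all $L\in\mathfrak l$, $K\in R_k(\mathfrak l)$, $B\in\mathfrak b_k$, then $\mathfrak b_k$ is non-degenerate. $(\mathfrak l,\theta_{\mathfrak l})$ is called admissible if $(T_1)$ holds and $\mathcal H^2_Q(\mathfrak l,\theta_{\mathfrak l},\mathfrak a)_\sharp\neq\emptyset$ for some semi-simple orthogonal $(\mathfrak l,\theta_{\mathfrak l})$-module $\mathfrak a$. **Proposition.** For $i=1,2$ let $(\mathfrak l_i,\theta_{\mathfrak l_i})$ be admissible Lie algebras with involution, $\mathfrak a_i$ orthogonal $(\mathfrak l_i,\theta_{\mathfrak l_i})$-modules, and $(\alpha_i,\gamma_i)\in\mathcal Z^2_Q(\mathfrak l_i,\mathfrak a_i)_+$ with $[\alpha_i,\gamma_i]\in\mathcal H^2_Q(\mathfrak l_i,\theta_{\mathfrak l_i},\mathfrak a_i)_\sharp$. Then $\mathfrak d_{\alpha_1,\gamma_1}(\mathfrak l_1,\theta_{\mathfrak l_1},\mathfrak a_1)$ and $\mathfrak d_{\alpha_2,\gamma_2}(\mathfrak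 l_2,\theta_{\mathfrak l_2},\mathfrak a_2)$ are symmetric triples, and they are isomorphic as symmetric triples if and only if there is an isomorphism of triples $(S,U):(\mathfrak l_1,\theta_{\mathfrak l_1},\mathfrak a_1)\to(\mathfrak l_2,\theta_{\mathfrak l_2},\mathfrak a_2)$ such that $$(S,U)^*[\alpha_2,\gamma_2]=[\alpha_1,\gamma_1].$$ -/

import Mathlib

open LieModule.Cohomology

noncomputable section

namespace SymTriple

/-! ### Lie algebras with involution -/

/-- An involutive automorphism of a real Lie algebra. -/
structure LieInvolution (L : Type*) [LieRing L] [LieAlgebra ℝ L] where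
  toHom : L →ₗ⁅ℝ⁆ L
  involutive : ∀ x, toHom (toHom x) = x

instance {L : Type*} [LieRing L] [LieAlgebra ℝ L] :
    CoeFun (LieInvolution L) (fun _ => L → L) := ⟨fun θ => θ.toHom⟩

namespace LieInvolution

variable {L : Type*} [LieRing L] [LieAlgebra ℝ L]

/-- The `+1`-eigenspace. -/
def plus (θ : LieInvolution L) : Submodule ℝ L :=
  Module.End.eigenspace (θ.toHom : L →ₗ[ℝ] L) 1

/-- The `-1`-eigenspace. -/
def minus (θ : LieInvolution L) : Submodule ℝ L :=
  Module.End.eigenspace (θ.toHom : L →ₗ[ℝ] L) (-1)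

/-- `[𝔩₋, 𝔩₋] = 𝔩₊`, where `[𝔩₋, 𝔩₋]` is the linear span of the brackets. -/
def BracketMinusEqPlus (θ : LieInvolution L) : Prop :=
  Submodule.span ℝ {z : L | ∃ x ∈ θ.minus, ∃ y ∈ θ.minus, ⁅x, y⁆ = z} = θ.plus

/-- `𝔩₊` acts faithfully on `𝔩₋`. -/
def PlusFaithfulOnMinus (θ : LieInvolution L) : Prop :=
  ∀ x ∈ θ.plus, (∀ y ∈ θ.minus, ⁅x, y⁆ = 0) → x = 0

end LieInvolution

/-! ### Metric Lie algebras with involution and symmetric triples -/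

/-- The data turning a finite-dimensional Lie algebra into a metric Lie algebra with involution:
an invariant scalar product (non-degenerate symmetric bilinear form, of any signature)
and an isometric involutive automorphism. -/
structure MetricInvolution (G : Type*) [LieRing G] [LieAlgebra ℝ G] [FiniteDimensional ℝ G] where
  form : LinearMap.BilinForm ℝ G
  symm : ∀ x y, form x y = form y x
  nondegenerate : form.Nondegenerate
  invariant : ∀ x y z : G, form ⁅x, y⁆ z + form y ⁅x, z⁆ = 0
  invol : LieInvolution G
  isometry : ∀ x y, form (invol x) (invol y) = form x y

/-- A metric Lie algebra with involution is a symmetric triple if `[𝔤₋, 𝔤₋] = 𝔤₊` and `𝔤₊` acts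
faithfully on `𝔤₋`. -/
def MetricInvolution.IsSymmetricTriple {G : Type*} [LieRing G] [LieAlgebra ℝ G]
    [FiniteDimensional ℝ G] (m : MetricInvolution G) : Prop :=
  m.invol.BracketMinusEqPlus ∧ m.invol.PlusFaithfulOnMinus

/-- Isomorphisms of metric Lie algebras with involution (in particular of symmetric triples):
isometric Lie algebra isomorphisms which intertwine the involutions. -/
structure MetricInvolution.Iso {G₁ G₂ : Type*} [LieRing G₁] [LieAlgebra ℝ G₁]
    [FiniteDimensional ℝ G₁] [LieRing G₂] [LieAlgebra ℝ G₂] [FiniteDimensional ℝ G₂]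
    (m₁ : MetricInvolution G₁) (m₂ : MetricInvolution G₂) where
  toEquiv : G₁ ≃ₗ⁅ℝ⁆ G₂
  isometry : ∀ x y, m₂.form (toEquiv x) (toEquiv y) = m₁.form x y
  comm : ∀ x, toEquiv (m₁.invol x) = m₂.invol (toEquiv x)

/-! ### Orthogonal modules -/

/-- The data turning a finite-dimensional `L`-module `A` (the representation `ρ` is the module
action `⁅x, a⁆ = ρ(x) a`) into an orthogonal `(L, θ)`-module. -/
structure OrthogonalModule {L : Type*} [LieRing L] [LieAlgebra ℝ L] (θ : LieInvolution L)
    (A : Type*) [AddCommGroup A] [Module ℝ A] [FiniteDimensional ℝ A]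
    [LieRingModule L A] [LieModule ℝ L A] where
  form : LinearMap.BilinForm ℝ A
  symm : ∀ a b, form a b = form b a
  nondegenerate : form.Nondegenerate
  invariant : ∀ (x : L) (a b : A), form ⁅x, a⁆ b + form a ⁅x, b⁆ = 0
  invol : A →ₗ[ℝ] A
  involutive : ∀ a, invol (invol a) = a
  isometry : ∀ a b, form (invol a) (invol b) = form a b
  compat : ∀ (x : L) (a : A), invol ⁅θ x, a⁆ = ⁅x, invol a⁆

/-! ### Cochains -/

/-- The space `C³(𝔩)` of alternating trilinear forms. (`C¹(𝔩, 𝔞)` is `L →ₗ[ℝ] A`, while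
`C²(𝔩, 𝔞)` and `C²(𝔩)` are `twoCochain ℝ L A` and `twoCochain ℝ L ℝ`.) -/
def threeCochain (L : Type*) [LieRing L] [LieAlgebra ℝ L] :
    Submodule ℝ (L →ₗ[ℝ] L →ₗ[ℝ] L →ₗ[ℝ] ℝ) where
  carrier := {c | (∀ x y, c x x y = 0) ∧ ∀ x y, c x y y = 0}
  add_mem' {a b} ha hb := ⟨fun x y => by simp [ha.1 x y, hb.1 x y],
    fun x y => by simp [ha.2 x y, hb.2 x y]⟩
  zero_mem' := by simp
  smul_mem' t {c} hc := ⟨fun x y => by simp [hc.1 x y], fun x y => by simp [hc.2 x y]⟩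

section Cochains

variable {L : Type*} [LieRing L] [LieAlgebra ℝ L]
variable {A : Type*} [AddCommGroup A] [Module ℝ A]

/-- The values of `dσ ∈ C³(𝔩)` for `σ ∈ C²(𝔩)` (trivial coefficients). -/
def dTwo (σ : twoCochain ℝ L ℝ) (x y z : L) : ℝ :=
  - σ ⁅x, y⁆ z + σ ⁅x, z⁆ y - σ ⁅y, z⁆ x

/-- The values of `dγ ∈ C⁴(𝔩)` for `γ ∈ C³(𝔩)` (trivial coefficients). -/
def dThree (γ : threeCochain L) (x y z w : L) : ℝ :=
  - γ.1 ⁅x, y⁆ z w + γ.1 ⁅x, z⁆ y w - γ.1 ⁅x, w⁆ y z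
    - γ.1 ⁅y, z⁆ x w + γ.1 ⁅y, w⁆ x z - γ.1 ⁅z, w⁆ x y

/-- The values of `⟨α ∧ β⟩ ∈ C⁴(𝔩)` for `α, β ∈ C²(𝔩, 𝔞)`: signed sum over `(2,2)`-shuffles. -/
def wedgeTwoTwo (B : LinearMap.BilinForm ℝ A) (α β : twoCochain ℝ L A) (x y z w : L) : ℝ :=
  B (α x y) (β z w) - B (α x z) (β y w) + B (α x w) (β y z)
    + B (α y z) (β x w) - B (α y w) (β x z) + B (α z w) (β x y)

/-- The values of `⟨α ∧ τ⟩ ∈ C³(𝔩)` for `α ∈ C²(𝔩, 𝔞)` and `τ ∈ C¹(𝔩, 𝔞)`: signed sum over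
`(2,1)`-shuffles. -/
def wedgeTwoOne (B : LinearMap.BilinForm ℝ A) (α : twoCochain ℝ L A) (τ : L →ₗ[ℝ] A)
    (x y z : L) : ℝ :=
  B (α x y) (τ z) - B (α x z) (τ y) + B (α y z) (τ x)

/-- `⟨τ₁ ∧ τ₂⟩ ∈ C²(𝔩)` for `τ₁, τ₂ ∈ C¹(𝔩, 𝔞)`. -/
def wedgeOneOne (B : LinearMap.BilinForm ℝ A) (hB : ∀ a b, B a b = B b a) (τ₁ τ₂ : L →ₗ[ℝ] A) :
    twoCochain ℝ L ℝ :=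
  ⟨B.compl₁₂ τ₁ τ₂ - B.compl₁₂ τ₂ τ₁, fun x => by simp [hB (τ₁ x) (τ₂ x)]⟩

end Cochains

/-! ### Quadratic cohomology -/

section Cohomology

variable {L : Type*} [LieRing L] [LieAlgebra ℝ L] {θ : LieInvolution L}
variable {A : Type*} [AddCommGroup A] [Module ℝ A] [FiniteDimensional ℝ A]
  [LieRingModule L A] [LieModule ℝ L A]

/-- The set of `Θ`-invariant quadratic 2-cocycles: pairs `(α, γ) ∈ C²(𝔩, 𝔞) ⊕ C³(𝔩)` such that
`dα = 0`, `dγ = ½⟨α ∧ α⟩`, and both `α` and `γ` are fixed by the involution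
`(θ_𝔩, θ_𝔞)^*` on cochains. -/
@[ext]
structure QuadraticCocycle (M : OrthogonalModule θ A) where
  α : twoCochain ℝ L A
  γ : threeCochain L
  d_α : d₂₃ ℝ L A α = 0
  d_γ : ∀ x y z w, dThree γ x y z w = 1 / 2 * wedgeTwoTwo M.form α α x y z w
  α_invariant : ∀ x y, M.invol (α (θ x) (θ y)) = α x y
  γ_invariant : ∀ x y z, γ.1 (θ x) (θ y) (θ z) = γ.1 x y z

theorem OrthogonalModule.form_lie (M : OrthogonalModule θ A) (x : L) (a b : A) :
    M.form ⁅x, a⁆ b = - M.form a ⁅x, b⁆ :=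
  eq_neg_of_add_eq_zero_left (M.invariant x a b)

/-- Two invariant quadratic cocycles lie in the same orbit of the group of invariant quadratic
1-cochains: there are `Θ`-invariant `τ ∈ C¹(𝔩, 𝔞)` and `σ ∈ C²(𝔩)` with
`(α', γ') = (α, γ)(τ, σ) = (α + dτ, γ + dσ + ⟨(α + ½ dτ) ∧ τ⟩)`. -/
def Cohomologous (M : OrthogonalModule θ A) (c c' : QuadraticCocycle M) : Prop :=
  ∃ (τ : L →ₗ[ℝ] A) (σ : twoCochain ℝ L ℝ),
    (∀ x, M.invol (τ (θ x)) = τ x) ∧ (∀ x y, σ (θ x) (θ y) = σ x y) ∧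
    c'.α = c.α + d₁₂ ℝ L A τ ∧
    ∀ x y z, c'.γ.1 x y z = c.γ.1 x y z + dTwo σ x y z
      + wedgeTwoOne M.form (c.α + (1 / 2 : ℝ) • d₁₂ ℝ L A τ) τ x y z

theorem Cohomologous.refl (M : OrthogonalModule θ A) (c : QuadraticCocycle M) :
    Cohomologous M c c := by
  have h0 (x y : L) : (0 : twoCochain ℝ L ℝ) x y = 0 := rfl
  exact ⟨0, 0, by simp, fun x y => by simp [h0], by simp, fun x y z => by
    simp [dTwo, wedgeTwoOne, h0]⟩

theorem Cohomologous.symm {M : OrthogonalModule θ A} {c c' : QuadraticCocycle M}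
    (h : Cohomologous M c c') : Cohomologous M c' c := by
  obtain ⟨τ, σ, hτ, hσ, hα, hγ⟩ := h
  have hn (x y : L) : ((-1 : ℝ) • σ) x y = - σ x y := by simp
  refine ⟨-τ, (-1 : ℝ) • σ, by simp [hτ], fun x y => by simp [hn, hσ],
    by rw [hα, map_neg]; module, fun x y z => ?_⟩
  have e : c'.α + (1 / 2 : ℝ) • d₁₂ ℝ L A (-τ) = c.α + (1 / 2 : ℝ) • d₁₂ ℝ L A τ := by
    rw [hα, map_neg]; module
  rw [hγ, e]
  simp only [dTwo, wedgeTwoOne, hn, LinearMap.neg_apply, map_neg]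
  ring

theorem Cohomologous.trans {M : OrthogonalModule θ A} {c c' c'' : QuadraticCocycle M}
    (h : Cohomologous M c c') (h' : Cohomologous M c' c'') : Cohomologous M c c'' := by
  obtain ⟨τ, σ, hτ, hσ, hα, hγ⟩ := h
  obtain ⟨τ', σ', hτ', hσ', hα', hγ'⟩ := h'
  have hs (x y : L) : (σ + σ' + (1 / 2 : ℝ) • wedgeOneOne M.form M.symm τ τ') x y
      = σ x y + σ' x y + 1 / 2 * (M.form (τ x) (τ' y) - M.form (τ' x) (τ y)) := rfl
  refine ⟨τ + τ', σ + σ' + (1 / 2 : ℝ) • wedgeOneOne M.form M.symm τ τ', fun x => by simp [hτ, hτ'],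
    fun x y => ?_, by rw [hα', hα, map_add, add_assoc], fun x y z => ?_⟩
  · rw [hs, hs, hσ, hσ', ← hτ x, ← hτ y, ← hτ' x, ← hτ' y, M.isometry, M.isometry]
  · rw [hγ', hγ, hα]
    simp only [dTwo, hs, wedgeTwoOne, LinearMap.add_apply, map_add, add_apply_apply,
      smul_apply_apply, d₁₂_apply_apply, map_sub, map_smul, LinearMap.smul_apply,
      LinearMap.sub_apply, smul_eq_mul]
    have i (u : L) (a b : A) : M.form ⁅u, a⁆ b = - M.form ⁅u, b⁆ a := by
      rw [M.symm ⁅u, b⁆ a]; linarith [M.invariant u a b]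
    rw [M.symm (τ' ⁅x, y⁆) (τ z), M.symm (τ' ⁅x, z⁆) (τ y), M.symm (τ' ⁅y, z⁆) (τ x),
      i x (τ y) (τ' z), i y (τ x) (τ' z), i x (τ z) (τ' y), i z (τ x) (τ' y), i y (τ z) (τ' x),
      i z (τ y) (τ' x), M.symm (τ z) (τ' ⁅x, y⁆), M.symm (τ y) (τ' ⁅x, z⁆),
      M.symm (τ x) (τ' ⁅y, z⁆)]
    ring

/-- The orbit equivalence relation on invariant quadratic cocycles. -/
instance cocycleSetoid (M : OrthogonalModule θ A) : Setoid (QuadraticCocycle M) where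
  r := Cohomologous M
  iseqv := ⟨Cohomologous.refl M, Cohomologous.symm, Cohomologous.trans⟩

/-- The quadratic cohomology set `H²_Q(𝔩, θ_𝔩, 𝔞)`. -/
def QuadraticCohomology (M : OrthogonalModule θ A) : Type _ := Quotient (cocycleSetoid M)

/-- The class `[α, γ]`. -/
def QuadraticCocycle.cls {M : OrthogonalModule θ A} (c : QuadraticCocycle M) :
    QuadraticCohomology M := Quotient.mk (cocycleSetoid M) c

end Cohomology

/-! ### Isomorphisms of triples and pull-back -/

section Triples

variable {L₁ : Type*} [LieRing L₁] [LieAlgebra ℝ L₁] {θ₁ : LieInvolution L₁}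
variable {A₁ : Type*} [AddCommGroup A₁] [Module ℝ A₁] [FiniteDimensional ℝ A₁]
  [LieRingModule L₁ A₁] [LieModule ℝ L₁ A₁]
variable {L₂ : Type*} [LieRing L₂] [LieAlgebra ℝ L₂] {θ₂ : LieInvolution L₂}
variable {A₂ : Type*} [AddCommGroup A₂] [Module ℝ A₂] [FiniteDimensional ℝ A₂]
  [LieRingModule L₂ A₂] [LieModule ℝ L₂ A₂]

/-- An isomorphism of triples `(S, U) : (𝔩₁, θ₁, 𝔞₁) → (𝔩₂, θ₂, 𝔞₂)`. Note that `U` maps in the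
reverse direction. -/
structure TripleIso (M₁ : OrthogonalModule θ₁ A₁) (M₂ : OrthogonalModule θ₂ A₂) where
  S : L₁ ≃ₗ⁅ℝ⁆ L₂
  U : A₂ ≃ₗ[ℝ] A₁
  S_comm : ∀ x, S (θ₁ x) = θ₂ (S x)
  U_comm : ∀ a, U (M₂.invol a) = M₁.invol (U a)
  U_isometry : ∀ a b, M₁.form (U a) (U b) = M₂.form a b
  equivariant : ∀ (x : L₁) (a : A₂), U ⁅S x, a⁆ = ⁅x, U a⁆

namespace TripleIso

variable {M₁ : OrthogonalModule θ₁ A₁} {M₂ : OrthogonalModule θ₂ A₂}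

/-- `U ∘ S^*α`. -/
def pullTwo (T : TripleIso M₁ M₂) (α : twoCochain ℝ L₂ A₂) : twoCochain ℝ L₁ A₁ :=
  ⟨(α.1.compl₁₂ (T.S : L₁ →ₗ[ℝ] L₂) (T.S : L₁ →ₗ[ℝ] L₂)).compr₂ (T.U : A₂ →ₗ[ℝ] A₁),
    fun x => by simp⟩

/-- `S^*γ`. -/
def pullThree (T : TripleIso M₁ M₂) (γ : threeCochain L₂) : threeCochain L₁ :=
  ⟨(γ.1.compl₁₂ (T.S : L₁ →ₗ[ℝ] L₂) (T.S : L₁ →ₗ[ℝ] L₂)).compr₂ (LinearMap.lcomp ℝ ℝ (T.S : L₁ →ₗ[ℝ] L₂)),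
    ⟨fun x y => by simpa using γ.2.1 (T.S x) (T.S y), fun x y => by simpa using γ.2.2 (T.S x) (T.S y)⟩⟩

@[simp] theorem pullTwo_apply (T : TripleIso M₁ M₂) (α : twoCochain ℝ L₂ A₂) (x y : L₁) :
    T.pullTwo α x y = T.U (α (T.S x) (T.S y)) := rfl

@[simp] theorem pullThree_apply (T : TripleIso M₁ M₂) (γ : threeCochain L₂) (x y z : L₁) :
    (T.pullThree γ).1 x y z = γ.1 (T.S x) (T.S y) (T.S z) := rfl

/-- The pull-back `(S, U)^*` on invariant quadratic cocycles:
`(α, γ) ↦ (U ∘ S^*α, S^*γ)`. -/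
def pullCocycle (T : TripleIso M₁ M₂) (c : QuadraticCocycle M₂) : QuadraticCocycle M₁ where
  α := T.pullTwo c.α
  γ := T.pullThree c.γ
  d_α := by
    ext x y z
    have h := congrArg T.U (congrArg (fun f => f (T.S x) (T.S y) (T.S z)) c.d_α)
    simpa [T.equivariant, LieEquiv.map_lie] using h
  d_γ x y z w := by
    have h := c.d_γ (T.S x) (T.S y) (T.S z) (T.S w)
    simpa [dThree, wedgeTwoTwo, T.U_isometry, LieEquiv.map_lie] using h
  α_invariant x y := by
    rw [pullTwo_apply, pullTwo_apply, ← T.U_comm, T.S_comm, T.S_comm, c.α_invariant]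
  γ_invariant x y z := by
    rw [pullThree_apply, pullThree_apply, T.S_comm, T.S_comm, T.S_comm, c.γ_invariant]

theorem pullCocycle_cohomologous (T : TripleIso M₁ M₂) (c c' : QuadraticCocycle M₂)
    (h : Cohomologous M₂ c c') : Cohomologous M₁ (T.pullCocycle c) (T.pullCocycle c') := by
  obtain ⟨τ, σ, hτ, hσ, hα, hγ⟩ := h
  refine ⟨(T.U : A₂ →ₗ[ℝ] A₁) ∘ₗ τ ∘ₗ (T.S : L₁ →ₗ[ℝ] L₂),
    ⟨σ.1.compl₁₂ (T.S : L₁ →ₗ[ℝ] L₂) (T.S : L₁ →ₗ[ℝ] L₂), fun x => by simp⟩,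
    fun x => ?_, fun x y => ?_, ?_, fun x y z => ?_⟩
  · simp [← T.U_comm, T.S_comm, hτ]
  · have h := hσ (T.S x) (T.S y)
    rw [← T.S_comm, ← T.S_comm] at h
    exact h
  · apply Subtype.ext
    ext x y
    change T.U (c'.α (T.S x) (T.S y)) = _
    rw [hα]
    change T.U (c.α (T.S x) (T.S y) + (⁅T.S x, τ (T.S y)⁆ - ⁅T.S y, τ (T.S x)⁆ - τ ⁅T.S x, T.S y⁆))
      = T.U (c.α (T.S x) (T.S y)) +
        (⁅x, T.U (τ (T.S y))⁆ - ⁅y, T.U (τ (T.S x))⁆ - T.U (τ (T.S ⁅x, y⁆)))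
    simp [T.equivariant, LieEquiv.map_lie]
  · have h := hγ (T.S x) (T.S y) (T.S z)
    have hp (x y : L₁) : (⟨σ.1.compl₁₂ (T.S : L₁ →ₗ[ℝ] L₂) (T.S : L₁ →ₗ[ℝ] L₂),
        fun x => by simp⟩ : twoCochain ℝ L₁ ℝ) x y = σ (T.S x) (T.S y) := rfl
    have hq (x y : L₁) : (T.pullTwo c.α + (1 / 2 : ℝ) • d₁₂ ℝ L₁ A₁
        ((T.U : A₂ →ₗ[ℝ] A₁) ∘ₗ τ ∘ₗ (T.S : L₁ →ₗ[ℝ] L₂))) x y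
        = T.U ((c.α + (1 / 2 : ℝ) • d₁₂ ℝ L₂ A₂ τ) (T.S x) (T.S y)) := by
      simp [T.equivariant, LieEquiv.map_lie]
    change c'.γ.1 (T.S x) (T.S y) (T.S z) = _
    rw [h]
    simp only [dTwo, wedgeTwoOne, hp]
    change _ = c.γ.1 (T.S x) (T.S y) (T.S z) + _ +
      (M₁.form ((T.pullTwo c.α + _) x y) _ - M₁.form ((T.pullTwo c.α + _) x z) _
        + M₁.form ((T.pullTwo c.α + _) y z) _)
    rw [hq, hq, hq]
    simp [T.U_isometry, LieEquiv.map_lie]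

/-- The map `(S, U)^* : H²_Q(𝔩₂, θ₂, 𝔞₂) → H²_Q(𝔩₁, θ₁, 𝔞₁)`. -/
def pullback (T : TripleIso M₁ M₂) : QuadraticCohomology M₂ → QuadraticCohomology M₁ :=
  Quotient.map T.pullCocycle T.pullCocycle_cohomologous

end TripleIso

end Triples

/-! ### The standard model `𝔡_{α,γ}(𝔩, θ, 𝔞)` -/

section StandardModel

variable {L : Type*} [LieRing L] [LieAlgebra ℝ L] {θ : LieInvolution L}
variable {A : Type*} [AddCommGroup A] [Module ℝ A] [FiniteDimensional ℝ A]
  [LieRingModule L A] [LieModule ℝ L A]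

/-- The vector space `𝔩^* ⊕ 𝔞 ⊕ 𝔩` underlying the standard model; its Lie bracket depends on
the cocycle `c = (α, γ)`. -/
def StdModel {M : OrthogonalModule θ A} (_c : QuadraticCocycle M) : Type _ :=
  Module.Dual ℝ L × A × L

namespace StdModel

variable {M : OrthogonalModule θ A} (c : QuadraticCocycle M)

instance : AddCommGroup (StdModel c) := inferInstanceAs (AddCommGroup (Module.Dual ℝ L × A × L))

instance : Module ℝ (StdModel c) := inferInstanceAs (Module ℝ (Module.Dual ℝ L × A × L))

instance [FiniteDimensional ℝ L] : FiniteDimensional ℝ (StdModel c) :=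
  inferInstanceAs (FiniteDimensional ℝ (Module.Dual ℝ L × A × L))

variable {c}

/-- The component in `𝔩^*`. -/
def dual (X : StdModel c) : Module.Dual ℝ L := X.1

/-- The component in `𝔞`. -/
def mid (X : StdModel c) : A := X.2.1

/-- The component in `𝔩`. -/
def base (X : StdModel c) : L := X.2.2

/-- The element `Z + B + x` of `𝔩^* ⊕ 𝔞 ⊕ 𝔩`. -/
def mk (Z : Module.Dual ℝ L) (B : A) (x : L) : StdModel c := (Z, B, x)

@[ext] theorem ext {X Y : StdModel c} (h₁ : ∀ x, X.dual x = Y.dual x) (h₂ : X.mid = Y.mid)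
    (h₃ : X.base = Y.base) : X = Y :=
  Prod.ext (LinearMap.ext h₁) (Prod.ext h₂ h₃)

@[simp] theorem dual_mk (Z : Module.Dual ℝ L) (B : A) (x : L) :
    (mk Z B x : StdModel c).dual = Z := rfl
@[simp] theorem mid_mk (Z : Module.Dual ℝ L) (B : A) (x : L) :
    (mk Z B x : StdModel c).mid = B := rfl
@[simp] theorem base_mk (Z : Module.Dual ℝ L) (B : A) (x : L) :
    (mk Z B x : StdModel c).base = x := rfl
@[simp] theorem dual_add (X Y : StdModel c) : (X + Y).dual = X.dual + Y.dual := rfl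
@[simp] theorem mid_add (X Y : StdModel c) : (X + Y).mid = X.mid + Y.mid := rfl
@[simp] theorem base_add (X Y : StdModel c) : (X + Y).base = X.base + Y.base := rfl
@[simp] theorem dual_smul (t : ℝ) (X : StdModel c) : (t • X).dual = t • X.dual := rfl
@[simp] theorem mid_smul (t : ℝ) (X : StdModel c) : (t • X).mid = t • X.mid := rfl
@[simp] theorem base_smul (t : ℝ) (X : StdModel c) : (t • X).base = t • X.base := rfl
@[simp] theorem dual_zero : (0 : StdModel c).dual = 0 := rfl
@[simp] theorem mid_zero : (0 : StdModel c).mid = 0 := rfl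
@[simp] theorem base_zero : (0 : StdModel c).base = 0 := rfl

/-- The bracket is determined by `[𝔩^*, 𝔩^* ⊕ 𝔞] = 0`,
`[x, y] = γ(x, y, ·) + α(x, y) + [x, y]_𝔩`, `[x, B] = ρ(x)B - ⟨B, α(x, ·)⟩`,
`[x, Z] = ad^*(x) Z = -Z([x, ·])` and `[B₁, B₂] = ⟨ρ(·)B₁, B₂⟩`. -/
instance : Bracket (StdModel c) (StdModel c) where
  bracket X Y := mk
    (c.γ.1 X.base Y.base
      - M.form Y.mid ∘ₗ c.α X.base + M.form X.mid ∘ₗ c.α Y.base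
      + ⁅X.base, Y.dual⁆ - ⁅Y.base, X.dual⁆
      + M.form Y.mid ∘ₗ (LieModule.toEnd ℝ L A : L →ₗ[ℝ] Module.End ℝ A).flip X.mid)
    (c.α X.base Y.base + ⁅X.base, Y.mid⁆ - ⁅Y.base, X.mid⁆)
    ⁅X.base, Y.base⁆

theorem dual_lie (X Y : StdModel c) (x : L) :
    (⁅X, Y⁆ : StdModel c).dual x = c.γ.1 X.base Y.base x
      - M.form Y.mid (c.α X.base x) + M.form X.mid (c.α Y.base x)
      - Y.dual ⁅X.base, x⁆ + X.dual ⁅Y.base, x⁆ + M.form ⁅x, X.mid⁆ Y.mid := by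
  rw [M.symm ⁅x, X.mid⁆]
  change _ + (- Y.dual ⁅X.base, x⁆) - (- X.dual ⁅Y.base, x⁆) + _ = _
  rw [sub_neg_eq_add, ← sub_eq_add_neg]
  rfl

@[simp] theorem mid_lie (X Y : StdModel c) :
    (⁅X, Y⁆ : StdModel c).mid = c.α X.base Y.base + ⁅X.base, Y.mid⁆ - ⁅Y.base, X.mid⁆ := rfl

@[simp] theorem base_lie (X Y : StdModel c) : (⁅X, Y⁆ : StdModel c).base = ⁅X.base, Y.base⁆ := rfl

theorem threeCochain_skew₁₂ (γ : threeCochain L) (x y z : L) : γ.1 y x z = - γ.1 x y z := by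
  have h := γ.2.1 (x + y) z
  simp only [map_add, LinearMap.add_apply, γ.2.1] at h
  linarith

theorem threeCochain_skew₂₃ (γ : threeCochain L) (x y z : L) : γ.1 x z y = - γ.1 x y z := by
  have h := γ.2.2 x (y + z)
  simp only [map_add, LinearMap.add_apply, γ.2.2] at h
  linarith

instance : LieRing (StdModel c) where
  add_lie X Y Z := by
    ext
    · simp [dual_lie]; ring
    · simp; abel
    · simp
  lie_add X Y Z := by
    ext
    · simp [dual_lie]; ring
    · simp; abel
    · simp
  lie_self X := by
    ext x
    · have h : M.form ⁅x, X.mid⁆ X.mid = 0 := by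
        have := M.invariant x X.mid X.mid
        rw [M.symm X.mid] at this
        linarith
      have h' := c.γ.2.1 X.base x
      simp only [dual_lie, h, h', dual_zero, LinearMap.zero_apply]
      ring
    · simp
    · simp
  leibniz_lie X Y Z := by
    ext w
    · simp only [dual_lie, mid_lie, base_lie, dual_add, LinearMap.add_apply, map_add, map_sub,
        LinearMap.sub_apply, lie_add, lie_sub, lie_lie]
      generalize X.base = x, Y.base = y, Z.base = z, X.mid = a, Y.mid = b, Z.mid = e
      have hd (p : A) (x y w : L) : M.form p ⁅x, c.α y w⁆ - M.form p ⁅y, c.α x w⁆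
          + M.form p ⁅w, c.α x y⁆ - M.form p (c.α ⁅x, y⁆ w) - M.form p (c.α y ⁅x, w⁆)
          + M.form p (c.α x ⁅y, w⁆) = 0 := by
        have h := congrArg (fun f => M.form p (f x y w)) c.d_α
        simp only [d₂₃_apply, map_add, map_sub, LinearMap.zero_apply, map_zero] at h
        rw [← twoCochain_skew c.α y ⁅x, w⁆, ← twoCochain_skew c.α x ⁅y, w⁆] at h
        simp only [map_neg] at h
        linarith
      have hs (p : A) (u x y : L) : M.form (c.α x y) ⁅u, p⁆ = - M.form p ⁅u, c.α x y⁆ := by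
        rw [M.symm, M.form_lie]
      have hγ := c.d_γ x y z w
      simp only [dThree, wedgeTwoTwo] at hγ
      have g₁ := threeCochain_skew₁₂ c.γ x ⁅y, z⁆ w
      have g₂ := threeCochain_skew₁₂ c.γ y ⁅x, z⁆ w
      have g₃ := threeCochain_skew₁₂ c.γ y ⁅x, w⁆ z
      have g₃' := threeCochain_skew₂₃ c.γ y ⁅x, w⁆ z
      have g₄ := threeCochain_skew₁₂ c.γ x ⁅y, w⁆ z
      have g₄' := threeCochain_skew₂₃ c.γ x ⁅y, w⁆ z
      have g₅ := threeCochain_skew₁₂ c.γ x ⁅z, w⁆ y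
      have g₅' := threeCochain_skew₂₃ c.γ x ⁅z, w⁆ y
      have i₁ := hd a y z w
      have i₂ := hd b x z w
      have i₃ := hd e x y w
      have j : M.form a ⁅z, ⁅w, b⁆⁆ = M.form b ⁅w, ⁅z, a⁆⁆ := by
        rw [M.symm b, M.form_lie w, M.form_lie z, neg_neg]
      simp only [M.form_lie, hs] at j ⊢
      linarith [M.symm (c.α x y) (c.α z w), M.symm (c.α x z) (c.α y w),
        M.symm (c.α x w) (c.α y z)]
    · simp only [mid_lie, base_lie, mid_add, lie_add, lie_sub, lie_lie]
      have h := congrArg (fun f => f X.base Y.base Z.base) c.d_α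
      simp only [d₂₃_apply, LinearMap.zero_apply] at h
      rw [← twoCochain_skew c.α Y.base ⁅X.base, Z.base⁆,
        ← twoCochain_skew c.α X.base ⁅Y.base, Z.base⁆] at h
      rw [← sub_eq_zero] at h ⊢
      rw [← h]
      abel
    · simp

instance : LieAlgebra ℝ (StdModel c) where
  lie_smul t X Y := by
    ext
    · simp [dual_lie]; ring
    · simp [smul_add, smul_sub]
    · simp

end StdModel

variable [FiniteDimensional ℝ L]

/-- The standard model `𝔡_{α,γ}(𝔩, θ, 𝔞)` as a metric Lie algebra with involution:
`⟨Z₁ + B₁ + x₁, Z₂ + B₂ + x₂⟩ = ⟨B₁, B₂⟩ + Z₁(x₂) + Z₂(x₁)` and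
`θ(Z + B + x) = θ_𝔩^*(Z) + θ_𝔞(B) + θ_𝔩(x)`. -/
def stdModel {M : OrthogonalModule θ A} (c : QuadraticCocycle M) :
    MetricInvolution (StdModel c) where
  form := LinearMap.mk₂ ℝ
    (fun X Y => M.form X.mid Y.mid + X.dual Y.base + Y.dual X.base)
    (fun X Y Z => by simp; ring) (fun t X Y => by simp; ring)
    (fun X Y Z => by simp; ring) (fun t X Y => by simp; ring)
  symm X Y := by simp [M.symm X.mid]; ring
  nondegenerate := by
    have hs : ∀ X : StdModel c, (∀ Y : StdModel c,
        M.form X.mid Y.mid + X.dual Y.base + Y.dual X.base = 0) → X = 0 := by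
      intro X h
      ext x
      · simpa using h (StdModel.mk 0 0 x)
      · exact M.nondegenerate.1 _ fun a => by simpa using h (StdModel.mk 0 a 0)
      · refine (Module.forall_dual_apply_eq_zero_iff ℝ _).1 fun Z => ?_
        simpa using h (StdModel.mk Z 0 0)
    refine ⟨fun X h => hs X h, fun X h => hs X fun Y => ?_⟩
    have := h Y
    simp only [LinearMap.mk₂_apply] at this
    rw [M.symm]; linarith
  invariant X Y Z := by
    simp only [LinearMap.mk₂_apply, StdModel.dual_lie, StdModel.mid_lie, StdModel.base_lie, map_add,
      map_sub, LinearMap.add_apply, LinearMap.sub_apply]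
    rw [← lie_skew Z.base Y.base, map_neg, StdModel.threeCochain_skew₂₃ c.γ X.base Y.base Z.base,
      ← twoCochain_skew c.α Y.base Z.base, map_neg]
    linarith [M.symm (c.α X.base Y.base) Z.mid, M.symm Y.mid ⁅Z.base, X.mid⁆,
      M.invariant X.base Y.mid Z.mid]
  invol :=
    { toHom :=
        { toFun := fun X => StdModel.mk (X.dual ∘ₗ (θ.toHom : L →ₗ[ℝ] L)) (M.invol X.mid)
            (θ X.base)
          map_add' := fun X Y => by ext <;> simp
          map_smul' := fun t X => by ext <;> simp
          map_lie' := by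
            intro X Y
            ext w
            · have hα (x y : L) (a : A) : M.form (M.invol a) (c.α (θ x) y)
                  = M.form a (c.α x (θ y)) := by
                rw [← M.isometry a, ← c.α_invariant x (θ y), θ.involutive, M.involutive]
              have hγ := c.γ_invariant X.base Y.base (θ w)
              rw [θ.involutive] at hγ
              have hρ := M.compat w X.mid
              have hρ' := M.isometry ⁅θ w, X.mid⁆ Y.mid
              rw [hρ] at hρ'
              simp only [StdModel.dual_lie, StdModel.dual_mk, StdModel.mid_mk, StdModel.base_mk,
                LinearMap.comp_apply, LieHom.coe_toLinearMap, LieHom.map_lie, θ.involutive,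
                hα, hγ, hρ']
            · have hα := c.α_invariant (θ X.base) (θ Y.base)
              have hρ (x : L) (a : A) := M.compat (θ x) a
              simp only [θ.involutive] at hα hρ
              simp only [StdModel.mid_lie, StdModel.mid_mk, StdModel.base_mk, map_add, map_sub, hα,
                hρ]
            · simp }
      involutive := fun X => by
        ext <;> simp [θ.involutive, M.involutive] }
  isometry X Y := by
    simp [M.isometry, θ.involutive]

end StandardModel

/-! ### Semi-simple modules and the radical filtration -/

/-- A module of a Lie algebra is semi-simple if every submodule has a complementary submodule. -/
def IsSemisimpleLieModule (L : Type*) [LieRing L] [LieAlgebra ℝ L] (A : Type*) [AddCommGroup A]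
    [Module ℝ A] [LieRingModule L A] [LieModule ℝ L A] : Prop :=
  ComplementedLattice (LieSubmodule ℝ L A)

/-- `R_k(𝔩)`: `R_0(𝔩) = 𝔩`, and `R_{k+1}(𝔩)` is the smallest ideal contained in `R_k(𝔩)` such that
the `𝔩`-module `R_k(𝔩) / R_{k+1}(𝔩)` is semi-simple. -/
def radFiltration (L : Type*) [LieRing L] [LieAlgebra ℝ L] : ℕ → LieIdeal ℝ L
  | 0 => ⊤
  | k + 1 => sInf {J : LieIdeal ℝ L | J ≤ radFiltration L k ∧
      IsSemisimpleLieModule L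
        (radFiltration L k ⧸ LieSubmodule.comap (LieSubmodule.incl (radFiltration L k)) J)}

/-- `S(𝔩)`: the largest ideal which is semi-simple as an `𝔩`-module. -/
def socle (L : Type*) [LieRing L] [LieAlgebra ℝ L] : LieIdeal ℝ L :=
  sSup {J : LieIdeal ℝ L | IsSemisimpleLieModule L J}

/-! ### Admissibility -/

section Admissible

variable {L : Type*} [LieRing L] [LieAlgebra ℝ L] {θ : LieInvolution L}
variable {A : Type*} [AddCommGroup A] [Module ℝ A]
  [LieRingModule L A] [LieModule ℝ L A]

/-- For a semi-simple module, `𝔞 = 𝔞^𝔩 ⊕ ρ(𝔩)𝔞`. -/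
theorem isCompl_invariants (h : IsSemisimpleLieModule L A) :
    IsCompl (LieModule.maxTrivSubmodule ℝ L A).toSubmodule
      (⁅(⊤ : LieIdeal ℝ L), (⊤ : LieSubmodule ℝ L A)⁆).toSubmodule := by
  have : ComplementedLattice (LieSubmodule ℝ L A) := h
  rw [LieSubmodule.isCompl_toSubmodule]
  constructor
  · obtain ⟨N, hN⟩ := exists_isCompl (LieModule.maxTrivSubmodule ℝ L A)
    refine hN.disjoint.mono_right ?_
    rw [LieSubmodule.lie_le_iff]
    intro x _ m _
    have hm : m ∈ LieModule.maxTrivSubmodule ℝ L A ⊔ N := by rw [hN.sup_eq_top]; trivial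
    obtain ⟨a, ha, b, hb, rfl⟩ := (LieSubmodule.mem_sup _ _ _).1 hm
    rw [lie_add, (LieModule.mem_maxTrivSubmodule ℝ L A a).1 ha x, zero_add]
    exact N.lie_mem hb
  · obtain ⟨N, hN⟩ := exists_isCompl (⁅(⊤ : LieIdeal ℝ L), (⊤ : LieSubmodule ℝ L A)⁆)
    refine Codisjoint.mono_left ?_ hN.symm.codisjoint
    intro n hn
    rw [LieModule.mem_maxTrivSubmodule]
    intro x
    have h1 : ⁅x, n⁆ ∈ ⁅(⊤ : LieIdeal ℝ L), (⊤ : LieSubmodule ℝ L A)⁆ :=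
      LieSubmodule.lie_mem_lie trivial trivial
    have h2 : ⁅x, n⁆ ∈ N := N.lie_mem hn
    have := hN.disjoint.le_bot (show ⁅x, n⁆ ∈ _ ⊓ N from ⟨h1, h2⟩)
    simpa using this

/-- The component `α₀` of `α` with respect to the decomposition `𝔞 = 𝔞^𝔩 ⊕ ρ(𝔩)𝔞`,
with values in `𝔞^𝔩`. -/
def alphaZero (h : IsSemisimpleLieModule L A) (α : twoCochain ℝ L A) : L →ₗ[ℝ] L →ₗ[ℝ] A :=
  α.1.compr₂ (Submodule.projection _ _ (isCompl_invariants h))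

/-- For a subspace `V` of `𝔩`, the image under `α₀` of the kernel of the bracket `Λ²V → 𝔩`. It is
computed here on `V ⊗ V` in place of its quotient `Λ²V`, which gives the same image since both
the bracket and `α₀` are alternating. -/
def alphaZeroKer (h : IsSemisimpleLieModule L A) (α : twoCochain ℝ L A) (V : Submodule ℝ L) :
    Submodule ℝ A :=
  (LinearMap.ker (TensorProduct.lift
      ((LieModule.toEnd ℝ L L : L →ₗ[ℝ] Module.End ℝ L).domRestrict₁₂ V V))).map
    (TensorProduct.lift ((alphaZero h α).domRestrict₁₂ V V))

/-- The restriction of the bilinear form `B` to the subspace `W` is non-degenerate. -/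
def NondegenerateOn (B : LinearMap.BilinForm ℝ A) (W : Submodule ℝ A) : Prop :=
  ∀ a ∈ W, (∀ b ∈ W, B a b = 0) → a = 0

variable [FiniteDimensional ℝ A]

/-- The conditions for a quadratic cocycle `(α, γ)` with values in a semi-simple orthogonal module
to be admissible. The conditions `cond_A k` and `cond_B k` hold automatically for all `k` with
`R_k(𝔩) = 0`, so they are stated for all `k ≥ 1`. -/
structure IsAdmissibleCocycle {M : OrthogonalModule θ A} (c : QuadraticCocycle M) : Prop where
  /-- Condition `(T₁)` -/
  bracket_eq : θ.BracketMinusEqPlus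
  semisimple : IsSemisimpleLieModule L A
  /-- Condition `(A₀)` -/
  cond_A_zero : ∀ x₀ : L, x₀ ∈ LieAlgebra.center ℝ L → x₀ ∈ LieModule.ker ℝ L A →
    (∃ (a₀ : A) (Z₀ : Module.Dual ℝ L), ∀ x : L,
      c.α x x₀ = ⁅x, a₀⁆ ∧
      ∀ y : L, c.γ.1 x x₀ y = - M.form a₀ (c.α x y) + Z₀ ⁅x, y⁆) → x₀ = 0
  /-- Condition `(B₀)` -/
  cond_B_zero : NondegenerateOn M.form (alphaZeroKer semisimple c.α ⊤)
  /-- Condition `(T₂)` -/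
  invariants_plus_eq :
    (LieModule.maxTrivSubmodule ℝ L A).toSubmodule ⊓ Module.End.eigenspace M.invol 1
      = alphaZeroKer semisimple c.α θ.minus
  /-- Condition `(A_k)` for `k ≥ 1` -/
  cond_A : ∀ k : ℕ, 1 ≤ k → ∀ K : LieIdeal ℝ L, K ≤ socle L ⊓ radFiltration L k →
    (∃ (Φ₁ : K →ₗ[ℝ] A) (Φ₂ : K →ₗ[ℝ] Module.Dual ℝ (radFiltration L k)), ∀ (x : L) (u : K),
      c.α x u = ⁅x, Φ₁ u⁆ - Φ₁ ⁅x, u⁆ ∧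
      ∀ y : radFiltration L k, c.γ.1 x u y
        = - M.form (Φ₁ u) (c.α x y) + Φ₂ u ⁅x, y⁆ + Φ₂ ⁅x, u⁆ y) → K = ⊥
  /-- Condition `(B_k)` for `k ≥ 1` -/
  cond_B : ∀ k : ℕ, 1 ≤ k → ∀ N : LieSubmodule ℝ L A,
    Maximal (fun N : LieSubmodule ℝ L A => ∃ Φ : radFiltration L k →ₗ[ℝ] A,
      ∀ (x : L) (u : radFiltration L k), ∀ b ∈ N,
        M.form (c.α x u) b = M.form (⁅x, Φ u⁆ - Φ ⁅x, u⁆) b) N →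
    NondegenerateOn M.form N.toSubmodule

/-- The set `H²_Q(𝔩, θ_𝔩, 𝔞)_♯` of admissible cohomology classes. -/
def admissibleClasses (M : OrthogonalModule θ A) : Set (QuadraticCohomology M) :=
  {φ | ∃ c : QuadraticCocycle M, c.cls = φ ∧ IsAdmissibleCocycle c}

/-- A Lie algebra with involution is admissible if `[𝔩₋, 𝔩₋] = 𝔩₊` and some semi-simple orthogonal
module has an admissible class. (A finite-dimensional module is isomorphic to one whose underlying
type lives in the lowest universe.) -/
def LieInvolution.IsAdmissible (θ : LieInvolution L) : Prop :=
  θ.BracketMinusEqPlus ∧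
  ∃ (A : Type) (_ : AddCommGroup A) (_ : Module ℝ A) (_ : FiniteDimensional ℝ A)
    (_ : LieRingModule L A) (_ : LieModule ℝ L A) (M : OrthogonalModule θ A),
    IsSemisimpleLieModule L A ∧ (admissibleClasses M).Nonempty

end Admissible

end SymTriple

end

open SymTriple

/-! The heart of the matter is that `𝔩^*` can be recovered from the metric Lie algebra `𝔡 = 𝔡_{α,γ}`
alone. Every metric Lie algebra `𝔤` carries the canonical ideal `Σ_k R_k(𝔤) ∩ S_k(𝔤)` with `S_k =
R_k^⊥`. It is built from the bracket and the form only, so isometric isomorphisms preserve it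
(`Iso.map_iSup`). For an admissible cocycle this ideal of `𝔡` is exactly `𝔩^*`
(`midIdeal_bot_eq_iSup`).

By `eq_iSup_radFiltration_inf_socFiltration` this equality needs `R_k ∩ S_k ⊆ 𝔩^*` and `R_k ∩
S_{k+1} ⊆ (𝔩^*)^⊥ = 𝔩^* ⊕ 𝔞` for all `k`. These follow by a staircase induction: `(A_k)` turns the
first inclusion at `k` into the second at `k` (`mixedLayer_le_ker`), and `(B_k)` leads on to the
first at `k + 1` (`radFiltration_inf_socFiltration_succ_le`). The induction uses that `R_k(𝔩)`, `k ≥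
1`, acts trivially on semi-simple modules (`radFiltration_le_ker`).

An isomorphism of standard models therefore preserves the flag `𝔩^* ⊆ 𝔩^* ⊕ 𝔞 ⊆ 𝔡`. Its diagonal
blocks on `𝔩` and `𝔞` form an isomorphism of triples, and its remaining blocks form a quadratic
1-cochain relating the two cocycles (`cohomologous_tripleIso`). Conversely, triple isomorphisms
(`pullIso`) and 1-cochains (`nonempty_iso_of_cohomologous`) give isomorphisms of standard models.

That `𝔡` is a symmetric triple reduces to faithfulness (`isSymmetricTriple_of_faithful`). An element
of `𝔡₊` commuting with `𝔡₋` is central by `(T₁)`; then `(A₀)`, `(T₂)` and `(T₁)` kill its components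
in `𝔩`, `𝔞` and `𝔩^*`. -/

noncomputable section

namespace SymTriple

/-! ### Relatively complemented intervals -/

section Lattice

variable {α β : Type*} [Lattice α] [Lattice β]

/-- The interval `[a, b]` is complemented. -/
def ComplementedIcc (a b : α) : Prop :=
  ∀ c, a ≤ c → c ≤ b → ∃ d, c ⊓ d = a ∧ c ⊔ d = b

theorem ComplementedIcc.refl (a : α) : ComplementedIcc a a := fun c h₁ h₂ =>
  ⟨c, by rw [inf_idem]; exact le_antisymm h₂ h₁, by rw [sup_idem]; exact le_antisymm h₂ h₁⟩

theorem ComplementedIcc.toDual {a b : α} (h : ComplementedIcc a b) :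
    ComplementedIcc (OrderDual.toDual b) (OrderDual.toDual a) := fun c h₁ h₂ => by
  obtain ⟨d, hd, hd'⟩ := h (OrderDual.ofDual c) h₂ h₁
  exact ⟨OrderDual.toDual d, hd', hd⟩

theorem ComplementedIcc.ofDual {a b : α}
    (h : ComplementedIcc (OrderDual.toDual b) (OrderDual.toDual a)) : ComplementedIcc a b :=
  fun c h₁ h₂ => by
    obtain ⟨d, hd, hd'⟩ := h (OrderDual.toDual c) h₂ h₁
    exact ⟨OrderDual.ofDual d, hd', hd⟩

/-- Complementation of intervals is reflected and preserved by lattice embeddings whose range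
contains the interval. -/
theorem complementedIcc_map_iff {f : β → α} (hf : Function.Injective f)
    (hinf : ∀ x y, f (x ⊓ y) = f x ⊓ f y) (hsup : ∀ x y, f (x ⊔ y) = f x ⊔ f y) {a b : β}
    (hr : ∀ c, f a ≤ c → c ≤ f b → ∃ x, f x = c) :
    ComplementedIcc (f a) (f b) ↔ ComplementedIcc a b := by
  have hle {x y : β} : f x ≤ f y ↔ x ≤ y := by
    rw [← inf_eq_left, ← hinf, hf.eq_iff, inf_eq_left]
  constructor
  · intro h c hac hcb
    obtain ⟨d, hd, hd'⟩ := h (f c) (hle.2 hac) (hle.2 hcb)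
    obtain ⟨d, rfl⟩ := hr d (hd ▸ inf_le_right) (hd' ▸ le_sup_right)
    exact ⟨d, hf (by rw [hinf, hd]), hf (by rw [hsup, hd'])⟩
  · intro h c hac hcb
    obtain ⟨c, rfl⟩ := hr c hac hcb
    obtain ⟨d, hd, hd'⟩ := h c (hle.1 hac) (hle.1 hcb)
    exact ⟨f d, by rw [← hinf, hd], by rw [← hsup, hd']⟩

/-- Complementation of intervals under an order-reversing involution. -/
theorem ComplementedIcc.antitone {f : α → α} (hf : ∀ x, f (f x) = x) (hanti : Antitone f)
    {a b : α} (h : ComplementedIcc a b) : ComplementedIcc (f b) (f a) := by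
  have hle {x y : α} (h : x ≤ f y) : y ≤ f x := by simpa [hf] using hanti h
  have hle' {x y : α} (h : f x ≤ y) : f y ≤ x := by simpa [hf] using hanti h
  intro c hbc hca
  obtain ⟨d, hd, hd'⟩ := h (f c) (hle hca) (hle' hbc)
  refine ⟨f d, le_antisymm ?_ ?_, le_antisymm ?_ ?_⟩
  · apply hle
    rw [← hd']
    exact sup_le (hanti inf_le_left) (hle inf_le_right)
  · exact le_inf hbc (hanti (hd' ▸ le_sup_right))
  · exact sup_le hca (hanti (hd ▸ inf_le_right))
  · apply hle'
    rw [← hd]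
    exact le_inf (hanti le_sup_left) (hle' le_sup_right)

/-- A complemented interval `[w ⊓ s, w]` lifts the image of `w` modulo `n`. -/
theorem ComplementedIcc.exists_lift {s w n : α} (h : ComplementedIcc (w ⊓ s) w)
    (hn : w ⊓ s ≤ n) : ∃ v ≤ w, v ⊓ n = w ⊓ s ∧ v ⊔ n = w ⊔ n := by
  -- The lift is a complement of `w ⊓ n` inside `[w ⊓ s, w]`.
  obtain ⟨v, hv, hv'⟩ := h (w ⊓ n) (le_inf inf_le_left hn) inf_le_left
  have hvw : v ≤ w := hv' ▸ le_sup_right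
  refine ⟨v, hvw, ?_, le_antisymm (sup_le_sup_right hvw n) (sup_le ?_ le_sup_right)⟩
  · rw [← hv, inf_right_comm, inf_eq_right.2 hvw]
  · conv_lhs => rw [← hv']
    exact sup_le (inf_le_right.trans le_sup_right) le_sup_left

variable [IsModularLattice α]

/-- Subquotients of semi-simple modules are semi-simple: by the modular law a complement may be cut
down by `b'` and then enlarged by `a'`. -/
theorem ComplementedIcc.mono {a b a' b' : α} (h : ComplementedIcc a b) (ha : a ≤ a') (hb : b' ≤ b) : ComplementedIcc a' b' := by
  intro c hac hcb
  obtain ⟨d, hd, hd'⟩ := h c (ha.trans hac) (hcb.trans hb)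
  have had : a ≤ d := hd ▸ inf_le_right
  have h₁ : (a' ⊔ d ⊓ b') ⊓ c = a' := by
    rw [sup_inf_assoc_of_le _ hac, sup_eq_left]
    exact (le_inf inf_le_right (inf_le_left.trans inf_le_left)).trans (hd.le.trans ha)
  have h₂ : c ⊔ d ⊓ b' = b' := by
    rw [← sup_inf_assoc_of_le _ hcb, hd', inf_eq_right.2 hb]
  refine ⟨a' ⊔ d ⊓ b', by rw [inf_comm, h₁], ?_⟩
  rw [← sup_assoc, sup_eq_left.2 hac, h₂]

/-- The second isomorphism theorem: in a modular lattice `a ⊔ ·` and `· ⊓ b` match the two intervals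
and carry complements to complements. -/
theorem complementedIcc_inf_iff (a b : α) :
    ComplementedIcc (a ⊓ b) b ↔ ComplementedIcc a (a ⊔ b) := by
  constructor
  · intro h c hac hcb
    obtain ⟨d, hd, hd'⟩ := h (c ⊓ b) (inf_le_inf_right b hac) inf_le_right
    have hdb : d ≤ b := hd' ▸ le_sup_right
    have hc : a ⊔ b ⊓ c = c := by
      rw [← sup_inf_assoc_of_le _ hac, inf_eq_right.2 hcb]
    refine ⟨a ⊔ d, ?_, ?_⟩
    · rw [inf_comm, sup_inf_assoc_of_le _ hac, sup_eq_left]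
      calc d ⊓ c ≤ (c ⊓ b) ⊓ d := le_inf (le_inf inf_le_right (inf_le_left.trans hdb)) inf_le_left
        _ ≤ a := hd.le.trans inf_le_left
    · apply le_antisymm (sup_le hcb (sup_le le_sup_left (hdb.trans le_sup_right)))
      refine sup_le (le_sup_left.trans le_sup_right) ?_
      rw [← hd']
      exact sup_le (inf_le_left.trans le_sup_left) (le_sup_right.trans le_sup_right)
  · intro h c hac hcb
    obtain ⟨d, hd, hd'⟩ := h (a ⊔ c) le_sup_left (sup_le_sup_left hcb a)
    have had : a ≤ d := hd ▸ inf_le_right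
    refine ⟨d ⊓ b, ?_, ?_⟩
    · apply le_antisymm
      · refine le_inf ?_ (inf_le_right.trans inf_le_right)
        rw [← hd]
        exact inf_le_inf le_sup_right inf_le_left
      · exact le_inf hac (le_inf (inf_le_left.trans had) inf_le_right)
    · rw [← sup_inf_assoc_of_le _ hcb]
      have : c ⊔ d = a ⊔ b := by
        rw [← hd', sup_comm a c, sup_assoc, sup_eq_right.2 had]
      rw [this, inf_eq_right]
      exact le_sup_right

/-- Sums of semi-simple modules are semi-simple. A complement of `x` is assembled from one of `x ⊓
b` in `b` and one of `(x ⊔ b) ⊓ c` in `c`. -/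
theorem ComplementedIcc.sup {a b c : α} (hab : a ≤ b) (hb : ComplementedIcc a b)
    (hc : ComplementedIcc a c) (hac : a ≤ c) : ComplementedIcc a (b ⊔ c) := by
  intro x hax hxb
  obtain ⟨d, hd, hd'⟩ := hb (x ⊓ b) (le_inf hax hab) inf_le_right
  obtain ⟨e, he, he'⟩ := hc ((x ⊔ b) ⊓ c) (le_inf (hax.trans le_sup_left) hac) inf_le_right
  have hdb : d ≤ b := hd' ▸ le_sup_right
  have hec : e ≤ c := he' ▸ le_sup_right
  have had : a ≤ d := hd ▸ inf_le_right
  have hbx : b ≤ x ⊔ (d ⊔ e) := by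
    conv_lhs => rw [← hd']
    exact sup_le (inf_le_left.trans le_sup_left) (le_sup_left.trans le_sup_right)
  refine ⟨d ⊔ e, le_antisymm ?_ (le_inf hax (had.trans le_sup_left)), le_antisymm ?_ ?_⟩
  · have h₁ : (d ⊔ e) ⊓ (x ⊔ b) = d := by
      rw [sup_inf_assoc_of_le _ (hdb.trans le_sup_right), sup_eq_left]
      refine le_trans ?_ (he.le.trans had)
      exact le_inf (le_inf inf_le_right (inf_le_left.trans hec)) inf_le_left
    have h₂ : x ⊓ (d ⊔ e) ≤ d := by
      exact (le_inf inf_le_right (inf_le_left.trans le_sup_left)).trans h₁.le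
    rw [← hd]
    exact le_inf (le_inf inf_le_left (h₂.trans hdb)) h₂
  · exact sup_le hxb (sup_le (hdb.trans le_sup_left) (hec.trans le_sup_right))
  · refine sup_le hbx ?_
    conv_lhs => rw [← he']
    exact sup_le (inf_le_left.trans (sup_le le_sup_left hbx)) (le_sup_right.trans le_sup_right)

theorem ComplementedIcc.inf {a b c : α} (hba : b ≤ a) (hb : ComplementedIcc b a)
    (hc : ComplementedIcc c a) (hca : c ≤ a) : ComplementedIcc (b ⊓ c) a :=
  ComplementedIcc.ofDual (ComplementedIcc.sup (α := αᵒᵈ) hba hb.toDual hc.toDual hca)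

theorem ComplementedIcc.sup_right {a b : α} (hab : a ≤ b) (h : ComplementedIcc a b) (c : α) :
    ComplementedIcc (a ⊔ c) (b ⊔ c) := by
  have := (complementedIcc_inf_iff (a ⊔ c) b).1
    (h.mono (le_inf le_sup_left hab) le_rfl)
  rwa [sup_right_comm, sup_eq_right.2 hab] at this

end Lattice

/-! ### Nilpotency and traces of powers -/

/-- Write the minimal polynomial as `X ^ r * q` with `X ∤ q`. The Fitting projection `e` onto the
invertible part of `x` is a polynomial in `x` without constant term, so its trace, which is its rank
in characteristic zero, vanishes. -/
theorem isNilpotent_of_trace_pow_eq_zero {V : Type*} [AddCommGroup V] [Module ℝ V]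
    [FiniteDimensional ℝ V] (x : Module.End ℝ V)
    (h : ∀ n : ℕ, LinearMap.trace ℝ V (x ^ (n + 1)) = 0) : IsNilpotent x := by
  open Polynomial in
  have hx : IsIntegral ℝ x := Algebra.IsIntegral.isIntegral x
  have h0 : minpoly ℝ x ≠ 0 := minpoly.ne_zero hx
  obtain ⟨q, hq, hq'⟩ := (minpoly ℝ x).exists_eq_pow_rootMultiplicity_mul_and_not_dvd h0 0
  generalize (minpoly ℝ x).rootMultiplicity 0 = r at hq
  simp only [map_zero, sub_zero] at hq hq'
  -- The exponent `r + 1` rather than `r` ensures that `e` is divisible by `X` even when `r = 0`.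
  have hco : IsCoprime (X ^ (r + 1) : ℝ[X]) q :=
    IsCoprime.pow_left ((Polynomial.irreducible_X.coprime_iff_not_dvd).2 hq')
  obtain ⟨u, v, huv⟩ := hco
  have hμ : aeval x (X ^ r * q) = 0 := by rw [← hq, minpoly.aeval]
  set e : Module.End ℝ V := aeval x (u * X ^ (r + 1)) with he
  have hid : IsIdempotentElem e := by
    rw [IsIdempotentElem, ← sub_eq_zero, he, ← map_mul, ← map_sub]
    have : u * X ^ (r + 1) * (u * X ^ (r + 1)) - u * X ^ (r + 1)
        = X ^ r * q * (- (u * X * v)) := by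
      linear_combination (u * X ^ (r + 1)) * huv
    rw [this, map_mul, hμ, zero_mul]
  have htr (p : ℝ[X]) : LinearMap.trace ℝ V (aeval x (p * X)) = 0 := by
    induction p using Polynomial.induction_on' with
    | add p q hp hq => rw [add_mul, map_add, map_add, hp, hq, add_zero]
    | monomial n a =>
      rw [← C_mul_X_pow_eq_monomial, mul_assoc, ← pow_succ, map_mul, aeval_C, map_pow, aeval_X,
        Algebra.algebraMap_eq_smul_one, smul_mul_assoc, one_mul, map_smul, h, smul_zero]
  have he0 : e = 0 := by
    have h1 := (LinearMap.IsIdempotentElem.isProj_range e hid).trace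
    have h1' : LinearMap.trace ℝ V e = 0 := by rw [he, pow_succ, ← mul_assoc, htr]
    rw [h1'] at h1
    have h2 : Module.finrank ℝ (LinearMap.range e) = 0 := by exact_mod_cast h1.symm
    rw [Submodule.finrank_eq_zero, LinearMap.range_eq_bot] at h2
    exact h2
  refine ⟨r, ?_⟩
  have : (X ^ r : ℝ[X]) = X ^ r * (u * X ^ (r + 1)) + X ^ r * q * v := by
    linear_combination (- X ^ r) * huv
  have h3 := congrArg (aeval x) this
  rw [map_add, map_mul, map_mul _ (X ^ r * q), hμ, ← he, he0, mul_zero, zero_mul, add_zero,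
    map_pow, aeval_X] at h3
  exact h3

/-! ### Semi-simple modules and complemented intervals of submodules -/

theorem complementedLattice_iff_complementedIcc {α : Type*} [Lattice α] [BoundedOrder α] :
    ComplementedLattice α ↔ ComplementedIcc (⊥ : α) ⊤ := by
  constructor
  · intro h c _ _
    obtain ⟨d, hd⟩ := exists_isCompl c
    exact ⟨d, hd.inf_eq_bot, hd.sup_eq_top⟩
  · intro h
    refine ⟨fun c => ?_⟩
    obtain ⟨d, hd, hd'⟩ := h c bot_le le_top
    exact ⟨d, disjoint_iff.2 hd, codisjoint_iff.2 hd'⟩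

section LieSubmodule

variable {L : Type*} [LieRing L] [LieAlgebra ℝ L]
variable {A : Type*} [AddCommGroup A] [Module ℝ A] [LieRingModule L A] [LieModule ℝ L A]

theorem isSemisimpleLieModule_iff :
    IsSemisimpleLieModule L A ↔ ComplementedIcc (⊥ : LieSubmodule ℝ L A) ⊤ :=
  complementedLattice_iff_complementedIcc

/-- The correspondence theorem: `f` takes preimages and identifies the submodules of the quotient
with the interval `[N', N]`. Semi-simplicity of subquotients thus becomes a statement in the modular
lattice of submodules of `A`. -/
theorem isSemisimpleLieModule_quotient_iff {N N' : LieSubmodule ℝ L A} (h : N' ≤ N) :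
    IsSemisimpleLieModule L (N ⧸ N'.comap N.incl) ↔ ComplementedIcc N' N := by
  let π := LieSubmodule.Quotient.mk' (N'.comap N.incl)
  let f (X : LieSubmodule ℝ L (N ⧸ N'.comap N.incl)) : LieSubmodule ℝ L A := (X.comap π).map N.incl
  have hf (X) (m : A) : m ∈ f X ↔ ∃ hm : m ∈ N, π ⟨m, hm⟩ ∈ X := by
    simp only [f, LieSubmodule.mem_map, LieSubmodule.mem_comap]
    constructor
    · rintro ⟨⟨m, hm⟩, hx, rfl⟩
      exact ⟨hm, hx⟩
    · rintro ⟨hm, hx⟩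
      exact ⟨⟨m, hm⟩, hx, rfl⟩
  have hmono {X Y} (hXY : X ≤ Y) : f X ≤ f Y := fun m hm => by
    rw [hf] at hm ⊢
    exact ⟨hm.1, hXY hm.2⟩
  have hπ : Function.Surjective π := LieSubmodule.Quotient.surjective_mk' _
  have hbot : f ⊥ = N' := by
    ext m
    rw [hf]
    constructor
    · rintro ⟨hm, hx⟩
      have h0 : (⟨m, hm⟩ : N) ∈ N'.comap N.incl :=
        (LieSubmodule.Quotient.mk_eq_zero _).1 ((LieSubmodule.mem_bot _).1 hx)
      exact h0
    · intro hm
      exact ⟨h hm, (LieSubmodule.mem_bot _).2 ((LieSubmodule.Quotient.mk_eq_zero _).2 hm)⟩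
  have htop : f ⊤ = N := by
    ext m
    rw [hf]
    exact ⟨fun ⟨hm, _⟩ => hm, fun hm => ⟨hm, trivial⟩⟩
  rw [isSemisimpleLieModule_iff, ← complementedIcc_map_iff (f := f), hbot, htop]
  · intro X Y hXY
    ext x
    obtain ⟨⟨m, hm⟩, rfl⟩ := hπ x
    have := congrArg (m ∈ ·) hXY
    simpa [hf, hm] using this
  · intro X Y
    ext m
    simp only [hf, LieSubmodule.mem_inf]
    exact ⟨fun ⟨a, b, c⟩ => ⟨⟨a, b⟩, a, c⟩, fun ⟨⟨a, b⟩, _, c⟩ => ⟨a, b, c⟩⟩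
  · intro X Y
    apply le_antisymm
    · intro m hm
      obtain ⟨hm, hx⟩ := (hf _ _).1 hm
      obtain ⟨x, hx, y, hy, hxy⟩ := (LieSubmodule.mem_sup _ _ _).1 hx
      obtain ⟨⟨n, hn⟩, rfl⟩ := hπ y
      rw [← sub_add_cancel m n]
      refine (LieSubmodule.mem_sup _ _ _).2 ⟨_, (hf _ _).2 ⟨sub_mem hm hn, ?_⟩, _,
        (hf _ _).2 ⟨hn, hy⟩, rfl⟩
      have : π ⟨m - n, sub_mem hm hn⟩ = x := by
        rw [← add_sub_cancel_right x (π ⟨n, hn⟩), hxy, ← map_sub]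
        rfl
      rwa [this]
    · exact sup_le (hmono le_sup_left) (hmono le_sup_right)
  · intro C hC hC'
    rw [hbot] at hC
    rw [htop] at hC'
    refine ⟨(C.comap N.incl).map π, ?_⟩
    ext m
    rw [hf]
    constructor
    · rintro ⟨hm, hx⟩
      obtain ⟨⟨n, hn⟩, hnC, hn'⟩ := (LieSubmodule.mem_map _).1 hx
      have h0 : π (⟨m, hm⟩ - ⟨n, hn⟩) = 0 := by rw [map_sub, hn', sub_self]
      have h1 : (⟨m, hm⟩ - ⟨n, hn⟩ : N) ∈ N'.comap N.incl :=
        (LieSubmodule.Quotient.mk_eq_zero _).1 h0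
      have h1 : m - n ∈ C := hC h1
      have h2 : n ∈ C := hnC
      simpa using add_mem h1 h2
    · intro hm
      exact ⟨hC' hm, (LieSubmodule.mem_map _).2 ⟨⟨m, hC' hm⟩, hm, rfl⟩⟩

theorem isSemisimpleLieModule_coe_iff (N : LieSubmodule ℝ L A) :
    IsSemisimpleLieModule L N ↔ ComplementedIcc ⊥ N := by
  rw [isSemisimpleLieModule_iff, ← complementedIcc_map_iff (f := LieSubmodule.map N.incl),
    LieSubmodule.map_bot]
  · have : LieSubmodule.map N.incl ⊤ = N := by
      ext m
      simp
    rw [this]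
  · exact LieSubmodule.map_injective_of_injective N.injective_incl
  · intro X Y
    ext m
    simp only [LieSubmodule.mem_map, LieSubmodule.mem_inf]
    constructor
    · rintro ⟨a, ⟨ha, hb⟩, rfl⟩
      exact ⟨⟨a, ha, rfl⟩, a, hb, rfl⟩
    · rintro ⟨⟨a, ha, rfl⟩, b, hb, hab⟩
      obtain rfl := N.injective_incl hab
      exact ⟨b, ⟨ha, hb⟩, rfl⟩
  · intro X Y
    exact LieSubmodule.map_sup
  · intro C _ hC
    refine ⟨C.comap N.incl, ?_⟩
    ext m
    simp only [LieSubmodule.mem_map, LieSubmodule.mem_comap]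
    constructor
    · rintro ⟨a, ha, rfl⟩
      exact ha
    · intro hm
      have : m ∈ LieSubmodule.map N.incl ⊤ := hC hm
      obtain ⟨a, -, rfl⟩ := (LieSubmodule.mem_map _).1 this
      exact ⟨a, hm, rfl⟩

theorem le_socle {J : LieIdeal ℝ L} (h : ComplementedIcc ⊥ J) : J ≤ socle L :=
  le_sSup ((isSemisimpleLieModule_coe_iff J).2 h)

end LieSubmodule

/-! ### The radical filtration -/

section RadFiltration

variable {L : Type*} [LieRing L] [LieAlgebra ℝ L]

theorem radFiltration_succ_le_of_complementedIcc {k : ℕ} {J : LieIdeal ℝ L}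
    (hJ : J ≤ radFiltration L k) (h : ComplementedIcc J (radFiltration L k)) :
    radFiltration L (k + 1) ≤ J :=
  sInf_le ⟨hJ, (isSemisimpleLieModule_quotient_iff hJ).2 h⟩

theorem radFiltration_succ_le (k : ℕ) : radFiltration L (k + 1) ≤ radFiltration L k :=
  radFiltration_succ_le_of_complementedIcc le_rfl (.refl _)

theorem radFiltration_antitone : Antitone (radFiltration L) :=
  antitone_nat_of_succ_le radFiltration_succ_le

variable [FiniteDimensional ℝ L]

/-- The infimum defining `R_{k+1}` is attained: ideals with semi-simple quotient are stable under
intersection, so a minimal one, which exists in finite dimension, is the smallest. -/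
theorem complementedIcc_radFiltration (k : ℕ) :
    ComplementedIcc (radFiltration L (k + 1)) (radFiltration L k) := by
  have : WellFoundedLT (LieIdeal ℝ L) := LieSubmodule.wellFoundedLT_of_isArtinian ℝ L L
  obtain ⟨J, -, hJ⟩ := exists_minimal_le_of_wellFoundedLT
    (fun J : LieIdeal ℝ L => J ≤ radFiltration L k ∧ ComplementedIcc J (radFiltration L k))
    (radFiltration L k) ⟨le_rfl, .refl _⟩
  have : radFiltration L (k + 1) = J := by
    apply le_antisymm (radFiltration_succ_le_of_complementedIcc hJ.1.1 hJ.1.2)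
    refine le_sInf fun I ⟨hI, hI'⟩ => ?_
    rw [isSemisimpleLieModule_quotient_iff hI] at hI'
    exact (hJ.2 ⟨inf_le_left.trans hJ.1.1, hJ.1.2.inf hJ.1.1 hI' hI⟩ inf_le_left).trans inf_le_right
  rw [this]
  exact hJ.1.2

/-- A nonzero `R_k` has a maximal proper subideal `J`. The quotient `R_k / J` is simple, hence
semi-simple, so `R_{k+1} ≤ J`. -/
theorem radFiltration_succ_lt {k : ℕ} (h : radFiltration L k ≠ ⊥) :
    radFiltration L (k + 1) < radFiltration L k := by
  have : WellFoundedLT (LieIdeal ℝ L) := LieSubmodule.wellFoundedLT_of_isArtinian ℝ L L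
  have : IsCoatomic (Set.Iic (radFiltration L k)) := inferInstance
  refine lt_of_le_of_ne (radFiltration_succ_le k) fun heq => ?_
  obtain h' | ⟨⟨J, hJ⟩, hJ', -⟩ := eq_top_or_exists_le_coatom (⊥ : Set.Iic (radFiltration L k))
  · exact h (congrArg Subtype.val h').symm
  · have hJ'' : J ⋖ radFiltration L k := by
      have := covBy_top_iff.2 hJ'
      refine ⟨this.lt, fun C h₁ h₂ => ?_⟩
      exact this.2 (c := ⟨C, h₂.le⟩) h₁ h₂
    have h1 : radFiltration L (k + 1) ≤ J := by
      refine radFiltration_succ_le_of_complementedIcc hJ fun C h₁ h₂ => ?_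
      rcases hJ''.eq_or_eq h₁ h₂ with rfl | rfl
      · exact ⟨_, inf_eq_left.2 hJ, sup_eq_right.2 hJ⟩
      · exact ⟨J, inf_eq_right.2 hJ, sup_eq_left.2 hJ⟩
    rw [heq] at h1
    exact hJ''.lt.not_ge h1

variable (L) in
theorem exists_radFiltration_eq_bot : ∃ n, radFiltration L n = ⊥ := by
  by_contra! h
  have : WellFoundedLT (LieIdeal ℝ L) := LieSubmodule.wellFoundedLT_of_isArtinian ℝ L L
  obtain ⟨n, hn⟩ := WellFounded.not_rel_apply_succ (r := (· < ·)) (radFiltration L)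
  exact hn (radFiltration_succ_lt (h n))

end RadFiltration

/-! ### Ideals and the radical filtration under surjective homomorphisms. -/

section Surjective

variable {G L : Type*} [LieRing G] [LieAlgebra ℝ G] [LieRing L] [LieAlgebra ℝ L]
  {p : G →ₗ⁅ℝ⁆ L}

theorem comap_injective_of_surjective (hp : Function.Surjective p) : Function.Injective (LieIdeal.comap p) := by
  intro I J h
  ext x
  obtain ⟨y, rfl⟩ := hp x
  rw [← LieIdeal.mem_comap, h, LieIdeal.mem_comap]

theorem mem_map_iff_of_surjective (hp : Function.Surjective p) {I : LieIdeal ℝ G} {x : L} :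
    x ∈ I.map p ↔ ∃ y ∈ I, p y = x := by
  constructor
  · intro h
    obtain ⟨y, hy⟩ := LieIdeal.mem_map_of_surjective hp h
    exact ⟨y, y.2, hy⟩
  · rintro ⟨y, hy, rfl⟩
    exact LieIdeal.mem_map hy

theorem comap_map_of_surjective (hp : Function.Surjective p) (I : LieIdeal ℝ G) : (I.map p).comap p = I ⊔ p.ker := by
  apply LieIdeal.comap_map_eq
  ext x
  exact mem_map_iff_of_surjective hp

theorem complementedIcc_comap_iff (hp : Function.Surjective p) {a b : LieIdeal ℝ L} :
    ComplementedIcc (a.comap p) (b.comap p) ↔ ComplementedIcc a b := by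
  apply complementedIcc_map_iff (comap_injective_of_surjective hp)
  · intro x y
    ext z
    simp only [LieIdeal.mem_comap, LieSubmodule.mem_inf]
  · intro x y
    apply le_antisymm
    · intro z hz
      obtain ⟨u, hu, v, hv, h⟩ := (LieSubmodule.mem_sup _ _ _).1 (LieIdeal.mem_comap.1 hz)
      obtain ⟨v, rfl⟩ := hp v
      rw [← sub_add_cancel z v]
      refine (LieSubmodule.mem_sup _ _ _).2 ⟨_, LieIdeal.mem_comap.2 ?_, _,
        LieIdeal.mem_comap.2 hv, rfl⟩
      rw [map_sub, ← h, add_sub_cancel_right]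
      exact hu
    · exact sup_le (LieIdeal.comap_mono le_sup_left) (LieIdeal.comap_mono le_sup_right)
  · intro c hc _
    refine ⟨c.map p, ?_⟩
    rw [comap_map_of_surjective hp, sup_eq_left]
    exact (LieHom.ker_le_comap p a).trans hc

theorem ComplementedIcc.map_of_surjective (hp : Function.Surjective p) {a b : LieIdeal ℝ G} (hab : a ≤ b)
    (h : ComplementedIcc a b) : ComplementedIcc (a.map p) (b.map p) := by
  rw [← complementedIcc_comap_iff hp, comap_map_of_surjective hp, comap_map_of_surjective hp]
  exact h.sup_right hab _

/-- Both inclusions use the minimality of `R_{k+1}`: semi-simple quotients pull back to `R_k(G)`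
along `p`, and images of semi-simple quotients are semi-simple. -/
theorem map_radFiltration [FiniteDimensional ℝ G] [FiniteDimensional ℝ L]
    (hp : Function.Surjective p) (k : ℕ) :
    (radFiltration G k).map p = radFiltration L k := by
  induction k with
  | zero =>
    ext x
    obtain ⟨y, rfl⟩ := hp x
    exact ⟨fun _ => trivial, fun _ => LieIdeal.mem_map trivial⟩
  | succ k ih =>
    apply le_antisymm
    · rw [LieIdeal.map_le_iff_le_comap]
      have h := (complementedIcc_comap_iff hp).2 (complementedIcc_radFiltration (L := L) k)
      have hk : radFiltration G k ≤ (radFiltration L k).comap p := by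
        rw [← LieIdeal.map_le_iff_le_comap, ih]
      refine (radFiltration_succ_le_of_complementedIcc inf_le_right
        ((complementedIcc_inf_iff _ _).2 (h.mono le_rfl ?_))).trans inf_le_left
      exact sup_le (LieIdeal.comap_mono (radFiltration_succ_le k)) hk
    · apply radFiltration_succ_le_of_complementedIcc
      · rw [← ih]
        exact LieIdeal.map_mono (radFiltration_succ_le k)
      · rw [← ih]
        exact (complementedIcc_radFiltration k).map_of_surjective hp (radFiltration_succ_le k)

end Surjective

/-! ### The radical acts trivially on semi-simple modules -/

section SemisimpleModule

open LieModule LieAlgebra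

attribute [local instance] LieRing.ofAssociativeRing

variable {L : Type*} [LieRing L] [LieAlgebra ℝ L]
variable {A : Type*} [AddCommGroup A] [Module ℝ A] [LieRingModule L A] [LieModule ℝ L A]

/-- The action on `N' / N` is trivial, so every linear complement is a submodule. -/
theorem complementedIcc_of_lie_mem {N N' : LieSubmodule ℝ L A}
    (h : ∀ a ∈ N', ∀ x : L, ⁅x, a⁆ ∈ N) : ComplementedIcc N N' := by
  intro C hNC hCN'
  obtain ⟨D, hD, hD'⟩ := ((complementedLattice_iff_complementedIcc (α := Submodule ℝ A)).1
    inferInstance).mono (a' := N.toSubmodule) (b' := N'.toSubmodule) bot_le le_top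
    C.toSubmodule hNC hCN'
  have hND : N.toSubmodule ≤ D := hD ▸ inf_le_right
  have hDN' : D ≤ N'.toSubmodule := hD' ▸ le_sup_right
  refine ⟨{ D with lie_mem := fun {x m} hm => hND (h m (hDN' hm) x) }, ?_, ?_⟩
  · rw [← LieSubmodule.toSubmodule_inj, LieSubmodule.inf_toSubmodule]
    exact hD
  · rw [← LieSubmodule.toSubmodule_inj, LieSubmodule.sup_toSubmodule]
    exact hD'

/-- A complement `C` of the submodule `I A` satisfies `I C ⊆ C ∩ I A = 0`, hence `I (I A) = I A`.
Nilpotency then forces `I A = 0`. -/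
theorem le_ker_of_isNilpotent (hA : IsSemisimpleLieModule L A) (I : LieIdeal ℝ L)
    (hI : LieModule.IsNilpotent I A) : I ≤ LieModule.ker ℝ L A := by
  have : ComplementedLattice (LieSubmodule ℝ L A) := hA
  obtain ⟨C, hC⟩ := exists_isCompl ⁅I, (⊤ : LieSubmodule ℝ L A)⁆
  have hIC : ⁅I, C⁆ = ⊥ := by
    rw [eq_bot_iff, ← hC.inf_eq_bot]
    exact le_inf (LieSubmodule.mono_lie_right _ le_top) (LieSubmodule.lie_le_right _ _)
  have hD : ⁅I, ⁅I, (⊤ : LieSubmodule ℝ L A)⁆⁆ = ⁅I, (⊤ : LieSubmodule ℝ L A)⁆ := by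
    conv_rhs => rw [← hC.sup_eq_top, LieSubmodule.lie_sup, hIC, sup_bot_eq]
  have hlcs (k : ℕ) : ⁅I, (⊤ : LieSubmodule ℝ L A)⁆ ≤ I.lcs A k := by
    induction k with
    | zero => simp
    | succ k ih =>
      rw [LieIdeal.lcs_succ, ← hD]
      exact LieSubmodule.mono_lie_right _ ih
  obtain ⟨k, hk⟩ := (LieModule.isNilpotent_iff ℝ I A).1 hI
  intro x hx
  rw [LieModule.mem_ker]
  intro a
  have h1 := hlcs k (LieSubmodule.lie_mem_lie hx (LieSubmodule.mem_top a))
  rw [← LieSubmodule.mem_toSubmodule, LieIdeal.coe_lcs_eq, hk] at h1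
  simpa using h1

/-- The orthogonal complement of an ideal with respect to the trace form of a module. -/
def traceOrthogonal (A : Type*) [AddCommGroup A] [Module ℝ A] [LieRingModule L A]
    [LieModule ℝ L A] (X : LieIdeal ℝ L) : LieIdeal ℝ L :=
  InvariantForm.orthogonal (traceForm ℝ L A) (traceForm_lieInvariant ℝ L A) X

theorem mem_traceOrthogonal {X : LieIdeal ℝ L} {y : L} :
    y ∈ traceOrthogonal A X ↔ ∀ x ∈ X, traceForm ℝ L A x y = 0 :=
  InvariantForm.mem_orthogonal _ _ _ _

variable [FiniteDimensional ℝ A]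

theorem le_ker_of_forall_isNilpotent (hA : IsSemisimpleLieModule L A) (I : LieIdeal ℝ L)
    (hI : ∀ x ∈ I, IsNilpotent (toEnd ℝ L A x)) : I ≤ LieModule.ker ℝ L A :=
  le_ker_of_isNilpotent hA I
    ((LieModule.isNilpotent_iff_forall' (R := ℝ)).2 fun x => hI x x.2)

/-- For `e ∈ E` and `y ∈ Y` the operators of `e` and `y` commute, so `tr([x, y] eⁿ) = 0` by
cyclicity of the trace. Since `e` is a sum of such brackets, all traces `tr(e^{n+1})` vanish and `e`
acts nilpotently. -/
theorem le_ker_of_le_lie (hA : IsSemisimpleLieModule L A) {E Y : LieIdeal ℝ L}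
    (hE : E ≤ ⁅(⊤ : LieIdeal ℝ L), Y⁆) (hEY : ⁅E, Y⁆ ≤ LieModule.ker ℝ L A) :
    E ≤ LieModule.ker ℝ L A := by
  refine le_ker_of_forall_isNilpotent hA E fun e he => isNilpotent_of_trace_pow_eq_zero _ fun n => ?_
  have hcomm (y : L) (hy : y ∈ Y) : Commute (toEnd ℝ L A e) (toEnd ℝ L A y) := by
    have h := hEY (LieSubmodule.lie_mem_lie he hy)
    ext a
    have h' := (LieModule.mem_ker ℝ L A _).1 h a
    rw [lie_lie, sub_eq_zero] at h'
    exact h'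
  have key (z : L) (hz : z ∈ ⁅(⊤ : LieIdeal ℝ L), Y⁆) :
      LinearMap.trace ℝ A (toEnd ℝ L A z * toEnd ℝ L A e ^ n) = 0 := by
    rw [← LieSubmodule.mem_toSubmodule, LieSubmodule.lieIdeal_oper_eq_linear_span'] at hz
    induction hz using Submodule.span_induction with
    | mem z hz =>
      obtain ⟨x, -, y, hy, rfl⟩ := hz
      rw [LieHom.map_lie, LieRing.of_associative_ring_bracket, sub_mul, map_sub, sub_eq_zero,
        mul_assoc, ← ((hcomm y hy).pow_left n).eq, ← mul_assoc, LinearMap.trace_mul_comm, mul_assoc]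
    | zero => simp
    | add x y _ _ hx hy => rw [map_add, add_mul, map_add, hx, hy, add_zero]
    | smul t x _ hx => rw [map_smul, smul_mul_assoc, map_smul, hx, smul_zero]
  rw [pow_succ']
  exact key e (hE he)

/-- On `I = X ∩ X^⊥` the trace form vanishes, so Cartan's criterion makes `[I, I]` act nilpotently,
hence trivially. `le_ker_of_le_lie` with `Y = I` extends this to `[𝔩, I]`. -/
theorem lie_inf_traceOrthogonal_le_ker (hA : IsSemisimpleLieModule L A) (X : LieIdeal ℝ L) :
    ⁅(⊤ : LieIdeal ℝ L), X ⊓ traceOrthogonal A X⁆ ≤ LieModule.ker ℝ L A := by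
  set I := X ⊓ traceOrthogonal A X with hI
  have h0 : traceForm ℝ I A = 0 := by
    ext ⟨x, hx⟩ ⟨y, hy⟩
    exact mem_traceOrthogonal.1 hy.2 x hx.1
  have h1 := LieModule.isNilpotent_derivedSeries_of_traceForm_eq_zero h0
  have h2 : ⁅I, I⁆ ≤ LieModule.ker ℝ L A := by
    refine le_ker_of_forall_isNilpotent hA _ fun x hx => ?_
    have hxI : x ∈ I := LieSubmodule.lie_le_left I I hx
    refine (LieModule.isNilpotent_iff_forall' (R := ℝ)).mp h1 ⟨⟨x, hxI⟩, ?_⟩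
    rwa [LieIdeal.derivedSeries_eq_derivedSeriesOfIdeal_comap, LieIdeal.mem_comap]
  exact le_ker_of_le_lie hA le_rfl
    ((LieSubmodule.mono_lie_left _ (LieSubmodule.lie_le_right _ _)).trans h2)

theorem inf_traceOrthogonal_le_ker (hA : IsSemisimpleLieModule L A) {X : LieIdeal ℝ L}
    (hX : X ≤ ⁅(⊤ : LieIdeal ℝ L), (⊤ : LieIdeal ℝ L)⁆) :
    X ⊓ traceOrthogonal A X ≤ LieModule.ker ℝ L A := by
  refine le_ker_of_le_lie hA (Y := ⊤) (inf_le_left.trans hX) ?_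
  rw [LieSubmodule.lie_comm]
  exact lie_inf_traceOrthogonal_le_ker hA X

variable [FiniteDimensional ℝ L]

/-- A dimension count: `X ∩ X^⊥` acts by zero, so it lies in the radical of the trace form, and
`X^⊥` is large enough to fill up `𝔩`. -/
theorem sup_traceOrthogonal_eq_top (hA : IsSemisimpleLieModule L A) {X : LieIdeal ℝ L}
    (hX : X ≤ ⁅(⊤ : LieIdeal ℝ L), (⊤ : LieIdeal ℝ L)⁆) :
    X ⊔ traceOrthogonal A X = ⊤ := by
  let B : LinearMap.BilinForm ℝ L := traceForm ℝ L A
  have hB : B.IsRefl := fun x y h => by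
    rw [← h]
    exact traceForm_comm ℝ L A y x
  have h1 := B.finrank_add_finrank_orthogonal hB X.toSubmodule
  have h2 := Submodule.finrank_sup_add_finrank_inf_eq X.toSubmodule (traceOrthogonal A X).toSubmodule
  have h3 : (traceOrthogonal A X).toSubmodule = B.orthogonal X.toSubmodule := rfl
  have h4 : X.toSubmodule ⊓ B.orthogonal X.toSubmodule ≤ X.toSubmodule ⊓ B.orthogonal ⊤ := by
    intro x hx
    refine ⟨hx.1, fun y _ => ?_⟩
    have h5 := inf_traceOrthogonal_le_ker hA hX ⟨hx.1, hx.2⟩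
    have h6 : toEnd ℝ L A x = 0 := by
      ext a
      exact (LieModule.mem_ker ℝ L A _).1 h5 a
    change traceForm ℝ L A y x = 0
    rw [traceForm_apply_apply, h6, LinearMap.comp_zero, map_zero]
  have h5 := Submodule.finrank_mono h4
  rw [h3] at h2
  rw [← LieSubmodule.toSubmodule_eq_top, LieSubmodule.sup_toSubmodule]
  apply Submodule.eq_top_of_finrank_eq
  apply le_antisymm (Submodule.finrank_le _)
  rw [h3]
  omega

/-- The quotient `𝔩 / ker ρ` is reductive. In `P = [𝔩, 𝔩]` trace-orthogonal complements serve as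
complements modulo `K`; on `Z / K`, the centre of `𝔩 / K`, the action is trivial; and `P^⊥ ⊆ Z`, so
`P` and `Z` span `𝔩`. -/
theorem complementedIcc_ker_top (hA : IsSemisimpleLieModule L A) :
    ComplementedIcc (LieModule.ker ℝ L A) ⊤ := by
  set K := LieModule.ker ℝ L A
  set P := ⁅(⊤ : LieIdeal ℝ L), (⊤ : LieIdeal ℝ L)⁆
  have hP : ComplementedIcc (K ⊓ P) P := by
    intro X hKX hXP
    refine ⟨P ⊓ traceOrthogonal A X, le_antisymm ?_ (le_inf hKX (le_inf inf_le_right ?_)), ?_⟩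
    · exact le_inf ((le_inf inf_le_left (inf_le_right.trans inf_le_right)).trans
        (inf_traceOrthogonal_le_ker hA hXP)) (inf_le_left.trans hXP)
    · intro x hx
      have h6 : toEnd ℝ L A x = 0 := by
        ext a
        exact (LieModule.mem_ker ℝ L A _).1 hx.1 a
      refine mem_traceOrthogonal.2 fun y _ => ?_
      rw [traceForm_apply_apply, h6, LinearMap.comp_zero, map_zero]
    · rw [inf_comm P, ← sup_inf_assoc_of_le _ hXP, sup_traceOrthogonal_eq_top hA hXP, top_inf_eq]
  let Z : LieIdeal ℝ L :=
    (maxTrivSubmodule ℝ L (L ⧸ K)).comap (LieSubmodule.Quotient.mk' K)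
  have hZ (z : L) : z ∈ Z ↔ ∀ x : L, ⁅x, z⁆ ∈ K := by
    rw [LieSubmodule.mem_comap, mem_maxTrivSubmodule]
    refine forall_congr' fun x => ?_
    rw [← LieModuleHom.map_lie]
    exact LieSubmodule.Quotient.mk_eq_zero K
  have hKZ : K ≤ Z := fun z hz => (hZ z).2 fun x => lie_mem_right ℝ L K x z hz
  have hCZ : ComplementedIcc K Z := complementedIcc_of_lie_mem fun z hz => (hZ z).1 hz
  have hPZ : (K ⊔ P) ⊔ Z = ⊤ := by
    rw [eq_top_iff, ← sup_traceOrthogonal_eq_top hA (le_refl P)]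
    refine sup_le (le_sup_right.trans le_sup_left) (le_trans ?_ le_sup_right)
    intro z hz
    refine (hZ z).2 fun x => inf_traceOrthogonal_le_ker hA (le_refl P) ⟨?_, ?_⟩
    · exact LieSubmodule.lie_mem_lie trivial trivial
    · exact lie_mem_right ℝ L _ x z hz
  rw [← hPZ]
  exact ComplementedIcc.sup le_sup_left ((complementedIcc_inf_iff K P).1 hP) hCZ hKZ

/-- The nilpotent radical of a Lie algebra acts trivially on every semi-simple module. -/
theorem radFiltration_le_ker (hA : IsSemisimpleLieModule L A) {k : ℕ} (hk : 1 ≤ k) :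
    radFiltration L k ≤ LieModule.ker ℝ L A :=
  (radFiltration_antitone hk).trans
    (radFiltration_succ_le_of_complementedIcc (k := 0) le_top (complementedIcc_ker_top hA))

end SemisimpleModule

/-! ### Orthogonal complements of ideals in metric Lie algebras -/

namespace MetricInvolution

variable {G : Type*} [LieRing G] [LieAlgebra ℝ G] [FiniteDimensional ℝ G]
  (m : MetricInvolution G)

theorem lieInvariant : m.form.lieInvariant G := fun x y z =>
  eq_neg_of_add_eq_zero_left (m.invariant x y z)

/-- The orthogonal complement of an ideal. -/
def orth (I : LieIdeal ℝ G) : LieIdeal ℝ G :=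
  LieAlgebra.InvariantForm.orthogonal m.form m.lieInvariant I

theorem mem_orth {I : LieIdeal ℝ G} {y : G} : y ∈ m.orth I ↔ ∀ x ∈ I, m.form x y = 0 :=
  LieAlgebra.InvariantForm.mem_orthogonal _ _ _ _

theorem orth_antitone : Antitone m.orth := fun _ _ h _ hy =>
  m.mem_orth.2 fun x hx => m.mem_orth.1 hy x (h hx)

theorem isRefl : m.form.IsRefl := fun x y h => by rw [m.symm, h]

theorem orth_orth (I : LieIdeal ℝ G) : m.orth (m.orth I) = I := by
  rw [← LieSubmodule.toSubmodule_inj]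
  exact LinearMap.BilinForm.orthogonal_orthogonal m.nondegenerate m.isRefl _

theorem complementedIcc_orth {a b : LieIdeal ℝ G} (h : ComplementedIcc a b) :
    ComplementedIcc (m.orth b) (m.orth a) :=
  h.antitone m.orth_orth m.orth_antitone

theorem orth_sup_orth (a b : LieIdeal ℝ G) : m.orth (a ⊓ m.orth b) = m.orth a ⊔ b := by
  apply le_antisymm
  · rw [← m.orth_orth (m.orth a ⊔ b)]
    apply m.orth_antitone
    exact le_inf ((m.orth_antitone le_sup_left).trans (m.orth_orth a).le)
      (m.orth_antitone le_sup_right)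
  · refine sup_le (m.orth_antitone inf_le_left) ?_
    conv_lhs => rw [← m.orth_orth b]
    exact m.orth_antitone inf_le_right

/-- The socle filtration of a metric Lie algebra. -/
def socFiltration (k : ℕ) : LieIdeal ℝ G := m.orth (radFiltration G k)

theorem socFiltration_mono : Monotone m.socFiltration := fun _ _ h =>
  m.orth_antitone (radFiltration_antitone h)

theorem socFiltration_zero : m.socFiltration 0 = ⊥ := by
  rw [eq_bot_iff]
  intro x hx
  exact (LieSubmodule.mem_bot x).2
    (m.nondegenerate.1 x fun y => by rw [m.symm]; exact m.mem_orth.1 hx y trivial)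

/-- Orthogonal complements reverse intervals: if `(S_k + W) / S_k` is semi-simple, so is `R_k / (S_k
+ W)^⊥`, whence `R_{k+1} ≤ (S_k + W)^⊥`. -/
theorem le_socFiltration_succ {k : ℕ} {W : LieIdeal ℝ G}
    (h : ComplementedIcc (W ⊓ m.socFiltration k) W) : W ≤ m.socFiltration (k + 1) := by
  rw [inf_comm, complementedIcc_inf_iff] at h
  have h1 := m.complementedIcc_orth h
  rw [socFiltration, m.orth_orth] at h1
  have h2 : m.orth (m.orth (radFiltration G k) ⊔ W) ≤ radFiltration G k :=
    (m.orth_antitone le_sup_left).trans (m.orth_orth _).le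
  have h3 := m.orth_antitone (radFiltration_succ_le_of_complementedIcc h2 h1)
  rw [m.orth_orth] at h3
  exact le_sup_right.trans h3

/-- `R_k ∩ S_{k+1}`. -/
def mixedLayer (k : ℕ) : LieIdeal ℝ G := radFiltration G k ⊓ m.socFiltration (k + 1)

theorem mixedLayer_inf_socFiltration (k : ℕ) :
    m.mixedLayer k ⊓ m.socFiltration k = radFiltration G k ⊓ m.socFiltration k := by
  rw [mixedLayer, inf_assoc, inf_eq_right.2 (m.socFiltration_mono (Nat.le_succ k))]

/-- The quotient embeds into `S_{k+1} / S_k`, which is dual to the semi-simple `R_k / R_{k+1}`. -/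
theorem complementedIcc_mixedLayer (k : ℕ) :
    ComplementedIcc (m.mixedLayer k ⊓ m.socFiltration k) (m.mixedLayer k) := by
  rw [inf_comm, complementedIcc_inf_iff]
  refine (m.complementedIcc_orth (complementedIcc_radFiltration k)).mono le_rfl ?_
  exact sup_le (m.socFiltration_mono (Nat.le_succ k)) inf_le_right

/-- If an ideal `I` contains all `R_k ∩ S_k` and its orthogonal complement all `R_k ∩ S_{k+1}`,
then it is the sum of all `R_k ∩ S_k`. -/
theorem eq_iSup_radFiltration_inf_socFiltration {I : LieIdeal ℝ G}
    (h₁ : ∀ k, radFiltration G k ⊓ m.socFiltration k ≤ I)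
    (h₂ : ∀ k, m.mixedLayer k ≤ m.orth I) :
    I = ⨆ k, radFiltration G k ⊓ m.socFiltration k := by
  apply le_antisymm _ (iSup_le h₁)
  set J := ⨆ k, radFiltration G k ⊓ m.socFiltration k with hJ
  -- The second hypothesis dualises to `I ≤ S_k + R_{k+1}`. This pushes the `R_k`-part of an element
  -- of `I` into `R_{k+1}` modulo `R_k ∩ S_k`, and `R_n = 0` for some `n`.
  have key (k : ℕ) : I ≤ radFiltration G k ⊔ J := by
    induction k with
    | zero => exact le_sup_of_le_left le_top
    | succ k ih =>
      have h3 : I ≤ m.socFiltration k ⊔ radFiltration G (k + 1) := by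
        have h := m.orth_antitone (h₂ k)
        rw [m.orth_orth, mixedLayer, socFiltration, m.orth_sup_orth] at h
        exact h
      intro z hz
      obtain ⟨r, hr, j, hj, rfl⟩ := (LieSubmodule.mem_sup _ _ _).1 (ih hz)
      have hrI : r ∈ I := by
        have := sub_mem hz (iSup_le h₁ hj)
        rwa [add_sub_cancel_right] at this
      obtain ⟨s, hs, r', hr', rfl⟩ := (LieSubmodule.mem_sup _ _ _).1 (h3 hrI)
      have hsk : s ∈ radFiltration G k := by
        have := sub_mem hr (radFiltration_succ_le k hr')
        rwa [add_sub_cancel_right] at this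
      rw [add_comm s r', add_assoc]
      refine add_mem (le_sup_left (a := radFiltration G (k + 1)) hr')
        (le_sup_right (a := radFiltration G (k + 1)) (add_mem ?_ hj))
      exact le_iSup (fun k => radFiltration G k ⊓ m.socFiltration k) k ⟨hsk, hs⟩
  obtain ⟨n, hn⟩ := exists_radFiltration_eq_bot G
  simpa [hn] using key n

variable {m}

theorem Iso.map_socFiltration {G₂ : Type*} [LieRing G₂] [LieAlgebra ℝ G₂]
    [FiniteDimensional ℝ G₂] {m₂ : MetricInvolution G₂} (F : m.Iso m₂) {k : ℕ} {x : G}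
    (hx : x ∈ m.socFiltration k) : F.toEquiv x ∈ m₂.socFiltration k := by
  refine m₂.mem_orth.2 fun y hy => ?_
  rw [← map_radFiltration (p := F.toEquiv.toLieHom) F.toEquiv.surjective,
    mem_map_iff_of_surjective F.toEquiv.surjective] at hy
  obtain ⟨y, hy, rfl⟩ := hy
  exact (F.isometry y x).trans (m.mem_orth.1 hx y hy)

theorem Iso.map_iSup {G₂ : Type*} [LieRing G₂] [LieAlgebra ℝ G₂]
    [FiniteDimensional ℝ G₂] {m₂ : MetricInvolution G₂} (F : m.Iso m₂) {x : G}
    (hx : x ∈ ⨆ k, radFiltration G k ⊓ m.socFiltration k) :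
    F.toEquiv x ∈ ⨆ k, radFiltration G₂ k ⊓ m₂.socFiltration k := by
  have h : (⨆ k, radFiltration G k ⊓ m.socFiltration k)
      ≤ (⨆ k, radFiltration G₂ k ⊓ m₂.socFiltration k).comap F.toEquiv.toLieHom := by
    refine iSup_le fun k y hy => LieIdeal.mem_comap.2 ?_
    refine le_iSup (fun k => radFiltration G₂ k ⊓ m₂.socFiltration k) k
      ⟨?_, F.map_socFiltration hy.2⟩
    rw [← map_radFiltration (p := F.toEquiv.toLieHom) F.toEquiv.surjective]
    exact LieIdeal.mem_map hy.1
  exact h hx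

end MetricInvolution

/-! ### The invariants of a semi-simple orthogonal module -/

section Invariants

variable {L : Type*} [LieRing L] [LieAlgebra ℝ L] {θ : LieInvolution L}
variable {A : Type*} [AddCommGroup A] [Module ℝ A] [FiniteDimensional ℝ A]
  [LieRingModule L A] [LieModule ℝ L A] (M : OrthogonalModule θ A)

theorem OrthogonalModule.isRefl : M.form.IsRefl := fun x y h => by rw [M.symm, h]

/-- Invariants are orthogonal to `ρ(𝔩)𝔞` by skewness, so pairing with an invariant only sees the
`𝔞^𝔩`-component. -/
theorem OrthogonalModule.form_projection (h : IsSemisimpleLieModule L A) {a : A}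
    (ha : ∀ x : L, ⁅x, a⁆ = 0) (b : A) :
    M.form a (Submodule.projection _ _ (isCompl_invariants h) b) = M.form a b := by
  have h1 : ∀ b ∈ (⁅(⊤ : LieIdeal ℝ L), (⊤ : LieSubmodule ℝ L A)⁆).toSubmodule,
      M.form a b = 0 := by
    intro b hb
    rw [LieSubmodule.lieIdeal_oper_eq_linear_span'] at hb
    induction hb using Submodule.span_induction with
    | mem z hz =>
      obtain ⟨x, -, y, -, rfl⟩ := hz
      rw [← neg_eq_zero, ← M.form_lie, ha, map_zero, LinearMap.zero_apply]
    | zero => simp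
    | add x y _ _ hx hy => rw [map_add, hx, hy, add_zero]
    | smul t x _ hx => rw [map_smul, hx, smul_zero]
  have h2 := h1 _ (Submodule.sub_projection_mem (isCompl_invariants h) b)
  rw [map_sub, sub_eq_zero] at h2
  exact h2.symm

/-- The form stays non-degenerate on `𝔞^𝔩`, because `𝔞^𝔩` and `ρ(𝔩)𝔞` are orthogonal and span `𝔞`.
-/
theorem OrthogonalModule.eq_zero_of_invariant (h : IsSemisimpleLieModule L A) {a : A}
    (ha : ∀ x : L, ⁅x, a⁆ = 0) (h0 : ∀ b : A, (∀ x : L, ⁅x, b⁆ = 0) → M.form a b = 0) :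
    a = 0 := by
  refine M.nondegenerate.1 a fun b => ?_
  rw [← M.form_projection h ha]
  refine h0 _ ((LieModule.mem_maxTrivSubmodule ℝ L A _).1 ?_)
  exact Submodule.projection_apply_mem (isCompl_invariants h) b

theorem alphaZeroKer_le (h : IsSemisimpleLieModule L A) (α : twoCochain ℝ L A)
    (V : Submodule ℝ L) {b : A} (hb : b ∈ alphaZeroKer h α V) (x : L) : ⁅x, b⁆ = 0 := by
  obtain ⟨t, -, rfl⟩ := hb
  refine (LieModule.mem_maxTrivSubmodule ℝ L A _).1 ?_ x
  induction t with
  | zero => simp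
  | tmul x y => exact Submodule.projection_apply_mem (isCompl_invariants h) _
  | add x y hx hy => rw [map_add]; exact add_mem hx hy

/-- By `hZ` the functional `⟨a, α₀(·)⟩` factors through the bracket, so it vanishes on the kernel of
the bracket. -/
theorem OrthogonalModule.form_alphaZeroKer_eq_zero (h : IsSemisimpleLieModule L A)
    {α : twoCochain ℝ L A} {V : Submodule ℝ L} {a : A} (ha : ∀ x : L, ⁅x, a⁆ = 0)
    {Z : Module.Dual ℝ L} (hZ : ∀ x ∈ V, ∀ y ∈ V, M.form a (α x y) = - Z ⁅x, y⁆) {b : A}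
    (hb : b ∈ alphaZeroKer h α V) : M.form a b = 0 := by
  obtain ⟨t, ht, rfl⟩ := hb
  have h1 : M.form a ∘ₗ TensorProduct.lift ((alphaZero h α).domRestrict₁₂ V V)
      = - Z ∘ₗ TensorProduct.lift
        ((LieModule.toEnd ℝ L L : L →ₗ[ℝ] Module.End ℝ L).domRestrict₁₂ V V) := by
    ext x y
    exact (M.form_projection h ha (α x y)).trans (hZ x x.2 y y.2)
  have h2 := congrArg (fun f => f t) h1
  simp only [LinearMap.comp_apply, LinearMap.neg_apply, LinearMap.mem_ker.1 ht] at h2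
  rw [h2, map_zero, neg_zero]

/-- A functional vanishing on the kernel of a linear map factors through that map; here the map is
the bracket. -/
theorem OrthogonalModule.exists_dual_of_form_alphaZeroKer (h : IsSemisimpleLieModule L A)
    {α : twoCochain ℝ L A} {a : A} (ha : ∀ x : L, ⁅x, a⁆ = 0)
    (h0 : ∀ b ∈ alphaZeroKer h α ⊤, M.form a b = 0) :
    ∃ Z : Module.Dual ℝ L, ∀ x y, M.form a (α x y) = - Z ⁅x, y⁆ := by
  let β := TensorProduct.lift
    ((LieModule.toEnd ℝ L L : L →ₗ[ℝ] Module.End ℝ L).domRestrict₁₂ (⊤ : Submodule ℝ L) ⊤)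
  let φ := M.form a ∘ₗ TensorProduct.lift ((alphaZero h α).domRestrict₁₂ (⊤ : Submodule ℝ L) ⊤)
  have hφ : φ ∈ (LinearMap.ker β).dualAnnihilator := by
    rw [Submodule.mem_dualAnnihilator]
    exact fun t ht => h0 _ ⟨t, ht, rfl⟩
  rw [← LinearMap.range_dualMap_eq_dualAnnihilator_ker] at hφ
  obtain ⟨Z, hZ⟩ := hφ
  refine ⟨-Z, fun x y => ?_⟩
  have := congrArg (fun f => f (TensorProduct.tmul ℝ (⟨x, trivial⟩ : (⊤ : Submodule ℝ L))
    (⟨y, trivial⟩ : (⊤ : Submodule ℝ L)))) hZ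
  rw [LinearMap.neg_apply, neg_neg]
  exact (M.form_projection h ha (α x y)).symm.trans this.symm

end Invariants

/-! ### The ideals `𝔩^*` and `𝔩^* ⊕ 𝔞` of the standard model -/

namespace StdModel

variable {L : Type*} [LieRing L] [LieAlgebra ℝ L] {θ : LieInvolution L}
variable {A : Type*} [AddCommGroup A] [Module ℝ A] [FiniteDimensional ℝ A]
  [LieRingModule L A] [LieModule ℝ L A] {M : OrthogonalModule θ A} {c : QuadraticCocycle M}

@[simp] theorem dual_neg (X : StdModel c) : (-X).dual = -X.dual := rfl
@[simp] theorem mid_neg (X : StdModel c) : (-X).mid = -X.mid := rfl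
@[simp] theorem base_neg (X : StdModel c) : (-X).base = -X.base := rfl
@[simp] theorem dual_sub (X Y : StdModel c) : (X - Y).dual = X.dual - Y.dual := rfl
@[simp] theorem mid_sub (X Y : StdModel c) : (X - Y).mid = X.mid - Y.mid := rfl
@[simp] theorem base_sub (X Y : StdModel c) : (X - Y).base = X.base - Y.base := rfl

variable (c)

/-- The projection to `𝔩`. -/
def baseHom : StdModel c →ₗ⁅ℝ⁆ L where
  toFun := base
  map_add' _ _ := rfl
  map_smul' _ _ := rfl
  map_lie' := rfl

/-- The component in `𝔞` as a linear map. -/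
def midLinear : StdModel c →ₗ[ℝ] A where
  toFun := mid
  map_add' _ _ := rfl
  map_smul' _ _ := rfl

/-- The component in `𝔩^*` as a linear map. -/
def dualLinear : StdModel c →ₗ[ℝ] Module.Dual ℝ L where
  toFun := dual
  map_add' _ _ := rfl
  map_smul' _ _ := rfl

theorem baseHom_surjective : Function.Surjective (baseHom c) := fun x => ⟨mk 0 0 x, rfl⟩

variable {c}

theorem mem_ker_baseHom {X : StdModel c} : X ∈ (baseHom c).ker ↔ X.base = 0 :=
  LieHom.mem_ker

variable (c)

/-- The ideal `𝔩^* ⊕ N` for a submodule `N` of `𝔞`. -/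
def midIdeal (N : LieSubmodule ℝ L A) : LieIdeal ℝ (StdModel c) where
  carrier := {X | X.base = 0 ∧ X.mid ∈ N}
  add_mem' {X Y} hX hY := ⟨by simp [hX.1, hY.1], by simpa using add_mem hX.2 hY.2⟩
  zero_mem' := ⟨rfl, by simp⟩
  smul_mem' t X hX := ⟨by simp [hX.1], by simpa using N.smul_mem t hX.2⟩
  lie_mem {X Y} hY := ⟨by rw [base_lie, hY.1, lie_zero],
    by rw [mid_lie, hY.1]; simpa using N.lie_mem hY.2⟩

variable {c}

theorem mem_midIdeal {N : LieSubmodule ℝ L A} {X : StdModel c} :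
    X ∈ midIdeal c N ↔ X.base = 0 ∧ X.mid ∈ N := Iff.rfl

theorem mem_midIdeal_bot {X : StdModel c} :
    X ∈ midIdeal c ⊥ ↔ X.base = 0 ∧ X.mid = 0 := by
  rw [mem_midIdeal, LieSubmodule.mem_bot]

theorem midIdeal_mono : Monotone (midIdeal c) := fun _ _ h _ hX => ⟨hX.1, h hX.2⟩

theorem midIdeal_top : midIdeal c ⊤ = (baseHom c).ker := by
  ext X
  rw [mem_midIdeal, mem_ker_baseHom]
  exact ⟨fun h => h.1, fun h => ⟨h, trivial⟩⟩

/-- The submodule of the components in `𝔞` of the elements of an ideal contained in `𝔩^* ⊕ 𝔞`. -/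
def midSubmodule (W : LieIdeal ℝ (StdModel c)) (hW : W ≤ (baseHom c).ker) :
    LieSubmodule ℝ L A where
  __ := W.toSubmodule.map (midLinear c)
  lie_mem := by
    rintro x _ ⟨X, hX, rfl⟩
    refine ⟨⁅(mk 0 0 x : StdModel c), X⁆, W.lie_mem hX, ?_⟩
    have h0 : X.base = 0 := mem_ker_baseHom.1 (hW hX)
    change c.α x X.base + ⁅x, X.mid⁆ - ⁅X.base, (0 : A)⁆ = _
    rw [h0, map_zero, lie_zero, sub_zero, zero_add]
    rfl

theorem mem_midSubmodule {W : LieIdeal ℝ (StdModel c)} {hW : W ≤ (baseHom c).ker} {a : A} :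
    a ∈ midSubmodule W hW ↔ ∃ X ∈ W, X.mid = a := Iff.rfl

/-- The assignment `N ↦ 𝔩^* ⊕ N` identifies the submodules of `𝔞` with the ideals between `𝔩^*` and
`𝔩^* ⊕ 𝔞`. -/
theorem complementedIcc_midIdeal (h : IsSemisimpleLieModule L A) :
    ComplementedIcc (midIdeal c ⊥) (baseHom c).ker := by
  rw [isSemisimpleLieModule_iff] at h
  rw [← midIdeal_top]
  refine (complementedIcc_map_iff (f := midIdeal c) ?_ ?_ ?_ ?_).2 h
  · intro N N' hN
    ext a
    have := congrArg ((mk 0 a 0 : StdModel c) ∈ ·) hN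
    simpa [mem_midIdeal] using this
  · intro N N'
    ext X
    simp only [mem_midIdeal, LieSubmodule.mem_inf]
    tauto
  · intro N N'
    apply le_antisymm
    · intro X hX
      obtain ⟨a, ha, b, hb, hab⟩ := (LieSubmodule.mem_sup _ _ _).1 hX.2
      refine (LieSubmodule.mem_sup _ _ _).2 ⟨mk X.dual a 0, ⟨rfl, ha⟩, mk 0 b 0, ⟨rfl, hb⟩, ?_⟩
      ext
      · simp
      · simpa using hab
      · simpa using hX.1.symm
    · exact sup_le (midIdeal_mono le_sup_left) (midIdeal_mono le_sup_right)
  · intro C hC hC'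
    rw [midIdeal_top] at hC'
    refine ⟨midSubmodule C hC', ?_⟩
    ext X
    constructor
    · rintro ⟨hX, Y, hY, hXY⟩
      have : X - Y ∈ midIdeal c ⊥ :=
        mem_midIdeal_bot.2 ⟨by rw [base_sub, hX, mem_ker_baseHom.1 (hC' hY), sub_zero], by
          rw [mid_sub, sub_eq_zero]; exact hXY.symm⟩
      simpa using add_mem (hC this) hY
    · exact fun hX => ⟨mem_ker_baseHom.1 (hC' hX), X, hX, rfl⟩

theorem midIdeal_bot_le_ker : midIdeal c ⊥ ≤ (baseHom c).ker := by
  rw [← midIdeal_top]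
  exact midIdeal_mono bot_le

/-- The components of `[x, X] = 0` in `𝔞` and `𝔩^*` are the equations of `(A₀)` with `A₀ = -X.mid`
and `Z₀ = X.dual`. -/
theorem base_eq_zero_of_central (hc : IsAdmissibleCocycle c) {X : StdModel c}
    (hX : ∀ Y : StdModel c, ⁅Y, X⁆ = 0) : X.base = 0 := by
  refine hc.cond_A_zero X.base ?_ ?_ ⟨-X.mid, X.dual, fun x => ?_⟩
  · refine (LieModule.mem_maxTrivSubmodule ℝ L L _).2 fun x => ?_
    exact congrArg base (hX (mk 0 0 x))
  · refine (LieModule.mem_ker ℝ L A _).2 fun a => ?_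
    have := congrArg mid (hX (mk 0 a 0))
    simpa using this
  · have h := hX (mk 0 0 x)
    constructor
    · have := congrArg mid h
      simp only [mid_lie, base_mk, mid_mk, lie_zero, sub_zero, mid_zero] at this
      rw [lie_neg]
      exact eq_neg_of_add_eq_zero_left this
    · intro y
      have := congrArg (fun W => W.dual y) h
      simp only [dual_lie, base_mk, mid_mk, dual_mk, map_zero, LinearMap.zero_apply, dual_zero,
        lie_zero] at this
      rw [map_neg, LinearMap.neg_apply]
      linarith

theorem lie_mid_eq_zero_of_central {X : StdModel c} (hX : ∀ Y : StdModel c, ⁅Y, X⁆ = 0)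
    (h0 : X.base = 0) (x : L) : ⁅x, X.mid⁆ = 0 := by
  have := congrArg mid (hX (mk 0 0 x))
  simpa [h0] using this

theorem form_mid_of_central {X : StdModel c} (hX : ∀ Y : StdModel c, ⁅Y, X⁆ = 0)
    (h0 : X.base = 0) (x y : L) : M.form X.mid (c.α x y) = - X.dual ⁅x, y⁆ := by
  have := congrArg (fun W => W.dual y) (hX (mk 0 0 x))
  simp only [dual_lie, base_mk, mid_mk, dual_mk, map_zero, LinearMap.zero_apply, dual_zero,
    lie_zero, h0] at this
  linarith

/-! ### Orthogonality and the filtrations in the standard model. -/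

variable [FiniteDimensional ℝ L]

theorem form_apply (X Y : StdModel c) :
    (stdModel c).form X Y = M.form X.mid Y.mid + X.dual Y.base + Y.dual X.base := rfl

theorem orth_ker_baseHom : (stdModel c).orth (baseHom c).ker = midIdeal c ⊥ := by
  ext X
  rw [MetricInvolution.mem_orth, mem_midIdeal_bot]
  constructor
  · intro h
    constructor
    · refine (Module.forall_dual_apply_eq_zero_iff ℝ _).1 fun Z => ?_
      simpa [form_apply] using h (mk Z 0 0) (mem_ker_baseHom.2 rfl)
    · refine M.nondegenerate.1 _ fun a => ?_
      rw [M.symm]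
      simpa [form_apply] using h (mk 0 a 0) (mem_ker_baseHom.2 rfl)
  · rintro ⟨h, h'⟩ Y hY
    rw [mem_ker_baseHom] at hY
    simp [form_apply, h, h', hY]

theorem orth_midIdeal_bot : (stdModel c).orth (midIdeal c ⊥) = (baseHom c).ker := by
  rw [← orth_ker_baseHom, MetricInvolution.orth_orth]

/-- The quotient `T / (T ∩ 𝔩^*)` embeds into the semi-simple module `𝔞`. -/
theorem le_socFiltration_succ_of_le_ker (h : IsSemisimpleLieModule L A) {k : ℕ}
    {T : LieIdeal ℝ (StdModel c)} (hT : T ≤ (baseHom c).ker)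
    (hT' : midIdeal c ⊥ ⊓ T ≤ (stdModel c).socFiltration k) :
    T ≤ (stdModel c).socFiltration (k + 1) := by
  apply MetricInvolution.le_socFiltration_succ
  have h1 : ComplementedIcc (midIdeal c ⊥ ⊓ T) T :=
    (complementedIcc_inf_iff _ _).2
      ((complementedIcc_midIdeal h).mono le_rfl (sup_le midIdeal_bot_le_ker hT))
  exact h1.mono (le_inf inf_le_right hT') le_rfl

/-- Since `R_k(𝔡)` projects onto `R_k(𝔩)`, the intersection `𝔩^* ∩ S_k(𝔡)` annihilates `R_k(𝔩)`. -/
theorem dual_eq_zero_of_mem_socFiltration {k : ℕ} {X : StdModel c}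
    (hX : X ∈ midIdeal c ⊥) (hX' : X ∈ (stdModel c).socFiltration k) {y : L}
    (hy : y ∈ radFiltration L k) : X.dual y = 0 := by
  rw [mem_midIdeal_bot] at hX
  rw [← map_radFiltration (baseHom_surjective c),
    mem_map_iff_of_surjective (baseHom_surjective c)] at hy
  obtain ⟨Y, hY, rfl⟩ := hy
  have h := (stdModel c).mem_orth.1 hX' Y hY
  rw [form_apply, hX.1, hX.2, map_zero, map_zero, zero_add, zero_add] at h
  exact h

theorem mem_socFiltration_of_dual_eq_zero {k : ℕ} {X : StdModel c} (hX : X ∈ midIdeal c ⊥)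
    (h : ∀ y ∈ radFiltration L k, X.dual y = 0) : X ∈ (stdModel c).socFiltration k := by
  rw [mem_midIdeal_bot] at hX
  refine (stdModel c).mem_orth.2 fun Y hY => ?_
  rw [form_apply, hX.1, hX.2, map_zero, map_zero, zero_add, zero_add]
  apply h
  rw [← map_radFiltration (baseHom_surjective c)]
  exact LieIdeal.mem_map hY

/-! ### Central ideals -/

/-- Invariance gives `⟨[X, Y], N⟩ = -⟨Y, [X, N]⟩ = 0` for `N ∈ 𝔩^* ⊕ 𝔞`. Thus `[X, Y]` lies in `(𝔩^*
⊕ 𝔞)^⊥ = 𝔩^*`, and also in `v`. -/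
theorem lie_eq_zero_of_disjoint {v : LieIdeal ℝ (StdModel c)} (hv : v ⊓ midIdeal c ⊥ = ⊥)
    (h : ∀ X ∈ v, ∀ N ∈ (baseHom c).ker, ⁅X, N⁆ = 0) {X : StdModel c} (hX : X ∈ v)
    (Y : StdModel c) : ⁅X, Y⁆ = 0 := by
  have h1 : ⁅X, Y⁆ ∈ midIdeal c ⊥ := by
    rw [← orth_ker_baseHom]
    refine (stdModel c).mem_orth.2 fun N hN => ?_
    rw [(stdModel c).symm, (stdModel c).lieInvariant, h X hX N hN, map_zero, neg_zero]
  have h2 : ⁅X, Y⁆ ∈ v ⊓ midIdeal c ⊥ := ⟨lie_mem_left ℝ _ v X Y hX, h1⟩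
  rw [hv] at h2
  exact (LieSubmodule.mem_bot _).1 h2

theorem mem_socFiltration_one_of_central {X : StdModel c} (hX : ∀ Y : StdModel c, ⁅Y, X⁆ = 0) :
    X ∈ (stdModel c).socFiltration 1 := by
  have h : LieAlgebra.center ℝ (StdModel c) ≤ (stdModel c).socFiltration (0 + 1) := by
    apply MetricInvolution.le_socFiltration_succ
    refine complementedIcc_of_lie_mem fun Y hY Z => ?_
    rw [(LieModule.mem_maxTrivSubmodule ℝ _ _ _).1 hY Z]
    exact zero_mem _
  exact h ((LieModule.mem_maxTrivSubmodule ℝ _ _ _).2 hX)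

/-! ### The ideal `𝔩^*` is the canonical isotropic ideal -/

/-- Here `R_0 ∩ S_1 = S_1`. A complement `v` of its intersection with `𝔩^* ⊕ 𝔞` commutes with `𝔩^* ⊕
𝔞`, hence is central, and `(A₀)` puts it inside `𝔩^* ⊕ 𝔞`. -/
theorem mixedLayer_zero_le_ker (hc : IsAdmissibleCocycle c) :
    (stdModel c).mixedLayer 0 ≤ (baseHom c).ker := by
  have h0 : (stdModel c).mixedLayer 0 ⊓ (stdModel c).socFiltration 0 = ⊥ := by
    rw [MetricInvolution.socFiltration_zero, inf_bot_eq]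
  obtain ⟨v, -, hv, hv'⟩ := ((stdModel c).complementedIcc_mixedLayer 0).exists_lift
    (n := (baseHom c).ker) (h0 ▸ bot_le)
  rw [h0] at hv
  have hcen (X) (hX : X ∈ v) (Y : StdModel c) : ⁅Y, X⁆ = 0 := by
    rw [← lie_skew, neg_eq_zero]
    refine lie_eq_zero_of_disjoint (eq_bot_iff.2 (hv ▸ inf_le_inf_left v midIdeal_bot_le_ker))
      (fun X hX N hN => ?_) hX Y
    have h1 : ⁅X, N⁆ ∈ v ⊓ (baseHom c).ker :=
      ⟨lie_mem_left ℝ _ v X N hX, lie_mem_right ℝ _ _ X N hN⟩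
    rw [hv] at h1
    exact (LieSubmodule.mem_bot _).1 h1
  have hvk : v ≤ (baseHom c).ker := fun X hX =>
    mem_ker_baseHom.2 (base_eq_zero_of_central hc (hcen X hX))
  rw [sup_eq_right.2 hvk] at hv'
  exact le_sup_left.trans hv'.ge

/-- Modulo `𝔩^*` the ideal `S_1` lifts to a central ideal `v`, so the `𝔞`-component of `X` is an
invariant orthogonal to `Q = α₀(ker [·,·])`. By `(B₀)` every invariant splits along `Q ⊕ Q^⊥`, and
the `Q^⊥`-part `r` extends to a central element, which is orthogonal to `R_1 ∋ X`. So the component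
is orthogonal to all invariants. -/
theorem radFiltration_inf_socFiltration_one_le (hc : IsAdmissibleCocycle c) :
    radFiltration (StdModel c) 1 ⊓ (stdModel c).socFiltration 1 ≤ midIdeal c ⊥ := by
  have hker := mixedLayer_zero_le_ker hc
  have h0 : (stdModel c).mixedLayer 0 ⊓ (stdModel c).socFiltration 0 = ⊥ := by
    rw [MetricInvolution.socFiltration_zero, inf_bot_eq]
  obtain ⟨v, hvW, hv, hv'⟩ := ((stdModel c).complementedIcc_mixedLayer 0).exists_lift
    (n := midIdeal c ⊥) (h0 ▸ bot_le)
  rw [h0] at hv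
  have hcen (X) (hX : X ∈ v) (Y : StdModel c) : ⁅Y, X⁆ = 0 := by
    rw [← lie_skew, neg_eq_zero]
    refine lie_eq_zero_of_disjoint hv (fun X hX N hN => ?_) hX Y
    have hX0 := mem_ker_baseHom.1 (hker (hvW hX))
    have hN0 := mem_ker_baseHom.1 hN
    have h1 : ⁅X, N⁆ ∈ v ⊓ midIdeal c ⊥ :=
      ⟨lie_mem_left ℝ _ v X N hX, mem_midIdeal_bot.2 ⟨by simp [hX0], by simp [hX0, hN0]⟩⟩
    rw [hv] at h1
    exact (LieSubmodule.mem_bot _).1 h1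
  have hW : (stdModel c).mixedLayer 0 = (stdModel c).socFiltration 1 :=
    inf_eq_right.2 le_top
  rintro X ⟨hXR, hXS⟩
  have hXb : X.base = 0 := mem_ker_baseHom.1 (hker (hW ▸ hXS))
  obtain ⟨X', hX', D, hD, rfl⟩ : ∃ X' ∈ v, ∃ D ∈ midIdeal c ⊥, X' + D = X := by
    rw [← LieSubmodule.mem_sup, hv', hW]
    exact LieSubmodule.mem_sup_left hXS
  rw [mem_midIdeal_bot] at hD ⊢
  have hb' : X'.base = 0 := by simpa [hD.1] using hXb
  have hmid : (X' + D).mid = X'.mid := by simp [hD.2]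
  refine ⟨hXb, ?_⟩
  rw [hmid]
  have ha := lie_mid_eq_zero_of_central (hcen X' hX') hb'
  have hperp (b) (hb : b ∈ alphaZeroKer hc.semisimple c.α ⊤) : M.form X'.mid b = 0 :=
    M.form_alphaZeroKer_eq_zero hc.semisimple ha
      (fun x _ y _ => form_mid_of_central (hcen X' hX') hb' x y) hb
  refine M.eq_zero_of_invariant hc.semisimple ha fun b hb => ?_
  set Q := alphaZeroKer hc.semisimple c.α ⊤ with hQ
  have hQc : IsCompl Q (M.form.orthogonal Q) := by
    apply LinearMap.BilinForm.isCompl_orthogonal_of_restrict_nondegenerate M.isRefl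
    have h1 : ∀ a : Q, (∀ b : Q, M.form a b = 0) → a = 0 := fun a h =>
      Subtype.ext (hc.cond_B_zero a a.2 fun b hb => h ⟨b, hb⟩)
    exact ⟨h1, fun a h => h1 a fun b => by rw [M.symm]; exact h b⟩
  obtain ⟨q, hq, r, hr, rfl⟩ := Submodule.mem_sup.1 (hQc.sup_eq_top ▸ Submodule.mem_top (x := b))
  have hqinv (x : L) : ⁅x, q⁆ = 0 := alphaZeroKer_le _ _ _ hq x
  have hrinv (x : L) : ⁅x, r⁆ = 0 := by
    have := hb x
    rwa [lie_add, hqinv, zero_add] at this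
  rw [map_add, hperp q hq, zero_add]
  obtain ⟨Z, hZ⟩ := M.exists_dual_of_form_alphaZeroKer hc.semisimple (α := c.α) hrinv
    fun s hs => by rw [M.symm]; exact hr s hs
  -- The choice of `Z` cancels `⟨r, α(x, ·)⟩` in the bracket with `x ∈ 𝔩`, so `Z + r` is central.
  have hcr (Y : StdModel c) : ⁅Y, (mk Z r 0 : StdModel c)⁆ = 0 := by
    ext w
    · simp only [dual_lie, base_mk, mid_mk, dual_mk, map_zero, LinearMap.zero_apply, dual_zero, hZ,
        zero_lie]
      rw [M.form_lie, hrinv, map_zero]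
      ring
    · simp [hrinv]
    · simp
  have h1 := (stdModel c).mem_orth.1 (mem_socFiltration_one_of_central hcr) _ hXR
  rw [form_apply, hXb, hmid] at h1
  simpa using h1

/-- The image of `W = R_k ∩ S_{k+1}` in `𝔩` lies in `S(𝔩) ∩ R_k(𝔩)`, and a linear section of a lift
`v` supplies the data `Φ₁`, `Φ₂` of `(A_k)`. The section fails to be equivariant only by elements of
`W ∩ S_k ⊆ 𝔩^*`, which annihilate `R_k(𝔩)`; this yields the equations that force the image to
vanish. -/
theorem mixedLayer_le_ker (hc : IsAdmissibleCocycle c) {k : ℕ} (hk : 1 ≤ k)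
    (h : radFiltration (StdModel c) k ⊓ (stdModel c).socFiltration k ≤ midIdeal c ⊥) :
    (stdModel c).mixedLayer k ≤ (baseHom c).ker := by
  set W := (stdModel c).mixedLayer k with hW
  have hp := baseHom_surjective c
  have hWS : W ⊓ (stdModel c).socFiltration k ≤ midIdeal c ⊥ := by
    rwa [hW, MetricInvolution.mixedLayer_inf_socFiltration]
  have hWk := hWS.trans midIdeal_bot_le_ker
  have hC : ComplementedIcc (W ⊓ (stdModel c).socFiltration k) W :=
    (stdModel c).complementedIcc_mixedLayer k
  obtain ⟨v, -, hv, hv'⟩ := hC.exists_lift hWk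
  have hvp : v.map (baseHom c) = W.map (baseHom c) := by
    rw [← LieIdeal.map_sup_ker_eq_map, hv', LieIdeal.map_sup_ker_eq_map]
  have hsoc : W.map (baseHom c) ≤ socle L := by
    apply le_socle
    rw [← complementedIcc_comap_iff hp, comap_map_of_surjective hp]
    have := hC.sup_right inf_le_left (baseHom c).ker
    rwa [sup_eq_right.2 hWk] at this
  have hrad : W.map (baseHom c) ≤ radFiltration L k := by
    rw [← map_radFiltration hp]
    exact LieIdeal.map_mono inf_le_left
  rw [← LieIdeal.map_eq_bot_iff]
  apply hc.cond_A k hk _ (le_inf hsoc hrad)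
  rw [← hvp]
  let q : v →ₗ[ℝ] v.map (baseHom c) :=
    ((baseHom c : StdModel c →ₗ[ℝ] L).restrict fun X hX => LieIdeal.mem_map hX)
  have hq : Function.Surjective q := by
    rintro ⟨x, hx⟩
    obtain ⟨X, hX, rfl⟩ := (mem_map_iff_of_surjective hp).1 hx
    exact ⟨⟨X, hX⟩, rfl⟩
  obtain ⟨s, hs⟩ := LinearMap.exists_rightInverse_of_surjective q (LinearMap.range_eq_top.2 hq)
  have hsb (u : v.map (baseHom c)) : (s u : StdModel c).base = u :=
    congrArg Subtype.val (congrArg (fun f => f u) hs)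
  -- `Φ₁` is minus the `𝔞`-component of the section, `Φ₂` its `𝔩^*`-component restricted to
  -- `R_k(𝔩)`.
  refine ⟨-(midLinear c ∘ₗ v.toSubmodule.subtype ∘ₗ s),
    (LinearMap.lcomp ℝ ℝ (radFiltration L k).toSubmodule.subtype) ∘ₗ dualLinear c
      ∘ₗ v.toSubmodule.subtype ∘ₗ s, fun x u => ?_⟩
  have hD : ⁅(mk 0 0 x : StdModel c), (s u : StdModel c)⁆ - (s ⁅x, u⁆ : StdModel c) ∈
      v ⊓ (baseHom c).ker := by
    refine ⟨sub_mem (v.lie_mem (s u).2) (s _).2, mem_ker_baseHom.2 ?_⟩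
    rw [base_sub, base_lie, hsb, hsb, base_mk, LieSubmodule.coe_bracket, sub_self]
  rw [hv] at hD
  have hD₁ := hWS hD
  have hm := (mem_midIdeal_bot.1 hD₁).2
  constructor
  · change c.α x u = ⁅x, -(s u : StdModel c).mid⁆ - -(s ⁅x, u⁆ : StdModel c).mid
    simp only [mid_sub, mid_lie, base_mk, mid_mk, hsb, lie_zero, sub_zero] at hm
    rw [lie_neg, ← sub_eq_zero, ← hm]
    abel
  · intro y
    have hd := dual_eq_zero_of_mem_socFiltration hD₁ hD.2 y.2
    change c.γ.1 x u y = - M.form (-(s u : StdModel c).mid) (c.α x y)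
      + (s u : StdModel c).dual ⁅x, (y : L)⁆ + (s ⁅x, u⁆ : StdModel c).dual y
    simp only [dual_sub, LinearMap.sub_apply, dual_lie, base_mk, mid_mk, dual_mk, hsb, map_zero,
      LinearMap.zero_apply, lie_zero] at hd
    rw [map_neg, LinearMap.neg_apply]
    linarith

/-- This makes the `𝔞`-components of `R_k ∩ S_{k+1}` a candidate for the submodule `𝔟_k` in `(B_k)`.
The map `Φ` is the transpose of the `𝔩^*`-component of a linear section; the defect of equivariance
again lies in `𝔩^* ∩ S_k`, so it vanishes on `R_k(𝔩)`. -/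
theorem exists_lift_midSubmodule {k : ℕ} (hW : (stdModel c).mixedLayer k ≤ (baseHom c).ker)
    (h : radFiltration (StdModel c) k ⊓ (stdModel c).socFiltration k ≤ midIdeal c ⊥) :
    ∃ Φ : radFiltration L k →ₗ[ℝ] A, ∀ (x : L) (u : radFiltration L k),
      ∀ b ∈ midSubmodule _ hW, M.form (c.α x u) b = M.form (⁅x, Φ u⁆ - Φ ⁅x, u⁆) b := by
  set W := (stdModel c).mixedLayer k with hW'
  have hWS : W ⊓ (stdModel c).socFiltration k ≤ midIdeal c ⊥ := by
    rwa [hW', MetricInvolution.mixedLayer_inf_socFiltration]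
  have hC : ComplementedIcc (W ⊓ (stdModel c).socFiltration k) W :=
    (stdModel c).complementedIcc_mixedLayer k
  obtain ⟨v, hvW, hv, hv'⟩ := hC.exists_lift hWS
  set N := midSubmodule W hW
  let q : v →ₗ[ℝ] N :=
    ((midLinear c).restrict (p := v.toSubmodule) (q := N.toSubmodule)
      fun X hX => mem_midSubmodule.2 ⟨X, hvW hX, rfl⟩)
  have hq : Function.Surjective q := by
    rintro ⟨a, X, hX, rfl⟩
    obtain ⟨X', hX', D, hD, rfl⟩ : ∃ X' ∈ v, ∃ D ∈ midIdeal c ⊥, X' + D = X := by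
      rw [← LieSubmodule.mem_sup, hv']
      exact LieSubmodule.mem_sup_left hX
    refine ⟨⟨X', hX'⟩, Subtype.ext ?_⟩
    change X'.mid = X'.mid + D.mid
    rw [(mem_midIdeal_bot.1 hD).2, add_zero]
  obtain ⟨s, hs⟩ := LinearMap.exists_rightInverse_of_surjective q (LinearMap.range_eq_top.2 hq)
  have hsm (b : N) : (s b : StdModel c).mid = b :=
    congrArg Subtype.val (congrArg (fun f => f b) hs)
  have hsb (b : N) : (s b : StdModel c).base = 0 := mem_ker_baseHom.1 (hW (hvW (s b).2))
  obtain ⟨ψ, hψ⟩ := LinearMap.exists_extend (p := N.toSubmodule)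
    (dualLinear c ∘ₗ v.toSubmodule.subtype ∘ₗ s)
  have hψ' (b : N) (x : L) : ψ b x = (s b : StdModel c).dual x :=
    congrArg (fun f => f b x) hψ
  let e : A ≃ₗ[ℝ] Module.Dual ℝ A := LinearMap.BilinForm.toDual M.form M.nondegenerate
  have he (f : Module.Dual ℝ A) (b : A) : M.form (e.symm f) b = f b :=
    congrArg (fun g : Module.Dual ℝ A => g b) (e.apply_symm_apply f)
  -- `Φ` is determined by `⟨Φ u, b⟩ = ψ(b)(u)`, with `e` the identification of `𝔞` with its dual.
  refine ⟨e.symm.toLinearMap ∘ₗ ψ.flip ∘ₗ (radFiltration L k).toSubmodule.subtype,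
    fun x u b hb => ?_⟩
  have hD : ⁅(mk 0 0 x : StdModel c), (s ⟨b, hb⟩ : StdModel c)⁆
      - (s ⁅x, (⟨b, hb⟩ : N)⁆ : StdModel c) ∈ v ⊓ midIdeal c ⊥ := by
    refine ⟨sub_mem (v.lie_mem (s _).2) (s _).2, mem_midIdeal_bot.2 ⟨?_, ?_⟩⟩
    · rw [base_sub, base_lie, hsb, hsb, lie_zero, sub_zero]
    · rw [mid_sub, mid_lie, hsb, hsm, hsm]
      simp
  rw [hv] at hD
  have hd := dual_eq_zero_of_mem_socFiltration (hWS hD) hD.2 u.2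
  simp only [dual_sub, LinearMap.sub_apply, dual_lie, base_mk, mid_mk, dual_mk, hsb, hsm, map_zero,
    LinearMap.zero_apply, lie_zero, ← hψ'] at hd
  rw [map_sub, LinearMap.sub_apply, M.form_lie]
  change _ = - M.form (e.symm (ψ.flip u)) ⁅x, b⁆ - M.form (e.symm (ψ.flip ⁅x, (u : L)⁆)) b
  rw [he, he, M.symm, LinearMap.flip_apply, LinearMap.flip_apply]
  have : ((⁅x, (⟨b, hb⟩ : N)⁆ : N) : A) = ⁅x, b⁆ := rfl
  rw [this] at hd
  linarith

/-- The ideal of all `Z + B` with `B ∈ N` and `Z = ⟨Φ(·), B⟩` on `R_k(𝔩)`. -/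
def liftIdeal {R : LieIdeal ℝ L} (hR : R ≤ LieModule.ker ℝ L A) (N : LieSubmodule ℝ L A)
    (Φ : R →ₗ[ℝ] A)
    (hΦ : ∀ (x : L) (u : R), ∀ b ∈ N, M.form (c.α x u) b = M.form (⁅x, Φ u⁆ - Φ ⁅x, u⁆) b) :
    LieIdeal ℝ (StdModel c) where
  carrier := {X | X.base = 0 ∧ X.mid ∈ N ∧ ∀ u : R, X.dual u = M.form (Φ u) X.mid}
  add_mem' {X Y} hX hY := ⟨by simp [hX.1, hY.1], by simpa using add_mem hX.2.1 hY.2.1,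
    fun u => by simp [hX.2.2, hY.2.2]⟩
  zero_mem' := ⟨rfl, by simp, by simp⟩
  smul_mem' t X hX := ⟨by simp [hX.1], by simpa using N.smul_mem t hX.2.1,
    fun u => by simp [hX.2.2]⟩
  lie_mem {X Y} hY := by
    refine ⟨by rw [base_lie, hY.1, lie_zero], by rw [mid_lie, hY.1]; simpa using N.lie_mem hY.2.1,
      fun u => ?_⟩
    have h1 := hΦ X.base u Y.mid hY.2.1
    have h2 : Y.dual ⁅X.base, (u : L)⁆ = M.form (Φ ⁅X.base, u⁆) Y.mid := hY.2.2 ⁅X.base, u⁆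
    rw [map_sub, LinearMap.sub_apply, M.form_lie] at h1
    -- As `u ∈ R` acts trivially on `𝔞`, the term `⟨ρ(u) X.mid, Y.mid⟩` drops out.
    rw [dual_lie, mid_lie, hY.1, (LieModule.mem_ker ℝ L A _).1 (hR u.2), h2, M.symm Y.mid, h1]
    simp

/-- Let `N = 𝔟_k` contain the `𝔞`-components of `R_k ∩ S_{k+1}`. The ideal `T` projects onto `N`,
and `T ∩ 𝔩^*` annihilates `R_k(𝔩)`, so `T ⊆ S_{k+1}`. An element of `R_{k+1} ∩ S_{k+1}` is
orthogonal to `T`, so its `𝔞`-component lies in `N` and is orthogonal to `N`; `(B_k)` makes it zero.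
-/
theorem radFiltration_inf_socFiltration_succ_le (hc : IsAdmissibleCocycle c) {k : ℕ} (hk : 1 ≤ k)
    (h : radFiltration (StdModel c) k ⊓ (stdModel c).socFiltration k ≤ midIdeal c ⊥) :
    radFiltration (StdModel c) (k + 1) ⊓ (stdModel c).socFiltration (k + 1) ≤ midIdeal c ⊥ := by
  have hW := mixedLayer_le_ker hc hk h
  obtain ⟨N, hN, hNmax⟩ := exists_maximal_ge_of_wellFoundedGT
    (fun N : LieSubmodule ℝ L A => ∃ Φ : radFiltration L k →ₗ[ℝ] A,
      ∀ (x : L) (u : radFiltration L k), ∀ b ∈ N,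
        M.form (c.α x u) b = M.form (⁅x, Φ u⁆ - Φ ⁅x, u⁆) b) (midSubmodule _ hW)
    (exists_lift_midSubmodule hW h)
  have hnd := hc.cond_B k hk N hNmax
  obtain ⟨Φ, hΦ⟩ := hNmax.1
  let T := liftIdeal (c := c) (radFiltration_le_ker hc.semisimple hk) N Φ hΦ
  have hT : T ≤ (stdModel c).socFiltration (k + 1) := by
    apply le_socFiltration_succ_of_le_ker hc.semisimple
    · exact fun X hX => mem_ker_baseHom.2 hX.1
    · intro X hX
      refine mem_socFiltration_of_dual_eq_zero hX.1 fun y hy => ?_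
      rw [hX.2.2.2 ⟨y, hy⟩, (mem_midIdeal_bot.1 hX.1).2, map_zero]
  rintro X ⟨hXR, hXS⟩
  have hXW : X ∈ (stdModel c).mixedLayer k := ⟨radFiltration_succ_le k hXR, hXS⟩
  have hX0 : X.base = 0 := mem_ker_baseHom.1 (hW hXW)
  refine mem_midIdeal_bot.2 ⟨hX0, hnd _ (hN (mem_midSubmodule.2 ⟨X, hXW, rfl⟩)) fun b hb => ?_⟩
  obtain ⟨Z, hZ⟩ := LinearMap.exists_extend (p := (radFiltration L k).toSubmodule)
    (M.form b ∘ₗ Φ)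
  have hbT : (mk Z b 0 : StdModel c) ∈ T := by
    refine ⟨rfl, hb, fun u => ?_⟩
    rw [M.symm]
    exact congrArg (fun f => f u) hZ
  have h1 := (stdModel c).mem_orth.1 (hT hbT) X hXR
  rw [form_apply, hX0] at h1
  simpa using h1

theorem radFiltration_inf_socFiltration_le (hc : IsAdmissibleCocycle c) (k : ℕ) :
    radFiltration (StdModel c) k ⊓ (stdModel c).socFiltration k ≤ midIdeal c ⊥ := by
  match k with
  | 0 => rw [MetricInvolution.socFiltration_zero, inf_bot_eq]; exact bot_le
  | k + 1 =>
    induction k with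
    | zero => exact radFiltration_inf_socFiltration_one_le hc
    | succ k ih => exact radFiltration_inf_socFiltration_succ_le hc (Nat.le_add_left 1 k) ih

/-- For an admissible cocycle, `𝔩^*` is the canonical isotropic ideal of the standard model. -/
theorem midIdeal_bot_eq_iSup (hc : IsAdmissibleCocycle c) :
    midIdeal c ⊥ = ⨆ k, radFiltration (StdModel c) k ⊓ (stdModel c).socFiltration k := by
  refine (stdModel c).eq_iSup_radFiltration_inf_socFiltration
    (radFiltration_inf_socFiltration_le hc) fun k => ?_
  rw [orth_midIdeal_bot]
  rcases Nat.eq_zero_or_pos k with rfl | hk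
  · exact mixedLayer_zero_le_ker hc
  · exact mixedLayer_le_ker hc hk (radFiltration_inf_socFiltration_le hc k)

end StdModel

/-! ### Isomorphisms of standard models -/

namespace MetricInvolution.Iso

variable {G₁ G₂ G₃ : Type*} [LieRing G₁] [LieAlgebra ℝ G₁] [FiniteDimensional ℝ G₁]
  [LieRing G₂] [LieAlgebra ℝ G₂] [FiniteDimensional ℝ G₂]
  [LieRing G₃] [LieAlgebra ℝ G₃] [FiniteDimensional ℝ G₃]
  {m₁ : MetricInvolution G₁} {m₂ : MetricInvolution G₂} {m₃ : MetricInvolution G₃}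

/-- The inverse isomorphism. -/
protected def symm (F : m₁.Iso m₂) : m₂.Iso m₁ where
  toEquiv := F.toEquiv.symm
  isometry x y := by
    rw [← F.isometry, LieEquiv.apply_symm_apply, LieEquiv.apply_symm_apply]
  comm x := by
    apply F.toEquiv.injective
    change F.toEquiv _ = F.toEquiv _
    rw [F.comm, LieEquiv.apply_symm_apply, LieEquiv.apply_symm_apply]

/-- The composition of isomorphisms. -/
protected def trans (F : m₁.Iso m₂) (F' : m₂.Iso m₃) : m₁.Iso m₃ where
  toEquiv := F.toEquiv.trans F'.toEquiv
  isometry x y := by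
    rw [LieEquiv.trans_apply, LieEquiv.trans_apply, F'.isometry, F.isometry]
  comm x := by
    rw [LieEquiv.trans_apply, LieEquiv.trans_apply, F.comm, F'.comm]

end MetricInvolution.Iso

namespace StdModel

section Cohomologous

variable {L : Type*} [LieRing L] [LieAlgebra ℝ L] {θ : LieInvolution L}
variable {A : Type*} [AddCommGroup A] [Module ℝ A] [FiniteDimensional ℝ A]
  [LieRingModule L A] [LieModule ℝ L A] {M : OrthogonalModule θ A} {c c' : QuadraticCocycle M}

/-- The linear map underlying the isomorphism of standard models given by a quadratic
1-cochain. -/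
def shear (c c' : QuadraticCocycle M) (τ : L →ₗ[ℝ] A) (σ : twoCochain ℝ L ℝ) :
    StdModel c →ₗ[ℝ] StdModel c' where
  -- The term `-½⟨τ x, τ(·)⟩` compensates `⟨τ x, τ y⟩` in the form on `𝔞`, which makes the map
  -- isometric; the alternating `σ` does not affect the form.
  toFun X := mk (X.dual - M.form X.mid ∘ₗ τ + σ.1 X.base
    - (1 / 2 : ℝ) • M.form (τ X.base) ∘ₗ τ) (X.mid + τ X.base) X.base
  map_add' X Y := by
    ext
    · simp; ring
    · simp; abel
    · simp
  map_smul' t X := by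
    ext
    · simp; ring
    · simp
    · simp

theorem dual_shear (τ : L →ₗ[ℝ] A) (σ : twoCochain ℝ L ℝ) (X : StdModel c) (y : L) :
    (shear c c' τ σ X).dual y = X.dual y - M.form X.mid (τ y) + σ X.base y
      - 1 / 2 * M.form (τ X.base) (τ y) := rfl

@[simp] theorem mid_shear (τ : L →ₗ[ℝ] A) (σ : twoCochain ℝ L ℝ) (X : StdModel c) :
    (shear c c' τ σ X).mid = X.mid + τ X.base := rfl

@[simp] theorem base_shear (τ : L →ₗ[ℝ] A) (σ : twoCochain ℝ L ℝ) (X : StdModel c) :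
    (shear c c' τ σ X).base = X.base := rfl

theorem shear_neg_shear (τ : L →ₗ[ℝ] A) (σ : twoCochain ℝ L ℝ) (X : StdModel c) :
    shear c' c (-τ) ((-1 : ℝ) • σ) (shear c c' τ σ X) = X := by
  ext y
  · simp only [dual_shear, mid_shear, base_shear, LinearMap.neg_apply, map_neg, map_add,
      LinearMap.add_apply, smul_apply_apply, smul_eq_mul]
    ring
  · simp
  · simp

theorem shear_lie {τ : L →ₗ[ℝ] A} {σ : twoCochain ℝ L ℝ}
    (hα : c'.α = c.α + d₁₂ ℝ L A τ)
    (hγ : ∀ x y z, c'.γ.1 x y z = c.γ.1 x y z + dTwo σ x y z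
      + wedgeTwoOne M.form (c.α + (1 / 2 : ℝ) • d₁₂ ℝ L A τ) τ x y z) (X Y : StdModel c') :
    shear c' c τ σ ⁅X, Y⁆ = ⁅shear c' c τ σ X, shear c' c τ σ Y⁆ := by
  ext w
  · simp only [dual_shear, dual_lie, mid_lie, base_lie, mid_shear, base_shear, hγ, hα]
    generalize X.base = x, Y.base = y, X.mid = a, Y.mid = b
    simp only [dTwo, wedgeTwoOne, LinearMap.add_apply, map_add, add_apply_apply, lie_add,
      smul_apply_apply, d₁₂_apply_apply, map_sub, map_smul, LinearMap.smul_apply,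
      LinearMap.sub_apply, smul_eq_mul]
    have hs (x y : L) : σ x y = - σ y x := by rw [← twoCochain_skew]
    have i (u : L) (p q : A) : M.form ⁅u, p⁆ q = - M.form ⁅u, q⁆ p := by
      rw [M.symm ⁅u, q⁆ p, M.form_lie]
    have j (u : L) (p q : A) : M.form p ⁅u, q⁆ = M.form ⁅u, q⁆ p := M.symm _ _
    simp only [j]
    rw [hs y ⁅x, w⁆, hs x ⁅y, w⁆, i x (τ w) b, i y (τ w) a, i w (τ y) a,
      i x (τ w) (τ y), i y (τ w) (τ x), i w (τ y) (τ x)]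
    linarith [M.symm (c.α x y) (τ w), M.symm (c.α x w) (τ y), M.symm (c.α y w) (τ x),
      M.symm (τ ⁅x, w⁆) (τ y), M.symm (τ ⁅y, w⁆) (τ x), M.symm (τ ⁅x, y⁆) (τ w)]
  · simp only [mid_shear, mid_lie, base_lie, base_shear, hα, add_apply_apply, d₁₂_apply_apply,
      lie_add]
    abel
  · simp

variable [FiniteDimensional ℝ L]

theorem invol_apply (X : StdModel c) :
    (stdModel c).invol X = mk (X.dual ∘ₗ (θ.toHom : L →ₗ[ℝ] L)) (M.invol X.mid) (θ X.base) := rfl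

/-- Cohomologous cocycles have isomorphic standard models. -/
theorem nonempty_iso_of_cohomologous (h : Cohomologous M c c') :
    Nonempty ((stdModel c').Iso (stdModel c)) := by
  obtain ⟨τ, σ, hτ, hσ, hα, hγ⟩ := h
  have hτ' (x : L) : τ (θ x) = M.invol (τ x) := by rw [← hτ x, M.involutive]
  refine ⟨⟨{ shear c' c τ σ with
    map_lie' := fun {X Y} => shear_lie hα hγ X Y
    invFun := shear c c' (-τ) ((-1 : ℝ) • σ)
    left_inv := shear_neg_shear τ σ
    right_inv := fun X => ?_ }, fun X Y => ?_, fun X => ?_⟩⟩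
  · have := shear_neg_shear (c := c) (c' := c') (-τ) ((-1 : ℝ) • σ) X
    rwa [neg_neg, smul_smul, neg_one_mul, neg_neg, one_smul] at this
  · change (stdModel c).form (shear c' c τ σ X) (shear c' c τ σ Y) = _
    simp only [form_apply, dual_shear, mid_shear, base_shear, map_add, LinearMap.add_apply]
    rw [M.symm (τ X.base) Y.mid, M.symm (τ Y.base) (τ X.base),
      ← twoCochain_skew σ Y.base X.base]
    ring
  · change shear c' c τ σ _ = (stdModel c).invol (shear c' c τ σ X)
    rw [invol_apply, invol_apply]
    ext y
    · have h1 : M.form (M.invol X.mid) (τ y) = M.form X.mid (τ (θ y)) := by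
        rw [hτ', ← M.isometry, M.involutive]
      have h2 : M.form (M.invol (τ X.base)) (τ y) = M.form (τ X.base) (τ (θ y)) := by
        rw [hτ', ← M.isometry, M.involutive]
      have h3 : σ (θ X.base) y = σ X.base (θ y) := by
        rw [← hσ X.base, θ.involutive]
      simp only [dual_shear, dual_mk, mid_mk, base_mk, LinearMap.comp_apply,
        LieHom.coe_toLinearMap, h1, hτ', h2, h3]
    · simp [hτ']
    · simp

end Cohomologous

/-! ### Isomorphisms of standard models induced by isomorphisms of triples. -/

section Triples

variable {L₁ : Type*} [LieRing L₁] [LieAlgebra ℝ L₁]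
  {θ₁ : LieInvolution L₁}
variable {A₁ : Type*} [AddCommGroup A₁] [Module ℝ A₁] [FiniteDimensional ℝ A₁]
  [LieRingModule L₁ A₁] [LieModule ℝ L₁ A₁]
variable {L₂ : Type*} [LieRing L₂] [LieAlgebra ℝ L₂]
  {θ₂ : LieInvolution L₂}
variable {A₂ : Type*} [AddCommGroup A₂] [Module ℝ A₂] [FiniteDimensional ℝ A₂]
  [LieRingModule L₂ A₂] [LieModule ℝ L₂ A₂]
variable {M₁ : OrthogonalModule θ₁ A₁} {M₂ : OrthogonalModule θ₂ A₂}

/-- The linear map underlying the isomorphism of standard models given by an isomorphism of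
triples. -/
def pullLinear (T : TripleIso M₁ M₂) (c : QuadraticCocycle M₂) :
    StdModel (T.pullCocycle c) →ₗ[ℝ] StdModel c where
  toFun X := mk (X.dual ∘ₗ (T.S.symm : L₂ →ₗ[ℝ] L₁)) (T.U.symm X.mid) (T.S X.base)
  map_add' X Y := by ext <;> simp
  map_smul' t X := by ext <;> simp

theorem dual_pullLinear (T : TripleIso M₁ M₂) {c : QuadraticCocycle M₂}
    (X : StdModel (T.pullCocycle c)) (y : L₁) : (pullLinear T c X).dual (T.S y) = X.dual y :=
  congrArg X.dual (T.S.symm_apply_apply y)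

theorem mid_pullLinear (T : TripleIso M₁ M₂) {c : QuadraticCocycle M₂}
    (X : StdModel (T.pullCocycle c)) : T.U (pullLinear T c X).mid = X.mid :=
  T.U.apply_symm_apply X.mid

theorem base_pullLinear (T : TripleIso M₁ M₂) {c : QuadraticCocycle M₂}
    (X : StdModel (T.pullCocycle c)) : (pullLinear T c X).base = T.S X.base := rfl

theorem pullLinear_lie (T : TripleIso M₁ M₂) {c : QuadraticCocycle M₂}
    (X Y : StdModel (T.pullCocycle c)) :
    pullLinear T c ⁅X, Y⁆ = ⁅pullLinear T c X, pullLinear T c Y⁆ := by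
  ext w
  · obtain ⟨w, rfl⟩ : ∃ v, T.S v = w := T.S.surjective w
    simp only [dual_pullLinear, dual_lie, base_pullLinear, ← LieEquiv.map_lie, ← T.U_isometry,
      mid_pullLinear, T.equivariant]
    rfl
  · apply T.U.injective
    simp only [mid_pullLinear, mid_lie, map_add, map_sub, base_pullLinear, T.equivariant]
    rfl
  · rw [base_pullLinear, base_lie, base_lie, LieEquiv.map_lie]
    rfl

theorem lie_mk_mk {c : QuadraticCocycle M₂} (x y : L₂) : ⁅(mk 0 0 x : StdModel c), (mk 0 0 y : StdModel c)⁆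
    = mk (c.γ.1 x y) 0 0 + mk 0 (c.α x y) 0 + mk 0 0 ⁅x, y⁆ := by
  ext <;> simp [dual_lie]

variable [FiniteDimensional ℝ L₁] [FiniteDimensional ℝ L₂]

/-- The isomorphism of standard models given by an isomorphism of triples. -/
def pullIso (T : TripleIso M₁ M₂) (c : QuadraticCocycle M₂) :
    (stdModel (T.pullCocycle c)).Iso (stdModel c) where
  toEquiv :=
    { pullLinear T c with
      map_lie' := fun {X Y} => pullLinear_lie T X Y
      invFun := fun X => mk (X.dual ∘ₗ (T.S : L₁ →ₗ[ℝ] L₂)) (T.U X.mid) (T.S.symm X.base)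
      left_inv := fun X => by
        ext y
        · exact dual_pullLinear T X y
        · exact mid_pullLinear T X
        · exact T.S.symm_apply_apply X.base
      right_inv := fun X => by
        ext y
        · obtain ⟨y, rfl⟩ : ∃ v, T.S v = y := T.S.surjective y
          exact dual_pullLinear T _ y
        · exact T.U.symm_apply_apply X.mid
        · exact T.S.apply_symm_apply X.base }
  isometry X Y := by
    change (stdModel c).form (pullLinear T c X) (pullLinear T c Y) = _
    rw [form_apply, form_apply, base_pullLinear, base_pullLinear, dual_pullLinear, dual_pullLinear,
      ← T.U_isometry, mid_pullLinear, mid_pullLinear]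
  comm X := by
    change pullLinear T c _ = (stdModel c).invol (pullLinear T c X)
    rw [invol_apply, invol_apply]
    ext y
    · obtain ⟨y, rfl⟩ : ∃ v, T.S v = y := T.S.surjective y
      rw [dual_pullLinear, dual_mk, dual_mk, LinearMap.comp_apply, LinearMap.comp_apply,
        LieHom.coe_toLinearMap, LieHom.coe_toLinearMap, ← T.S_comm, dual_pullLinear]
    · apply T.U.injective
      rw [mid_pullLinear, mid_mk, mid_mk, T.U_comm, mid_pullLinear]
    · exact T.S_comm X.base

/-! ### Isomorphisms preserving `𝔩^*` -/

variable {c₁ : QuadraticCocycle M₁} {c₂ : QuadraticCocycle M₂}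

/-- The isomorphism maps `𝔩₁^*` into `𝔩₂^*`. -/
def PreservesDual (F : (stdModel c₁).Iso (stdModel c₂)) : Prop :=
  ∀ X ∈ midIdeal c₁ ⊥, F.toEquiv X ∈ midIdeal c₂ ⊥

/-- On both sides `𝔩^*` is the canonical ideal, which isometric isomorphisms preserve. -/
theorem preservesDual (h₁ : IsAdmissibleCocycle c₁) (h₂ : IsAdmissibleCocycle c₂)
    (F : (stdModel c₁).Iso (stdModel c₂)) : PreservesDual F := by
  intro X hX
  rw [midIdeal_bot_eq_iSup h₁] at hX
  rw [midIdeal_bot_eq_iSup h₂]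
  exact F.map_iSup hX

section

variable (F : (stdModel c₁).Iso (stdModel c₂))

/-- The map `𝔩₁ → 𝔩₂` induced by an isomorphism of standard models. -/
def baseMap : L₁ →ₗ[ℝ] L₂ where
  toFun x := (F.toEquiv (mk 0 0 x)).base
  map_add' x y := by
    have : (mk 0 0 (x + y) : StdModel c₁) = mk 0 0 x + mk 0 0 y := by ext <;> simp
    rw [this, map_add, base_add]
  map_smul' t x := by
    have : (mk 0 0 (t • x) : StdModel c₁) = t • mk 0 0 x := by ext <;> simp
    rw [this, map_smul, base_smul, RingHom.id_apply]

/-- The map `𝔞₁ → 𝔞₂` induced by an isomorphism of standard models. -/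
def midMap : A₁ →ₗ[ℝ] A₂ where
  toFun a := (F.toEquiv (mk 0 a 0)).mid
  map_add' x y := by
    have : (mk 0 (x + y) 0 : StdModel c₁) = mk 0 x 0 + mk 0 y 0 := by ext <;> simp
    rw [this, map_add, mid_add]
  map_smul' t x := by
    have : (mk 0 (t • x) 0 : StdModel c₁) = t • mk 0 x 0 := by ext <;> simp
    rw [this, map_smul, mid_smul, RingHom.id_apply]

/-- The map `𝔩₁ → 𝔞₂` induced by an isomorphism of standard models. -/
def baseMidMap : L₁ →ₗ[ℝ] A₂ where
  toFun x := (F.toEquiv (mk 0 0 x)).mid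
  map_add' x y := by
    have : (mk 0 0 (x + y) : StdModel c₁) = mk 0 0 x + mk 0 0 y := by ext <;> simp
    rw [this, map_add, mid_add]
  map_smul' t x := by
    have : (mk 0 0 (t • x) : StdModel c₁) = t • mk 0 0 x := by ext <;> simp
    rw [this, map_smul, mid_smul, RingHom.id_apply]

/-- The bilinear form on `𝔩₁` induced by an isomorphism of standard models. -/
def baseDualMap : L₁ →ₗ[ℝ] L₁ →ₗ[ℝ] ℝ where
  toFun x := (F.toEquiv (mk 0 0 x)).dual ∘ₗ baseMap F
  map_add' x y := by
    have : (mk 0 0 (x + y) : StdModel c₁) = mk 0 0 x + mk 0 0 y := by ext <;> simp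
    rw [this, map_add, dual_add, LinearMap.add_comp]
  map_smul' t x := by
    have : (mk 0 0 (t • x) : StdModel c₁) = t • mk 0 0 x := by ext <;> simp
    rw [this, map_smul, dual_smul, RingHom.id_apply, LinearMap.smul_comp]

variable {F}

/-- The kernel is `(𝔩^*)^⊥`, so the claim is adjoint to the inverse preserving `𝔩^*`. -/
theorem map_mem_ker_baseHom (hF' : PreservesDual F.symm) {X : StdModel c₁}
    (hX : X ∈ (baseHom c₁).ker) : F.toEquiv X ∈ (baseHom c₂).ker := by
  rw [← orth_midIdeal_bot, MetricInvolution.mem_orth] at hX ⊢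
  intro Y hY
  have h := hX _ (hF' Y hY)
  rw [← F.isometry] at h
  rwa [show F.toEquiv (F.symm.toEquiv Y) = Y from F.toEquiv.apply_symm_apply Y] at h

theorem base_map (hF' : PreservesDual F.symm) (X : StdModel c₁) :
    (F.toEquiv X).base = baseMap F X.base := by
  have h := map_mem_ker_baseHom hF' (X := X - mk 0 0 X.base)
    (mem_ker_baseHom.2 (by rw [base_sub, base_mk, sub_self]))
  rw [mem_ker_baseHom, map_sub, base_sub, sub_eq_zero] at h
  exact h

theorem mid_map (hF : PreservesDual F) {X : StdModel c₁} (hX : X.base = 0) :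
    (F.toEquiv X).mid = midMap F X.mid := by
  have h := hF (X - mk 0 X.mid 0) (mem_midIdeal_bot.2 ⟨by simp [hX], by simp⟩)
  rw [mem_midIdeal_bot, map_sub, mid_sub, sub_eq_zero] at h
  exact h.2

theorem baseMap_symm_baseMap (hF : PreservesDual F) (x : L₁) :
    baseMap F.symm (baseMap F x) = x := by
  have h := base_map (F := F.symm) (X := F.toEquiv (mk 0 0 x)) hF
  rw [show F.symm.toEquiv (F.toEquiv (mk 0 0 x)) = mk 0 0 x from
    F.toEquiv.symm_apply_apply _] at h
  exact h.symm

theorem midMap_symm_midMap (hF' : PreservesDual F.symm) (a : A₁) :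
    midMap F.symm (midMap F a) = a := by
  have h := mid_map (F := F.symm) (X := F.toEquiv (mk 0 a 0)) hF' (by
    rw [base_map hF', base_mk, map_zero])
  rw [show F.symm.toEquiv (F.toEquiv (mk 0 a 0)) = mk 0 a 0 from
    F.toEquiv.symm_apply_apply _] at h
  exact h.symm

/-- Isometry pairs `𝔩^*` with `𝔩`, so the block on `𝔩^*` is the inverse transpose of `baseMap F`. -/
theorem dual_map_dual (hF : PreservesDual F) (hF' : PreservesDual F.symm) (Z : Module.Dual ℝ L₁)
    (y : L₁) : (F.toEquiv (mk Z 0 0)).dual (baseMap F y) = Z y := by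
  have h := F.isometry (mk Z 0 0) (mk 0 0 y)
  have h0 := mem_midIdeal_bot.1 (hF (mk Z 0 0) (mem_midIdeal_bot.2 ⟨rfl, rfl⟩))
  rw [form_apply, form_apply, h0.1, h0.2, base_map hF' (mk 0 0 y)] at h
  simpa using h

theorem dual_map_mid (hF' : PreservesDual F.symm) (a : A₁) (y : L₁) :
    (F.toEquiv (mk 0 a 0)).dual (baseMap F y) = - M₂.form (midMap F a) (baseMidMap F y) := by
  have h := F.isometry (mk 0 a 0) (mk 0 0 y)
  rw [form_apply, form_apply, base_map hF' (mk 0 a 0), base_map hF' (mk 0 0 y)] at h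
  simp only [base_mk, mid_mk, dual_mk, map_zero, add_zero, LinearMap.zero_apply] at h
  exact eq_neg_of_add_eq_zero_right h

/-- Isometry on `𝔩` fixes the symmetric part of the `𝔩^*`-block; only its alternating part is free,
and it becomes `σ`. -/
theorem baseDualMap_symm (hF' : PreservesDual F.symm) (x y : L₁) :
    baseDualMap F x y + baseDualMap F y x = - M₂.form (baseMidMap F x) (baseMidMap F y) := by
  have h := F.isometry (mk 0 0 x) (mk 0 0 y)
  rw [form_apply, form_apply, base_map hF' (mk 0 0 x), base_map hF' (mk 0 0 y)] at h
  simp only [base_mk, mid_mk, dual_mk, map_zero, add_zero, LinearMap.zero_apply] at h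
  change (F.toEquiv (mk 0 0 x)).dual (baseMap F y) + (F.toEquiv (mk 0 0 y)).dual (baseMap F x)
    = - M₂.form (F.toEquiv (mk 0 0 x)).mid (F.toEquiv (mk 0 0 y)).mid
  linarith

theorem baseMap_lie (hF' : PreservesDual F.symm) (x y : L₁) :
    baseMap F ⁅x, y⁆ = ⁅baseMap F x, baseMap F y⁆ := by
  have h := congrArg base (F.toEquiv.map_lie (mk 0 0 x) (mk 0 0 y))
  rwa [base_map hF'] at h

theorem midMap_lie (hF : PreservesDual F) (hF' : PreservesDual F.symm) (x : L₁) (a : A₁) :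
    midMap F ⁅x, a⁆ = ⁅baseMap F x, midMap F a⁆ := by
  have h := congrArg mid (F.toEquiv.map_lie (mk 0 0 x) (mk 0 a 0))
  rw [mid_map hF (by simp), mid_lie, mid_lie, base_map hF' (mk 0 0 x), base_map hF' (mk 0 a 0)] at h
  simp only [base_mk, mid_mk, map_zero, zero_add, sub_zero, lie_zero, zero_lie] at h
  exact h

theorem midMap_alpha (hF : PreservesDual F) (x y : L₁) :
    midMap F (c₁.α x y) = c₂.α (baseMap F x) (baseMap F y)
      + (⁅baseMap F x, baseMidMap F y⁆ - ⁅baseMap F y, baseMidMap F x⁆ - baseMidMap F ⁅x, y⁆) := by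
  have h := congrArg mid (F.toEquiv.map_lie (mk 0 0 x) (mk 0 0 y))
  have h0 := (mem_midIdeal_bot.1 (hF (mk (c₁.γ.1 x y) 0 0) (mem_midIdeal_bot.2 ⟨rfl, rfl⟩))).2
  rw [lie_mk_mk, map_add, map_add, mid_add, mid_add, h0, zero_add] at h
  change midMap F (c₁.α x y) + baseMidMap F ⁅x, y⁆ = c₂.α (baseMap F x) (baseMap F y)
    + ⁅baseMap F x, baseMidMap F y⁆ - ⁅baseMap F y, baseMidMap F x⁆ at h
  rw [eq_sub_of_add_eq h]
  abel

/-- This is the `𝔩^*`-component of `F [x, y] = [F x, F y]`, evaluated at the image of `z`. -/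
theorem gamma_eq (hF : PreservesDual F) (hF' : PreservesDual F.symm) (x y z : L₁) :
    c₁.γ.1 x y z - M₂.form (midMap F (c₁.α x y)) (baseMidMap F z) + baseDualMap F ⁅x, y⁆ z
      = c₂.γ.1 (baseMap F x) (baseMap F y) (baseMap F z)
        - M₂.form (baseMidMap F y) (c₂.α (baseMap F x) (baseMap F z))
        + M₂.form (baseMidMap F x) (c₂.α (baseMap F y) (baseMap F z))
        - baseDualMap F y ⁅x, z⁆ + baseDualMap F x ⁅y, z⁆
        + M₂.form ⁅baseMap F z, baseMidMap F x⁆ (baseMidMap F y) := by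
  have h := congrArg (fun X => X.dual (baseMap F z)) (F.toEquiv.map_lie (mk 0 0 x) (mk 0 0 y))
  simp only [lie_mk_mk, map_add, dual_add, LinearMap.add_apply] at h
  rw [dual_map_dual hF hF', dual_map_mid hF', dual_lie, base_map hF' (mk 0 0 x),
    base_map hF' (mk 0 0 y), base_mk, base_mk, ← baseMap_lie hF', ← baseMap_lie hF'] at h
  exact h

theorem baseMap_invol (x : L₁) : baseMap F (θ₁ x) = θ₂ (baseMap F x) := by
  have h := congrArg base (F.comm (mk 0 0 x))
  rw [invol_apply, invol_apply, dual_mk, mid_mk, base_mk, map_zero, LinearMap.zero_comp] at h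
  exact h

theorem baseMidMap_invol (x : L₁) : baseMidMap F (θ₁ x) = M₂.invol (baseMidMap F x) := by
  have h := congrArg mid (F.comm (mk 0 0 x))
  rw [invol_apply, invol_apply, dual_mk, mid_mk, base_mk, map_zero, LinearMap.zero_comp] at h
  exact h

theorem baseDualMap_invol (x y : L₁) : baseDualMap F (θ₁ x) (θ₁ y) = baseDualMap F x y := by
  have h := congrArg (fun X => X.dual (baseMap F (θ₁ y))) (F.comm (mk 0 0 x))
  simp only [invol_apply, dual_mk, mid_mk, base_mk, map_zero, LinearMap.zero_comp,
    LinearMap.comp_apply, LieHom.coe_toLinearMap] at h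
  rw [baseMap_invol y, θ₂.involutive] at h
  change (F.toEquiv (mk 0 0 (θ₁ x))).dual (baseMap F (θ₁ y)) = _
  rw [baseMap_invol y]
  exact h

theorem midMap_invol (a : A₁) : midMap F (M₁.invol a) = M₂.invol (midMap F a) := by
  have h := congrArg mid (F.comm (mk 0 a 0))
  rw [invol_apply, invol_apply, dual_mk, mid_mk, base_mk, map_zero, LinearMap.zero_comp] at h
  exact h

theorem midMap_isometry (hF' : PreservesDual F.symm) (a b : A₁) :
    M₂.form (midMap F a) (midMap F b) = M₁.form a b := by
  have h := F.isometry (mk 0 a 0) (mk 0 b 0)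
  rw [form_apply, form_apply, base_map hF' (mk 0 a 0), base_map hF' (mk 0 b 0)] at h
  simp only [base_mk, mid_mk, dual_mk, map_zero, add_zero] at h
  exact h

/-- The isomorphism of triples induced by an isomorphism of standard models. -/
def tripleIso (hF : PreservesDual F) (hF' : PreservesDual F.symm) : TripleIso M₁ M₂ where
  S :=
    { baseMap F with
      map_lie' := fun {x y} => baseMap_lie hF' x y
      invFun := baseMap F.symm
      left_inv := baseMap_symm_baseMap hF
      right_inv := baseMap_symm_baseMap (F := F.symm) hF' }
  U :=
    { midMap F.symm with
      invFun := midMap F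
      left_inv := midMap_symm_midMap (F := F.symm) hF
      right_inv := midMap_symm_midMap hF' }
  S_comm := baseMap_invol
  U_comm := midMap_invol
  U_isometry := midMap_isometry (F := F.symm) hF
  equivariant x a := by
    refine (midMap_lie (F := F.symm) hF' hF (baseMap F x) a).trans ?_
    rw [baseMap_symm_baseMap hF]
    rfl

/-- The off-diagonal block `𝔩₁ → 𝔞₂`, moved to `𝔞₁` by `U`, is `τ`. Compatibility of `F` with
brackets of elements of `𝔩₁` gives the relation for `α` in the `𝔞`-component and the relation for
`γ` in the `𝔩^*`-component. -/
theorem cohomologous_tripleIso (hF : PreservesDual F) (hF' : PreservesDual F.symm) :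
    Cohomologous M₁ ((tripleIso hF hF').pullCocycle c₂) c₁ := by
  set T := tripleIso hF hF' with hT
  have hU (a : A₁) : T.U (midMap F a) = a := midMap_symm_midMap hF' a
  have hS (x : L₁) : T.S x = baseMap F x := rfl
  have hf (a b : A₂) : M₁.form (T.U a) (T.U b) = M₂.form a b := T.U_isometry a b
  -- The symmetric part of `baseDualMap F` is `-½⟨τ·, τ·⟩`; adding `½⟨τ·, τ·⟩` leaves an alternating
  -- form.
  let σ : twoCochain ℝ L₁ ℝ :=
    ⟨baseDualMap F + (1 / 2 : ℝ) • M₂.form.compl₁₂ (baseMidMap F) (baseMidMap F), fun x => by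
      have h := baseDualMap_symm hF' x x
      simp only [LinearMap.add_apply, LinearMap.smul_apply, LinearMap.compl₁₂_apply, smul_eq_mul]
      linarith⟩
  have hσ (x y : L₁) : σ x y = baseDualMap F x y
      + 1 / 2 * M₂.form (baseMidMap F x) (baseMidMap F y) := rfl
  have hdτ (x y : L₁) : d₁₂ ℝ L₁ A₁ ((T.U : A₂ →ₗ[ℝ] A₁) ∘ₗ baseMidMap F) x y
      = T.U (⁅baseMap F x, baseMidMap F y⁆ - ⁅baseMap F y, baseMidMap F x⁆
        - baseMidMap F ⁅x, y⁆) := by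
    rw [d₁₂_apply_apply, map_sub, map_sub, ← hS, ← hS, T.equivariant, T.equivariant]
    rfl
  refine ⟨(T.U : A₂ →ₗ[ℝ] A₁) ∘ₗ baseMidMap F, σ, fun x => ?_, fun x y => ?_, ?_, fun x y z => ?_⟩
  · change M₁.invol (T.U (baseMidMap F (θ₁ x))) = T.U (baseMidMap F x)
    rw [← T.U_comm, baseMidMap_invol, M₂.involutive]
  · rw [hσ, hσ, baseDualMap_invol, baseMidMap_invol, baseMidMap_invol, M₂.isometry]
  · apply Subtype.ext
    ext x y
    change c₁.α x y = T.U (c₂.α (baseMap F x) (baseMap F y)) + d₁₂ ℝ L₁ A₁ _ x y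
    rw [hdτ, ← map_add, ← midMap_alpha hF, hU]
  · have hw (x y : L₁) : ((T.pullCocycle c₂).α
        + (1 / 2 : ℝ) • d₁₂ ℝ L₁ A₁ ((T.U : A₂ →ₗ[ℝ] A₁) ∘ₗ baseMidMap F)) x y
        = T.U (c₂.α (baseMap F x) (baseMap F y) + (1 / 2 : ℝ) • (⁅baseMap F x, baseMidMap F y⁆
          - ⁅baseMap F y, baseMidMap F x⁆ - baseMidMap F ⁅x, y⁆)) := by
      rw [add_apply_apply, smul_apply_apply, hdτ, map_add, map_smul]
      rfl
    have hτ (x : L₁) : ((T.U : A₂ →ₗ[ℝ] A₁) ∘ₗ baseMidMap F) x = T.U (baseMidMap F x) := rfl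
    have h := gamma_eq hF hF' x y z
    rw [midMap_alpha hF] at h
    change _ = c₂.γ.1 (baseMap F x) (baseMap F y) (baseMap F z) + _ + _
    simp only [dTwo, wedgeTwoOne, hσ, hw, hτ, hf]
    have i (u : L₂) (p q : A₂) : M₂.form ⁅u, p⁆ q = - M₂.form ⁅u, q⁆ p := by
      rw [M₂.symm ⁅u, q⁆ p, M₂.form_lie]
    have h1 := baseDualMap_symm hF' y ⁅x, z⁆
    have h2 := baseDualMap_symm hF' x ⁅y, z⁆
    simp only [map_add, map_sub, map_smul, LinearMap.add_apply, LinearMap.sub_apply,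
      LinearMap.smul_apply, smul_eq_mul] at h ⊢
    rw [i (baseMap F x) (baseMidMap F z) (baseMidMap F y),
      i (baseMap F y) (baseMidMap F z) (baseMidMap F x),
      i (baseMap F z) (baseMidMap F y) (baseMidMap F x)]
    linarith [M₂.symm (c₂.α (baseMap F x) (baseMap F z)) (baseMidMap F y),
      M₂.symm (c₂.α (baseMap F y) (baseMap F z)) (baseMidMap F x),
      M₂.symm (baseMidMap F ⁅x, z⁆) (baseMidMap F y),
      M₂.symm (baseMidMap F ⁅y, z⁆) (baseMidMap F x)]

end

/-- Standard models of admissible cocycles are isomorphic if and only if the cocycles correspond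
to each other under an isomorphism of triples. -/
theorem nonempty_iso_iff_of_isAdmissibleCocycle (h₁ : IsAdmissibleCocycle c₁)
    (h₂ : IsAdmissibleCocycle c₂) :
    Nonempty ((stdModel c₁).Iso (stdModel c₂)) ↔
      ∃ T : TripleIso M₁ M₂, T.pullback c₂.cls = c₁.cls := by
  constructor
  · rintro ⟨F⟩
    have hF := preservesDual h₁ h₂ F
    have hF' := preservesDual h₂ h₁ F.symm
    exact ⟨tripleIso hF hF', Quotient.sound (cohomologous_tripleIso hF hF')⟩
  · rintro ⟨T, hT⟩
    obtain ⟨F⟩ := nonempty_iso_of_cohomologous (M := M₁) (Quotient.exact hT)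
    exact ⟨F.trans (pullIso T c₂)⟩

end Triples

end StdModel

/-! ### Symmetric triples -/

namespace LieInvolution

variable {L : Type*} [LieRing L] [LieAlgebra ℝ L] {θ : LieInvolution L}

theorem mem_plus {x : L} : x ∈ θ.plus ↔ θ x = x := by
  rw [plus, Module.End.mem_eigenspace_iff, one_smul]
  rfl

theorem mem_minus {x : L} : x ∈ θ.minus ↔ θ x = -x := by
  rw [minus, Module.End.mem_eigenspace_iff, neg_one_smul]
  rfl

theorem lie_mem_plus {x y : L} (hx : x ∈ θ.minus) (hy : y ∈ θ.minus) : ⁅x, y⁆ ∈ θ.plus := by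
  rw [mem_minus] at hx hy
  rw [mem_plus, LieHom.map_lie, hx, hy, neg_lie, lie_neg, neg_neg]

theorem lie_mem_minus {x y : L} (hx : x ∈ θ.plus) (hy : y ∈ θ.minus) : ⁅x, y⁆ ∈ θ.minus := by
  rw [mem_plus] at hx
  rw [mem_minus] at hy
  rw [mem_minus, LieHom.map_lie, hx, hy, lie_neg]

variable (θ) in
theorem exists_plus_add_minus (x : L) : ∃ y ∈ θ.plus, ∃ z ∈ θ.minus, y + z = x := by
  refine ⟨(1 / 2 : ℝ) • (x + θ x), mem_plus.2 ?_, (1 / 2 : ℝ) • (x - θ x), mem_minus.2 ?_, ?_⟩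
  · rw [map_smul, map_add, θ.involutive, add_comm]
  · rw [map_smul, map_sub, θ.involutive, ← smul_neg, neg_sub]
  · module

/-- Under `(T₁)` the algebra is spanned by `𝔩₋` and `[𝔩₋, 𝔩₋]`. -/
theorem BracketMinusEqPlus.induction (h : θ.BracketMinusEqPlus) {p : L → Prop}
    (add : ∀ x y, p x → p y → p (x + y)) (smul : ∀ (t : ℝ) x, p x → p (t • x))
    (minus : ∀ x ∈ θ.minus, p x)
    (bracket : ∀ x ∈ θ.minus, ∀ y ∈ θ.minus, p ⁅x, y⁆) (x : L) : p x := by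
  obtain ⟨y, hy, z, hz, rfl⟩ := θ.exists_plus_add_minus x
  refine add _ _ ?_ (minus z hz)
  rw [← h] at hy
  induction hy using Submodule.span_induction with
  | mem w hw =>
    obtain ⟨u, hu, v, hv, rfl⟩ := hw
    exact bracket u hu v hv
  | zero => exact minus 0 (zero_mem _)
  | add u v _ _ hu hv => exact add u v hu hv
  | smul t u _ hu => exact smul t u hu

end LieInvolution

namespace MetricInvolution

open LieInvolution

variable {G : Type*} [LieRing G] [LieAlgebra ℝ G] [FiniteDimensional ℝ G]
  {m : MetricInvolution G}

theorem form_plus_minus {x y : G} (hx : x ∈ m.invol.plus) (hy : y ∈ m.invol.minus) :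
    m.form x y = 0 := by
  have h := m.isometry x y
  rw [mem_plus.1 hx, mem_minus.1 hy, map_neg] at h
  linarith

/-- For metric Lie algebras with involution, faithfulness implies `[𝔤₋, 𝔤₋] = 𝔤₊`. -/
theorem isSymmetricTriple_of_faithful (h : m.invol.PlusFaithfulOnMinus) : m.IsSymmetricTriple := by
  refine ⟨le_antisymm (Submodule.span_le.2 ?_) fun y hy => ?_, h⟩
  · rintro _ ⟨x, hx, y, hy, rfl⟩
    exact lie_mem_plus hx hy
  set H := Submodule.span ℝ {z : G | ∃ x ∈ m.invol.minus, ∃ y ∈ m.invol.minus, ⁅x, y⁆ = z}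
  -- By double orthogonality it suffices that `H^⊥ ⊆ 𝔤₋`: the `𝔤₊`-part of an element of `H^⊥`
  -- commutes with `𝔤₋` by invariance, so faithfulness kills it.
  rw [← LinearMap.BilinForm.orthogonal_orthogonal m.nondegenerate m.isRefl H]
  intro z hz
  obtain ⟨u, hu, v, hv, rfl⟩ := m.invol.exists_plus_add_minus z
  have hu0 : u = 0 := by
    refine h u hu fun a ha => m.nondegenerate.1 _ fun w => ?_
    obtain ⟨w₁, hw₁, w₂, hw₂, rfl⟩ := m.invol.exists_plus_add_minus w
    have h1 : m.form ⁅a, w₂⁆ (u + v) = 0 := hz _ (Submodule.subset_span ⟨a, ha, w₂, hw₂, rfl⟩)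
    rw [map_add, form_plus_minus (lie_mem_plus ha hw₂) hv, add_zero, m.symm] at h1
    rw [map_add, m.symm _ w₁, form_plus_minus hw₁ (lie_mem_minus hu ha), zero_add, ← lie_skew,
      map_neg, LinearMap.neg_apply, m.lieInvariant, h1, neg_zero, neg_zero]
  rw [hu0, zero_add]
  change m.form v y = 0
  rw [m.symm]
  exact form_plus_minus hy hv

theorem Iso.isSymmetricTriple {G₂ : Type*} [LieRing G₂] [LieAlgebra ℝ G₂]
    [FiniteDimensional ℝ G₂] {m₂ : MetricInvolution G₂} (F : m.Iso m₂)
    (h : m.IsSymmetricTriple) : m₂.IsSymmetricTriple := by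
  refine isSymmetricTriple_of_faithful fun x hx h0 => ?_
  obtain ⟨x, rfl⟩ : ∃ y, F.toEquiv y = x := F.toEquiv.surjective x
  have hx' : x ∈ m.invol.plus := by
    rw [mem_plus, ← F.comm] at hx
    exact mem_plus.2 (F.toEquiv.injective hx)
  have h1 := h.2 x hx' fun y hy => ?_
  · rw [h1, map_zero]
  · have h2 := h0 (F.toEquiv y) (mem_minus.2 (by rw [← F.comm, mem_minus.1 hy, map_neg]))
    rw [← LieEquiv.map_lie] at h2
    exact F.toEquiv.injective (h2.trans (map_zero _).symm)

end MetricInvolution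

namespace StdModel

open LieInvolution

variable {L : Type*} [LieRing L] [LieAlgebra ℝ L] {θ : LieInvolution L}
variable {A : Type*} [AddCommGroup A] [Module ℝ A] [FiniteDimensional ℝ A]
  [LieRingModule L A] [LieModule ℝ L A] {M : OrthogonalModule θ A} {c : QuadraticCocycle M}

theorem invol_lie (M : OrthogonalModule θ A) (x : L) (a : A) :
    M.invol ⁅x, a⁆ = ⁅θ x, M.invol a⁆ := by
  rw [← M.compat, θ.involutive]

/-- A central element of `𝔩` which kills `𝔞₋` acts trivially on `𝔞`. -/
theorem lie_eq_zero_of_forall_minus (hT : θ.BracketMinusEqPlus) (hA : IsSemisimpleLieModule L A)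
    {u : L} (hcen : ∀ x : L, ⁅u, x⁆ = 0)
    (h : ∀ a : A, M.invol a = -a → ⁅u, a⁆ = 0) (a : A) : ⁅u, a⁆ = 0 := by
  have hswap (x : L) (a : A) : ⁅u, ⁅x, a⁆⁆ = ⁅x, ⁅u, a⁆⁆ := by
    rw [leibniz_lie, hcen, zero_lie, zero_add]
  -- An element `x ∈ 𝔩₋` maps `𝔞₊` into `𝔞₋`, where `u` acts by zero, and `u` kills `𝔞₋` directly;
  -- since `u` and `x` commute, `ρ(x)ρ(u) = 0`.
  have hm (x : L) (hx : x ∈ θ.minus) (a : A) : ⁅x, ⁅u, a⁆⁆ = 0 := by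
    have ha : a = (1 / 2 : ℝ) • (a + M.invol a) + (1 / 2 : ℝ) • (a - M.invol a) := by module
    have h1 : ⁅u, ⁅x, (1 / 2 : ℝ) • (a + M.invol a)⁆⁆ = 0 := by
      apply h
      rw [invol_lie, mem_minus.1 hx, map_smul, map_add, M.involutive, neg_lie, add_comm a]
    have h2 : ⁅u, (1 / 2 : ℝ) • (a - M.invol a)⁆ = 0 := by
      apply h
      rw [map_smul, map_sub, M.involutive, ← smul_neg, neg_sub]
    rw [ha, lie_add, h2, add_zero, ← hswap, h1]
  have hinv (x : L) : ∀ a : A, ⁅x, ⁅u, a⁆⁆ = 0 := by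
    refine hT.induction (p := fun x => ∀ a : A, ⁅x, ⁅u, a⁆⁆ = 0) (fun x y hx hy a => ?_)
      (fun t x hx a => ?_) hm (fun x hx y hy a => ?_) x
    · rw [add_lie, hx, hy, add_zero]
    · rw [smul_lie, hx, smul_zero]
    · rw [lie_lie, hm x hx a, hm y hy a, lie_zero, lie_zero, sub_zero]
  -- The vector `ρ(u)a` is invariant, and by skewness orthogonal to every invariant.
  refine M.eq_zero_of_invariant hA (fun x => hinv x a) fun b hb => ?_
  rw [M.form_lie, hb, map_zero, neg_zero]

/-- Commuting with `𝔩₋` passes to `[𝔩₋, 𝔩₋]` one component at a time, because `[x, y]` in `𝔡`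
differs from `[x, y]_𝔩` by terms in `𝔞` and `𝔩^*`. Centrality of `X.base` in `𝔩` gives `[X, 𝔩^*] =
0`, and its trivial action on `𝔞` makes the `𝔞`-component of `[X, 𝔩]` vanish. By duality `[X, 𝔞] =
0`, and finally `[X, 𝔩] = 0`. -/
theorem central_of_lie_minus (hT : θ.BracketMinusEqPlus) (hA : IsSemisimpleLieModule L A)
    {X : StdModel c}
    (hL : ∀ x ∈ θ.minus, ⁅X, (mk 0 0 x : StdModel c)⁆ = 0)
    (hM : ∀ a : A, M.invol a = -a → ⁅X, (mk 0 a 0 : StdModel c)⁆ = 0) (Y : StdModel c) :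
    ⁅X, Y⁆ = 0 := by
  have hadd (x y : L) : (mk 0 0 (x + y) : StdModel c) = mk 0 0 x + mk 0 0 y := by ext <;> simp
  have hsmul (t : ℝ) (x : L) : (mk 0 0 (t • x) : StdModel c) = t • mk 0 0 x := by ext <;> simp
  have hbr {x y : L} (hx : x ∈ θ.minus) (hy : y ∈ θ.minus) :
      ⁅X, mk (c.γ.1 x y) 0 0⁆ + ⁅X, mk 0 (c.α x y) 0⁆ + ⁅X, (mk 0 0 ⁅x, y⁆ : StdModel c)⁆ = 0 := by
    rw [← lie_add, ← lie_add, ← lie_mk_mk, leibniz_lie, hL x hx, hL y hy, zero_lie, lie_zero,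
      add_zero]
  have hcen (x : L) : ⁅X.base, x⁆ = 0 := by
    refine hT.induction (p := fun x => ⁅X.base, x⁆ = 0) (fun x y hx hy => ?_) (fun t x hx => ?_)
      (fun x hx => congrArg base (hL x hx)) (fun x hx y hy => ?_) x
    · rw [lie_add, hx, hy, add_zero]
    · rw [lie_smul, hx, smul_zero]
    · have h := congrArg base (hbr hx hy)
      simpa using h
  have hdual (Z : Module.Dual ℝ L) : ⁅X, (mk Z 0 0 : StdModel c)⁆ = 0 := by
    ext w
    · simp [dual_lie, hcen]
    · simp
    · simp
  have hρ (a : A) : ⁅X.base, a⁆ = 0 :=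
    lie_eq_zero_of_forall_minus (M := M) hT hA hcen
      (fun a ha => by simpa using congrArg mid (hM a ha)) a
  have hmid (x : L) : (⁅X, (mk 0 0 x : StdModel c)⁆ : StdModel c).mid = 0 := by
    refine hT.induction (p := fun x => (⁅X, (mk 0 0 x : StdModel c)⁆ : StdModel c).mid = 0)
      (fun x y hx hy => ?_) (fun t x hx => ?_) (fun x hx => congrArg mid (hL x hx))
      (fun x hx y hy => ?_) x
    · rw [hadd, lie_add, mid_add, hx, hy, add_zero]
    · rw [hsmul, lie_smul, mid_smul, hx, smul_zero]
    · have h := congrArg mid (hbr hx hy)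
      rw [hdual, zero_add, mid_add] at h
      have h1 : (⁅X, (mk 0 (c.α x y) 0 : StdModel c)⁆ : StdModel c).mid = 0 := by simp [hρ]
      rwa [h1, zero_add] at h
  have hmk (a : A) : ⁅X, (mk 0 a 0 : StdModel c)⁆ = 0 := by
    ext w
    · have h := hmid w
      simp only [mid_lie, base_mk, mid_mk, lie_zero, add_zero] at h
      rw [sub_eq_zero] at h
      simp only [dual_lie, base_mk, mid_mk, dual_mk, map_zero, LinearMap.zero_apply, dual_zero,
        zero_lie, h]
      rw [M.symm a]
      ring
    · simp [hρ]
    · simp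
  have hbase (x : L) : ⁅X, (mk 0 0 x : StdModel c)⁆ = 0 := by
    refine hT.induction (p := fun x => ⁅X, (mk 0 0 x : StdModel c)⁆ = 0)
      (fun x y hx hy => ?_) (fun t x hx => ?_) hL (fun x hx y hy => ?_) x
    · rw [hadd, lie_add, hx, hy, add_zero]
    · rw [hsmul, lie_smul, hx, smul_zero]
    · have h := hbr hx hy
      rwa [hdual, hmk, zero_add, zero_add] at h
  have hY : Y = mk Y.dual 0 0 + mk 0 Y.mid 0 + mk 0 0 Y.base := by ext <;> simp
  rw [hY, lie_add, lie_add, hdual, hmk, hbase, add_zero, add_zero]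

variable [FiniteDimensional ℝ L]

/-- The standard model of an admissible cocycle is a symmetric triple. -/
theorem isSymmetricTriple_of_isAdmissibleCocycle (hc : IsAdmissibleCocycle c) :
    (stdModel c).IsSymmetricTriple := by
  refine MetricInvolution.isSymmetricTriple_of_faithful fun X hX h0 => ?_
  have hT := hc.bracket_eq
  rw [mem_plus, invol_apply] at hX
  have hXm : M.invol X.mid = X.mid := congrArg mid hX
  have hXd (y : L) : X.dual (θ y) = X.dual y := congrArg (fun W => W.dual y) hX
  have hcen (Y : StdModel c) : ⁅Y, X⁆ = 0 := by
    rw [← lie_skew, neg_eq_zero]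
    refine central_of_lie_minus hT hc.semisimple (fun x hx => h0 _ ?_) (fun a ha => h0 _ ?_) Y
    · rw [mem_minus, invol_apply]
      ext
      · simp
      · simp
      · simpa using mem_minus.1 hx
    · rw [mem_minus, invol_apply]
      ext
      · simp
      · simpa using ha
      · simp
  have hb := base_eq_zero_of_central hc hcen
  have ha := lie_mid_eq_zero_of_central hcen hb
  have hf := form_mid_of_central hcen hb
  have hm : X.mid = 0 := by
    refine M.eq_zero_of_invariant hc.semisimple ha fun b hbinv => ?_
    -- As `X.mid ∈ 𝔞₊`, its pairing with `b` is half of that with `b + θb`. This vector lies in `𝔞^𝔩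
    -- ∩ 𝔞₊`, where `(T₂)` applies.
    have h1 : b + M.invol b ∈ alphaZeroKer hc.semisimple c.α θ.minus := by
      rw [← hc.invariants_plus_eq]
      refine ⟨(LieModule.mem_maxTrivSubmodule ℝ L A _).2 fun x => ?_, ?_⟩
      · rw [lie_add, hbinv, ← M.compat, hbinv, map_zero, add_zero]
      · rw [SetLike.mem_coe, Module.End.mem_eigenspace_iff, one_smul, map_add, M.involutive,
          add_comm]
    have h2 := M.form_alphaZeroKer_eq_zero hc.semisimple ha (fun x _ y _ => hf x y) h1
    have h3 := M.isometry X.mid b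
    rw [hXm] at h3
    rw [map_add] at h2
    linarith
  ext y
  · refine hT.induction (p := fun y => X.dual y = 0) (fun x y hx hy => ?_) (fun t x hx => ?_)
      (fun x hx => ?_) (fun x _ y _ => ?_) y
    · rw [map_add, hx, hy, add_zero]
    · rw [map_smul, hx, smul_zero]
    · have h := hXd x
      rw [mem_minus.1 hx, map_neg] at h
      linarith
    · have h := hf x y
      rw [hm, map_zero, LinearMap.zero_apply] at h
      linarith
  · exact hm
  · exact hb

end StdModel

end SymTriple

end

theorem proposition5p1
    {L₁ : Type*} [LieRing L₁] [LieAlgebra ℝ L₁] [FiniteDimensional ℝ L₁]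
    {L₂ : Type*} [LieRing L₂] [LieAlgebra ℝ L₂] [FiniteDimensional ℝ L₂]
    {A₁ : Type*} [AddCommGroup A₁] [Module ℝ A₁] [FiniteDimensional ℝ A₁]
    [LieRingModule L₁ A₁] [LieModule ℝ L₁ A₁]
    {A₂ : Type*} [AddCommGroup A₂] [Module ℝ A₂] [FiniteDimensional ℝ A₂]
    [LieRingModule L₂ A₂] [LieModule ℝ L₂ A₂]
    (θ₁ : LieInvolution L₁) (hθ₁ : θ₁.IsAdmissible)
    (θ₂ : LieInvolution L₂) (hθ₂ : θ₂.IsAdmissible)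
    (M₁ : OrthogonalModule θ₁ A₁) (M₂ : OrthogonalModule θ₂ A₂)
    (c₁ : QuadraticCocycle M₁) (hc₁ : c₁.cls ∈ admissibleClasses M₁)
    (c₂ : QuadraticCocycle M₂) (hc₂ : c₂.cls ∈ admissibleClasses M₂) :
    (stdModel c₁).IsSymmetricTriple ∧ (stdModel c₂).IsSymmetricTriple ∧
    (Nonempty ((stdModel c₁).Iso (stdModel c₂)) ↔
      ∃ T : TripleIso M₁ M₂, T.pullback c₂.cls = c₁.cls) := by
  obtain ⟨c₁', h₁, hc₁'⟩ := hc₁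
  obtain ⟨c₂', h₂, hc₂'⟩ := hc₂
  -- Admissibility is known only for some representative of each class; cohomologous cocycles have
  -- isomorphic standard models, so everything transfers.
  obtain ⟨F₁⟩ := StdModel.nonempty_iso_of_cohomologous (Quotient.exact h₁.symm)
  obtain ⟨F₂⟩ := StdModel.nonempty_iso_of_cohomologous (Quotient.exact h₂.symm)
  refine ⟨F₁.isSymmetricTriple (StdModel.isSymmetricTriple_of_isAdmissibleCocycle hc₁'),
    F₂.isSymmetricTriple (StdModel.isSymmetricTriple_of_isAdmissibleCocycle hc₂'), ?_⟩
  rw [← h₁, ← h₂, ← StdModel.nonempty_iso_iff_of_isAdmissibleCocycle hc₁' hc₂']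
  exact ⟨fun ⟨F⟩ => ⟨(F₁.trans F).trans F₂.symm⟩, fun ⟨F⟩ => ⟨(F₁.symm.trans F).trans F₂⟩⟩
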